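/- **Setting.** Let $\psi_{x,a}$ ($x\in\mathbb Z$, $a\in\{1,2,3,4\}$) be fermionic field operators on Fock space with vacuum $|\Omega\rangle$. Let $\mathcal F(\psi^\dagger_{x,a})=\psi^\dagger_{x+1,a}$ for $a\in\{1,4\}$ and $\mathcal F(\psi^\dagger_{x,a})=\psi^\dagger_{x-1,a}$ for $a\in\{2,3\}$ (massless Dirac automaton in one dimension). For $\lambda\in\mathbb C$ let $O_x=\psi_{x,2}\psi_{x,3}^\dagger\psi_{x,3}\psi_{x,4}^\dagger+\psi_{x,1}\psi_{x,3}^\dagger\psi_{x,4}^\dagger\psi_{x,4}$, $J_x=\lambda O_x+\bar\lambda O_x^\dagger$, $\mathcal J(X)=e^{-i\sum_xJ_x}Xe^{i\sum_xJ_x}$ (on operators localized at finitely many sites, the sum over any finite set of sites containing them gives the same result), and $\mathcal A=\mathcal J\circ\mathcal F$. Assume $\sqrt2|\lambda|\ne2n\pi$ for all $n\in\mathbb Z$. On $\mathcal H_1\otimes\mathcal H_1$, with orthonormal basis $|a_1\rangle|a_2\rangle|x_1\rangle|x_2\rangle$, let $\mathbf P_-=\frac12(\mathbf I-\mathbf S)$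 with $\mathbf S$ the swap of the particles, let $\mathbf F$ be the one-particle operator $|x,a\rangle\mapsto|x\pm1,a\rangle$ of $\mathcal F$, and let $\mathbf J=\exp\big(-i(\lambda\mathbf O+\bar\lambda\mathbf O^\dagger)\otimes\sum_x|x\rangle\langle x|\otimes|x\rangle\langle x|\big)$ with $$\mathbf O=-\big(|3\rangle\langle1|\otimes|4\rangle\langle4|+|3\rangle\langle3|\otimes|4\rangle\langle2|+|4\rangle\langle2|\otimes|3\rangle\langle3|+|4\rangle\langle4|\otimes|3\rangle\langle1|\big),$$ and $\mathbf A_2=\mathbf P_-\,\mathbf J(\mathbf F\otimes\mathbf F)\,\mathbf P_-$. Put $e_1=|1\rangle|4\rangle$, $e_2=|3\rangle|2\rangle$, $e_3=|3\rangle|4\rangle$, $e_4=|4\rangle|1\rangle$, $e_5=|2\rangle|3\rangle$, $e_6=|4\rangle|3\rangle$, let $\mathbf Q$ be the projector onto the span of these internal states (tensored with all positions), and let $\widetilde{\mathbf A}_2=\mathbf Q\mathbf A_2\mathbf Q$, $\widetilde{\mathbf A}_2^\perp=(\mathbf I-\mathbf Q)\mathbf A_2(\mathbf I-\mathbf Q)$.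 For $p\in\mathbb R$, on $\mathbb C^6\otimes\ell^2(\mathbb Z)$ with basis $|e_i\rangle|y\rangle$ let $\widetilde{\mathbf P}_-$ be the antisymmetric projector $\frac12(\mathbf I-\widetilde{\mathbf S})$, $\widetilde{\mathbf S}|e_i\rangle|y\rangle=|e_{i+3}\rangle|-y\rangle$ (indices mod 6), let $\widetilde{\mathbf D}_p=\mathrm{diag}(e^{2ip},e^{-2ip},T^{\dagger2},e^{2ip},e^{-2ip},T^2)$ with $T|y\rangle=|y+1\rangle$, and $\widetilde{\mathbf J}=\exp(-i(\lambda\widetilde{\mathbf O}+\bar\lambda\widetilde{\mathbf O}^\dagger))$ with $\widetilde{\mathbf O}=-(|e_3\rangle\langle e_1|+|e_3\rangle\langle e_2|+|e_6\rangle\langle e_4|+|e_6\rangle\langle e_5|)\otimes|0\rangle\langle0|$. Let $\widetilde{\mathbf A}_2(p)=\widetilde{\mathbf P}_-\widetilde{\mathbf J}\widetilde{\mathbf D}_p\widetilde{\mathbf P}_-$. Let $\widetilde{\mathbf P}_a,\widetilde{\mathbf P}_b,\widetilde{\mathbf P}_c,\widetilde{\mathbf P}_d$ be the orthogonal projectors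 onto the closed spans of $\{|e_1\rangle|y\rangle-|e_4\rangle|-y\rangle:y\neq0\}$, of $\{|e_2\rangle|y\rangle-|e_5\rangle|-y\rangle:y\ne0\}$, of $\{|e_3\rangle|2y+1\rangle-|e_6\rangle|-2y-1\rangle:y\in\mathbb Z\}$, and onto the orthogonal complement of these three spaces in the range of $\widetilde{\mathbf P}_-$. Let $$\phi_f(k)=\tfrac{1}{\sqrt{4\pi}}\sum_{y\in\mathbb Z}e^{-iky}\big(|e_3\rangle|2y+1\rangle-|e_6\rangle|-2y-1\rangle\big),$$ $$N_k\phi_s(k)=\sum_{y\ge1}\overline{c_k}\,e^{-iyk}\big(|e_3\rangle|2y\rangle-|e_6\rangle|-2y\rangle\big)+\sum_{y\le0}c_k\,e^{-iyk}\big(|e_3\rangle|2y\rangle-|e_6\rangle|-2y\rangle\big)+\big(d_k^+(|e_1\rangle-|e_4\rangle)+d_k^-(|e_2\rangle-|e_5\rangle)\big)|0\rangle,$$ $$c_k=\cos(\sqrt2|\lambda|)(e^{-ik}-\cos2p)+(e^{ik}-\cos2p),\qquad d_k^\pm=\frac{i\bar\lambda\sin(\sqrt2|\lambda|)}{\sqrt2|\lambda|}\,(e^{-ik}-e^{\mp2ip}),\qquad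 N_k=\sqrt{4\pi}\,|c_k|$$ (with $\phi_s(k):=0$ at the at most three exceptional $k\in[-\pi,\pi]$ with $c_k=0$), and $$\phi_{b0}=\tfrac12(|e_1\rangle-|e_4\rangle-|e_2\rangle+|e_5\rangle)|0\rangle,\qquad \phi_{b\pm}=\tfrac12\big(e^{-ip}(|e_1\rangle-|e_4\rangle)\pm e^{ip}(|e_2\rangle-|e_5\rangle)\big)|0\rangle .$$ **Statement.** 1. $\mathbf A_2$ is unitary on the range of $\mathbf P_-$ and describes one step of $\mathcal A$ in the two-particle sector: the map $W:|m_1\rangle|m_2\rangle\mapsto\frac1{\sqrt2}\psi^\dagger_{m_1}\psi^\dagger_{m_2}|\Omega\rangle$ is a partial isometry with $W^\dagger W=\mathbf P_-$ onto the two-particle sector of Fock space, and $\frac1{\sqrt2}\mathcal A(\psi^\dagger_{m_1})\mathcal A(\psi^\dagger_{m_2})|\Omega\rangle=W\mathbf A_2|m_1\rangle|m_2\rangle$ for all modes $m_1,m_2$. 2. $[\mathbf A_2,\mathbf Q]=0$, $\mathbf A_2=\widetilde{\mathbf A}_2+\widetilde{\mathbf A}_2^\perp$, and $\widetilde{\mathbf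 A}_2^\perp=(\mathbf I-\mathbf Q)\mathbf P_-(\mathbf F\otimes\mathbf F)\mathbf P_-(\mathbf I-\mathbf Q)$ is a free evolution. 3. $\widetilde{\mathbf A}_2=\int_{-\pi}^{\pi}dp\,\widetilde{\mathbf A}_2(p)\otimes|p\rangle\langle p|$. Precisely: embed the range of $\mathbf Q$ isometrically by $|e_i\rangle|x_1\rangle|x_2\rangle\mapsto|e_i\rangle|y\rangle|z\rangle$, $y=x_1-x_2$, $z=x_1+x_2$, into the extended space where $(y,z)$ runs over $\mathbb Z^2$, and apply the unitary $|e_i\rangle|y\rangle|z\rangle\mapsto\big(p\mapsto(2\pi)^{-1/2}e^{ipz}|e_i\rangle|y\rangle\big)$ onto $L^2((-\pi,\pi];\mathbb C^6\otimes\ell^2(\mathbb Z))$. Then $\widetilde{\mathbf A}_2$ acts as $\widetilde{\mathbf A}_2(p)$ on the fibre at almost every $p$. 4. For every $p\in\mathbb R$: $\widetilde{\mathbf P}_a+\widetilde{\mathbf P}_b+\widetilde{\mathbf P}_c+\widetilde{\mathbf P}_d=\widetilde{\mathbf P}_-$, and $$\widetilde{\mathbf A}_2(p)=e^{2ip}\widetilde{\mathbf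 P}_a+e^{-2ip}\widetilde{\mathbf P}_b+\widetilde{\mathbf B}+\int_{-\pi}^{\pi}dk\,e^{-ik}\big(|\phi_f(k)\rangle\langle\phi_f(k)|+|\phi_s(k)\rangle\langle\phi_s(k)|\big)$$ weakly, where $$\widetilde{\mathbf B}=\begin{cases}(-1)^{n'}|\phi_{b0}\rangle\langle\phi_{b0}|&\text{if }\sqrt2|\lambda|\notin\pi\mathbb Z\text{ and }2p=n'\pi,\ n'\in\mathbb Z,\\ |\phi_{b-}\rangle\langle\phi_{b-}|-|\phi_{b+}\rangle\langle\phi_{b+}|&\text{if }\sqrt2|\lambda|=(2n+1)\pi,\ n\in\mathbb Z,\\0&\text{otherwise.}\end{cases}$$ Here $\phi_f(k)$ and $\phi_s(k)$ are improper eigenvectors of $\widetilde{\mathbf A}_2(p)$ with eigenvalue $e^{-ik}$, and the bound states occurring in $\widetilde{\mathbf B}$ are orthonormal eigenvectors of $\widetilde{\mathbf A}_2(p)$ in the range of $\widetilde{\mathbf P}_d$, with eigenvalues $(-1)^{n'}$ for $\phi_{b0}$ and $\mp1$ for $\phi_{b\pm}$. The improper eigenvectors are normalized, $\langle\phi_f(k)|\phi_f(k')\rangle=\langle\phi_s(k)|\phi_s(k')\rangle=\delta(k-k')$,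 and complete: $\int_{-\pi}^{\pi}dk\,|\phi_f(k)\rangle\langle\phi_f(k)|=\widetilde{\mathbf P}_c$, and $\int_{-\pi}^{\pi}dk\,|\phi_s(k)\rangle\langle\phi_s(k)|$ is $\widetilde{\mathbf P}_d$ minus the projector onto the span of the bound states occurring in $\widetilde{\mathbf B}$. That is, $v\mapsto\langle\phi_f(\cdot)|v\rangle$ and $v\mapsto\langle\phi_s(\cdot)|v\rangle$ extend from finitely supported vectors to partial isometries onto $L^2(-\pi,\pi)$ with these initial projectors. -/

import Mathlib

open Complex MeasureTheory
open scoped ComplexConjugate InnerProductSpace InnerProduct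

namespace DiracFCA

noncomputable section

/-! ### Square-summable sequences and elementary operators on them -/

/-- The Hilbert space `ℓ²(ι)` with orthonormal basis `|i⟩`, `i : ι`. -/
abbrev EllTwo (ι : Type) := lp (fun _ : ι => ℂ) 2

/-- The basis vector `|i⟩`. -/
def ket {ι : Type} [DecidableEq ι] (i : ι) : EllTwo ι := lp.single 2 i (1 : ℂ)

open Classical in
theorem sum_pull_le {ι κ : Type} (s : Set ι) (f : ι → κ) (w : ι → ℂ)
    (hf : Set.InjOn f s) (hw : ∀ i ∈ s, ‖w i‖ ≤ 1) (v : EllTwo κ) (t : Finset ι) :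
    ∑ i ∈ t, ‖(if i ∈ s then w i * v (f i) else 0 : ℂ)‖ ^ (2 : ENNReal).toReal
      ≤ ‖v‖ ^ (2 : ENNReal).toReal := by
  have h2 : 0 < (2 : ENNReal).toReal := by norm_num
  calc ∑ i ∈ t, ‖(if i ∈ s then w i * v (f i) else 0 : ℂ)‖ ^ (2 : ENNReal).toReal
      = ∑ i ∈ t with i ∈ s, ‖w i * v (f i)‖ ^ (2 : ENNReal).toReal := by
        rw [Finset.sum_filter]
        refine Finset.sum_congr rfl fun i _ => ?_
        split_ifs
        · rfl
        · rw [norm_zero, Real.zero_rpow h2.ne']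
    _ ≤ ∑ i ∈ t with i ∈ s, ‖v (f i)‖ ^ (2 : ENNReal).toReal := by
        refine Finset.sum_le_sum fun i hi => ?_
        refine Real.rpow_le_rpow (norm_nonneg _) ?_ h2.le
        rw [norm_mul]
        exact mul_le_of_le_one_left (norm_nonneg _) (hw i (Finset.mem_filter.1 hi).2)
    _ = ∑ j ∈ (t.filter (· ∈ s)).image f, ‖v j‖ ^ (2 : ENNReal).toReal := by
        rw [Finset.sum_image]
        intro a ha b hb hab
        simp only [Finset.coe_filter, Set.mem_ofPred_eq] at ha hb
        exact hf ha.2 hb.2 hab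
    _ ≤ ‖v‖ ^ (2 : ENNReal).toReal := lp.sum_rpow_le_norm_rpow h2 v _

open Classical in
/-- The bounded operator `ℓ²(κ) → ℓ²(ι)` with `(A v)(i) = w i * v (f i)` for `i ∈ s` and
`(A v)(i) = 0` for `i ∉ s`; here `f` is injective on `s` and `|w| ≤ 1` on `s`. Shifts, swaps,
matrix units and field operators all have this form. -/
def weightedPull {ι κ : Type} (s : Set ι) (f : ι → κ) (w : ι → ℂ)
    (hf : Set.InjOn f s) (hw : ∀ i ∈ s, ‖w i‖ ≤ 1) : EllTwo κ →L[ℂ] EllTwo ι :=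
  LinearMap.mkContinuous
    { toFun := fun v => ⟨fun i => if i ∈ s then w i * v (f i) else 0,
        memℓp_gen' (sum_pull_le s f w hf hw v)⟩
      map_add' := fun v v' => by
        ext i
        change (if i ∈ s then w i * (v (f i) + v' (f i)) else 0) =
          (if i ∈ s then w i * v (f i) else 0) + (if i ∈ s then w i * v' (f i) else 0)
        split_ifs <;> simp [mul_add]
      map_smul' := fun c v => by
        ext i
        by_cases h : i ∈ s <;> simp [h, mul_left_comm] }
    1
    (fun v => by
      rw [one_mul]
      exact lp.norm_le_of_forall_sum_le (by norm_num) (norm_nonneg _)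
        (sum_pull_le s f w hf hw v))

open Classical in
theorem weightedPull_apply {ι κ : Type} (s : Set ι) (f : ι → κ) (w : ι → ℂ)
    (hf : Set.InjOn f s) (hw : ∀ i ∈ s, ‖w i‖ ≤ 1) (v : EllTwo κ) (i : ι) :
    weightedPull s f w hf hw v i = if i ∈ s then w i * v (f i) else 0 := rfl

/-! ### The fermionic automaton on Fock space

Internal states `1, 2, 3, 4` are represented by `0, 1, 2, 3 : Fin 4`. -/

/-- A local mode `(x, a)`: site `x`, internal state `a`. -/
abbrev Mode := ℤ × Fin 4

/-- Fermionic Fock space, in the occupation number basis indexed by finite sets of modes. -/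
abbrev Fock := EllTwo (Finset Mode)

/-- The sign `(-1)^(number of elements of S before m)`, for the lexicographic order of modes. -/
def orderSign (S : Finset Mode) (m : Mode) : ℂ :=
  (-1) ^ (S.filter fun n => n.1 < m.1 ∨ (n.1 = m.1 ∧ n.2 < m.2)).card

/-- The field operator `ψ_m`: `ψ_m |S ∪ {m}⟩ = orderSign S m |S⟩` for `m ∉ S`, and
`ψ_m |S⟩ = 0` for `m ∉ S`. -/
def annihilate (m : Mode) : Fock →L[ℂ] Fock :=
  weightedPull {S | m ∉ S} (fun S => insert m S) (fun S => orderSign S m)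
    (fun S hS S' hS' h => by
      have h1 := congrArg (fun T : Finset Mode => T.erase m) h
      simpa [Finset.erase_insert hS, Finset.erase_insert hS'] using h1)
    (fun S _ => by simp [orderSign])

/-- The creation operator `ψ_m†`. -/
def create (m : Mode) : Fock →L[ℂ] Fock := (annihilate m)†

/-- The vacuum `|Ω⟩`. -/
def vacuum : Fock := ket ∅

/-- `O_x = ψ_{x,2} ψ†_{x,3} ψ_{x,3} ψ†_{x,4} + ψ_{x,1} ψ†_{x,3} ψ†_{x,4} ψ_{x,4}`. -/
def localO (x : ℤ) : Fock →L[ℂ] Fock :=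
  annihilate (x, 1) * create (x, 2) * annihilate (x, 2) * create (x, 3)
    + annihilate (x, 0) * create (x, 2) * create (x, 3) * annihilate (x, 3)

/-- `J_x = λ O_x + conj λ O_x†`. -/
def localJ (lam : ℂ) (x : ℤ) : Fock →L[ℂ] Fock :=
  lam • localO x + conj lam • (localO x)†

/-- The interaction step `X ↦ exp(-i ∑_{x ∈ Λ} J_x) X exp(i ∑_{x ∈ Λ} J_x)` with the sum cut off
to a finite set `Λ` of sites. On operators localized at sites of `Λ` the remaining
`J_x` have no effect, as they are even and localized elsewhere. -/
def interactionStep (lam : ℂ) (Λ : Finset ℤ) (X : Fock →L[ℂ] Fock) : Fock →L[ℂ] Fock :=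
  NormedSpace.exp ((-I) • ∑ x ∈ Λ, localJ lam x) * X *
    NormedSpace.exp (I • ∑ x ∈ Λ, localJ lam x)

/-- Direction of motion of the four internal states: `1, 4` move by `+1` and `2, 3` by `-1`. -/
def direction : Fin 4 → ℤ := ![1, -1, -1, 1]

/-- The massless Dirac step on modes; the free automaton is `ℱ(ψ†_m) = ψ†_(freeMode m)`. -/
def freeMode (m : Mode) : Mode := (m.1 + direction m.2, m.2)

/-- The automaton `𝒜 = 𝒥 ∘ ℱ` on the generators `ψ†_m` (interaction cut off to `Λ`). -/
def automaton (lam : ℂ) (Λ : Finset ℤ) (m : Mode) : Fock →L[ℂ] Fock :=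
  interactionStep lam Λ (create (freeMode m))

/-! ### The two-particle operators -/

/-- `ℋ₁ ⊗ ℋ₁ = ℓ²(Mode × Mode)`; the basis vector `|a₁⟩|a₂⟩|x₁⟩|x₂⟩` is
`ket ((x₁, a₁), (x₂, a₂))`. -/
abbrev PairSpace := EllTwo (Mode × Mode)

/-- The free evolution `𝐅 ⊗ 𝐅`, sending `|m₁⟩|m₂⟩` to `|freeMode m₁⟩|freeMode m₂⟩`. -/
def freePair : PairSpace →L[ℂ] PairSpace :=
  weightedPull Set.univ
    (fun q => ((q.1.1 - direction q.1.2, q.1.2), (q.2.1 - direction q.2.2, q.2.2)))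
    (fun _ => 1)
    (fun q _ q' _ h => by
      obtain ⟨⟨x, a⟩, ⟨y, b⟩⟩ := q
      obtain ⟨⟨x', a'⟩, ⟨y', b'⟩⟩ := q'
      simp only [Prod.mk.injEq] at h ⊢
      obtain ⟨⟨h1, rfl⟩, ⟨h2, rfl⟩⟩ := h
      exact ⟨⟨by linarith, rfl⟩, ⟨by linarith, rfl⟩⟩)
    (fun _ _ => by simp)

/-- The swap `𝐒` of the two particles. -/
def swapPair : PairSpace →L[ℂ] PairSpace :=
  weightedPull Set.univ Prod.swap (fun _ => 1)
    (Prod.swap_injective.injOn) (fun _ _ => by simp)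

/-- The antisymmetric projector `𝐏₋ = (𝐈 - 𝐒) / 2`. -/
def antiPair : PairSpace →L[ℂ] PairSpace := (1 / 2 : ℂ) • (1 - swapPair)

/-- `|a⟩⟨b| ⊗ |c⟩⟨d| ⊗ ∑_x |x⟩⟨x| ⊗ |x⟩⟨x|` (a strongly convergent sum). -/
def contactHop (a b c d : Fin 4) : PairSpace →L[ℂ] PairSpace :=
  weightedPull {q | q.1.1 = q.2.1 ∧ q.1.2 = a ∧ q.2.2 = c}
    (fun q => ((q.1.1, b), (q.2.1, d))) (fun _ => 1)
    (fun q hq q' hq' h => by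
      obtain ⟨⟨x, a⟩, ⟨y, b⟩⟩ := q
      obtain ⟨⟨x', a'⟩, ⟨y', b'⟩⟩ := q'
      simp only [Set.mem_ofPred_eq, Prod.mk.injEq] at h hq hq' ⊢
      obtain ⟨_, rfl, rfl⟩ := hq
      obtain ⟨_, rfl, rfl⟩ := hq'
      exact ⟨⟨h.1.1, rfl⟩, ⟨h.2.1, rfl⟩⟩)
    (fun _ _ => by simp)

/-- The two-particle form of `∑_x O_x`. The overall minus sign is that of
`O_x ψ†_{x,1} ψ†_{x,4} |Ω⟩ = -ψ†_{x,3} ψ†_{x,4} |Ω⟩`. -/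
def pairO : PairSpace →L[ℂ] PairSpace :=
  -(contactHop 2 0 3 3 + contactHop 2 2 3 1 + contactHop 3 1 2 2 + contactHop 3 3 2 0)

/-- The interaction `𝐉 = exp(-i ∑_x 𝐉_x)`. -/
def pairJ (lam : ℂ) : PairSpace →L[ℂ] PairSpace :=
  NormedSpace.exp ((-I) • (lam • pairO + conj lam • pairO†))

/-- `𝐀₂ = 𝐏₋ (𝐉 (𝐅 ⊗ 𝐅)) 𝐏₋`. -/
def pairA (lam : ℂ) : PairSpace →L[ℂ] PairSpace :=
  antiPair ∘L (pairJ lam ∘L freePair) ∘L antiPair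

/-- Internal states `e₁ = |1⟩|4⟩, e₂ = |3⟩|2⟩, e₃ = |3⟩|4⟩, e₄ = |4⟩|1⟩, e₅ = |2⟩|3⟩,
`e₆ = |4⟩|3⟩`, represented by `0, …, 5 : Fin 6`. -/
def relLabel : Fin 6 → Fin 4 × Fin 4 := ![(0, 3), (2, 1), (2, 3), (3, 0), (1, 2), (3, 2)]

/-- The projector `𝐐` onto the span of the internal states `e₁, …, e₆`. -/
def projQ : PairSpace →L[ℂ] PairSpace :=
  weightedPull {q | (q.1.2, q.2.2) ∈ Set.range relLabel} id (fun _ => 1)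
    (Function.injective_id.injOn) (fun _ _ => by simp)

/-- The nontrivial part `𝐐 𝐀₂ 𝐐`. -/
def nontrivialPart (lam : ℂ) : PairSpace →L[ℂ] PairSpace := projQ ∘L pairA lam ∘L projQ

/-- The complementary part `(𝐈 - 𝐐) 𝐀₂ (𝐈 - 𝐐)`. -/
def trivialPart (lam : ℂ) : PairSpace →L[ℂ] PairSpace :=
  (1 - projQ) ∘L pairA lam ∘L (1 - projQ)

/-! ### Relative coordinates -/

/-- The map `|e_i⟩|x₁⟩|x₂⟩ ↦ |e_i⟩|y⟩|z⟩`, `y = x₁ - x₂`, `z = x₁ + x₂`, into the extended space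
where `y` and `z` run freely over `ℤ` (zero on the other internal states). -/
def toRelative : PairSpace →L[ℂ] EllTwo (Fin 6 × ℤ × ℤ) :=
  weightedPull {q | Even (q.2.2 + q.2.1)}
    (fun q => (((q.2.2 + q.2.1) / 2, (relLabel q.1).1), ((q.2.2 - q.2.1) / 2, (relLabel q.1).2)))
    (fun _ => 1)
    (fun q hq q' hq' h => by
      obtain ⟨i, y, z⟩ := q
      obtain ⟨i', y', z'⟩ := q'
      have hinj : Function.Injective relLabel := by decide
      simp only [Set.mem_ofPred_eq, Prod.mk.injEq] at h hq hq' ⊢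
      obtain ⟨⟨h1, h2⟩, ⟨h3, h4⟩⟩ := h
      obtain ⟨r, hr⟩ := hq
      obtain ⟨r', hr'⟩ := hq'
      exact ⟨hinj (Prod.ext h2 h4), by omega, by omega⟩)
    (fun _ _ => by simp)

/-- Index `(i, y)` of the basis vector `|e_i⟩|y⟩`. -/
abbrev RelIndex := Fin 6 × ℤ

/-- `ℂ⁶ ⊗ ℓ²(ℤ)`: internal states and relative coordinate. -/
abbrev RelSpace := EllTwo RelIndex

/-- Lebesgue measure on `(-π, π]`. -/
def circleMeasure : Measure ℝ := volume.restrict (Set.Ioc (-Real.pi) Real.pi)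

/-- `|i⟩⟨j| ⊗ |0⟩⟨0|`. -/
def originHop (i j : Fin 6) : RelSpace →L[ℂ] RelSpace :=
  weightedPull {q | q = (i, 0)} (fun _ => (j, 0)) (fun _ => 1)
    (fun q hq q' hq' _ => by
      simp only [Set.mem_ofPred_eq] at hq hq'
      rw [hq, hq'])
    (fun _ _ => by simp)

/-- `∑_{i} |e_{i+3}⟩⟨e_i| ⊗ ∑_y |-y⟩⟨y|` (indices of `e` modulo 6). -/
def relSwap : RelSpace →L[ℂ] RelSpace :=
  weightedPull Set.univ (fun q => (q.1 + 3, -q.2)) (fun _ => 1)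
    (fun q _ q' _ h => by
      obtain ⟨i, y⟩ := q
      obtain ⟨i', y'⟩ := q'
      simp only [Prod.mk.injEq, add_left_inj, neg_inj] at h ⊢
      exact h)
    (fun _ _ => by simp)

/-- The antisymmetric projector on `ℂ⁶ ⊗ ℓ²(ℤ)`. -/
def relAnti : RelSpace →L[ℂ] RelSpace := (1 / 2 : ℂ) • (1 - relSwap)

/-- The free evolution
`diag(e^{2ip}, e^{-2ip}, T_y†², e^{2ip}, e^{-2ip}, T_y²)`, with `T_y |y⟩ = |y + 1⟩`. -/
def relFree (p : ℝ) : RelSpace →L[ℂ] RelSpace :=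
  weightedPull Set.univ
    (fun q => (q.1, q.2 + (![0, 0, 2, 0, 0, -2] : Fin 6 → ℤ) q.1))
    (fun q => (![exp (2 * I * p), exp (-2 * I * p), 1,
      exp (2 * I * p), exp (-2 * I * p), 1] : Fin 6 → ℂ) q.1)
    (fun q _ q' _ h => by
      obtain ⟨i, y⟩ := q
      obtain ⟨i', y'⟩ := q'
      simp only [Prod.mk.injEq] at h ⊢
      obtain ⟨rfl, h⟩ := h
      exact ⟨rfl, by simpa using h⟩)
    (fun q _ => by
      obtain ⟨i, y⟩ := q
      fin_cases i <;> simp [Complex.norm_exp])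

/-- The operator `-(|e₃⟩⟨e₁| + |e₃⟩⟨e₂| + |e₆⟩⟨e₄| + |e₆⟩⟨e₅|) ⊗ |0⟩⟨0|`. -/
def relO : RelSpace →L[ℂ] RelSpace :=
  -(originHop 2 0 + originHop 2 1 + originHop 5 3 + originHop 5 4)

/-- The interaction, localized at relative coordinate `0`. -/
def relJ (lam : ℂ) : RelSpace →L[ℂ] RelSpace :=
  NormedSpace.exp ((-I) • (lam • relO + conj lam • relO†))

/-- The evolution of the nontrivial part at total momentum `p`. -/
def relA (lam : ℂ) (p : ℝ) : RelSpace →L[ℂ] RelSpace :=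
  relAnti ∘L relJ lam ∘L relFree p ∘L relAnti

/-- The closed span of `|e₁⟩|y⟩ - |e₄⟩|-y⟩`, `y ≠ 0`. -/
def spaceA : Submodule ℂ RelSpace :=
  (Submodule.span ℂ {v | ∃ y : ℤ, y ≠ 0 ∧ v = ket (0, y) - ket (3, -y)}).topologicalClosure

/-- The closed span of `|e₂⟩|y⟩ - |e₅⟩|-y⟩`, `y ≠ 0`. -/
def spaceB : Submodule ℂ RelSpace :=
  (Submodule.span ℂ {v | ∃ y : ℤ, y ≠ 0 ∧ v = ket (1, y) - ket (4, -y)}).topologicalClosure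

/-- The closed span of `|e₃⟩|2y+1⟩ - |e₆⟩|-2y-1⟩`. -/
def spaceC : Submodule ℂ RelSpace :=
  (Submodule.span ℂ
    {v | ∃ y : ℤ, v = ket (2, 2 * y + 1) - ket (5, -2 * y - 1)}).topologicalClosure

/-- The orthogonal complement of the previous three spaces in the range of `relAnti`
(the fixed space of a projector). -/
def spaceD : Submodule ℂ RelSpace :=
  LinearMap.eqLocus (relAnti : RelSpace →ₗ[ℂ] RelSpace) LinearMap.id ⊓
    (spaceA ⊔ spaceB ⊔ spaceC)ᗮ

instance : CompleteSpace spaceA := Submodule.topologicalClosure.completeSpace _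

instance : CompleteSpace spaceB := Submodule.topologicalClosure.completeSpace _

instance : CompleteSpace spaceC := Submodule.topologicalClosure.completeSpace _

instance : CompleteSpace spaceD :=
  IsClosed.completeSpace_coe (hs := by
    refine IsClosed.inter ?_ (Submodule.isClosed_orthogonal _)
    exact isClosed_eq relAnti.continuous continuous_id)

/-! ### Improper and proper eigenvectors -/

/-- Formal components of
`φ_f(k) = (4π)^{-1/2} ∑_m e^{-ikm} (|e₃⟩|2m+1⟩ - |e₆⟩|-2m-1⟩)`. -/
def phiFree (k : ℝ) : RelIndex → ℂ := fun q =>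
  if Odd q.2 then
    ((Real.sqrt (4 * Real.pi) : ℝ) : ℂ)⁻¹ *
      (![0, 0, exp (-I * k * (((q.2 - 1) / 2 : ℤ) : ℂ)),
        0, 0, -exp (-I * k * (((-q.2 - 1) / 2 : ℤ) : ℂ))] : Fin 6 → ℂ) q.1
  else 0

/-- `√2 |λ|`. -/
def coupling (lam : ℂ) : ℝ := Real.sqrt 2 * ‖lam‖

/-- `c_k = cos(√2|λ|) (e^{-ik} - cos 2p) + (e^{ik} - cos 2p)`. -/
def scatC (lam : ℂ) (p k : ℝ) : ℂ :=
  (Real.cos (coupling lam) : ℂ) * (exp (-I * k) - (Real.cos (2 * p) : ℂ))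
    + (exp (I * k) - (Real.cos (2 * p) : ℂ))

/-- `d_k^± = i conj(λ) sin(√2|λ|) / (√2|λ|) (e^{-ik} - e^{∓2ip})`, where `s = ±1`. -/
def scatD (lam : ℂ) (p k s : ℝ) : ℂ :=
  I * conj lam * (Real.sin (coupling lam) : ℂ) / (coupling lam : ℂ)
    * (exp (-I * k) - exp (-2 * I * s * p))

/-- Coefficient of `|e₃⟩|2m⟩ - |e₆⟩|-2m⟩` in `N_k φ_s(k)`. -/
def scatAmplitude (lam : ℂ) (p k : ℝ) (m : ℤ) : ℂ :=
  (if 1 ≤ m then conj (scatC lam p k) else scatC lam p k) * exp (-I * m * k)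

/-- The normalization constant `N_k = (4π)^{1/2} |c_k|`. -/
def scatNorm (lam : ℂ) (p k : ℝ) : ℝ := Real.sqrt (4 * Real.pi) * ‖scatC lam p k‖

/-- Formal components of the scattering vector `φ_s(k)`. -/
def phiScat (lam : ℂ) (p k : ℝ) : RelIndex → ℂ := fun q =>
  (scatNorm lam p k : ℂ)⁻¹ *
    (![if q.2 = 0 then scatD lam p k 1 else 0,
      if q.2 = 0 then scatD lam p k (-1) else 0,
      if Even q.2 then scatAmplitude lam p k (q.2 / 2) else 0,
      if q.2 = 0 then -scatD lam p k 1 else 0,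
      if q.2 = 0 then -scatD lam p k (-1) else 0,
      if Even q.2 then -scatAmplitude lam p k (-q.2 / 2) else 0] : Fin 6 → ℂ) q.1

/-- `|φ_{b0}⟩ = (|e₁⟩ - |e₄⟩ - |e₂⟩ + |e₅⟩)|0⟩ / 2`. -/
def phiBound : RelSpace :=
  (1 / 2 : ℂ) • (ket (0, 0) - ket (3, 0) - ket (1, 0) + ket (4, 0))

/-- `|φ_{b-}⟩ = (e^{-ip}(|e₁⟩ - |e₄⟩) - e^{ip}(|e₂⟩ - |e₅⟩))|0⟩ / 2`. -/
def phiBoundMinus (p : ℝ) : RelSpace :=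
  (1 / 2 : ℂ) • (exp (-I * p) • (ket (0, 0) - ket (3, 0))
    - exp (I * p) • (ket (1, 0) - ket (4, 0)))

/-- `|φ_{b+}⟩ = (e^{-ip}(|e₁⟩ - |e₄⟩) + e^{ip}(|e₂⟩ - |e₅⟩))|0⟩ / 2`. -/
def phiBoundPlus (p : ℝ) : RelSpace :=
  (1 / 2 : ℂ) • (exp (-I * p) • (ket (0, 0) - ket (3, 0))
    + exp (I * p) • (ket (1, 0) - ket (4, 0)))

/-- The Hilbert space `L²(-π, π]` in the variable `k`. -/
abbrev MomentumSpace := Lp ℂ 2 circleMeasure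

/-- `φ(k)`, `k ∈ (-π, π]`, is a delta-normalized system of improper vectors, complete in the range
of the projector `P`, and `Φ v = (k ↦ ⟨φ(k)|v⟩)` is its expansion map:
`Φ Φ† = 1` says `⟨φ(k)|φ(k')⟩ = δ(k - k')`, and `Φ† Φ = P` says `∫ dk |φ(k)⟩⟨φ(k)| = P`. -/
def IsImproperBasis (φ : ℝ → RelIndex → ℂ) (P : RelSpace →L[ℂ] RelSpace)
    (Φ : RelSpace →L[ℂ] MomentumSpace) : Prop :=
  (∀ i : RelIndex, (Φ (ket i) : ℝ → ℂ) =ᵐ[circleMeasure] fun k => conj (φ k i)) ∧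
    Φ ∘L Φ† = ContinuousLinearMap.id ℂ MomentumSpace ∧ Φ† ∘L Φ = P

/-- `φ` is a formal eigenvector of `A`: `∑_j ⟨i|A|j⟩ φ_j = c φ_i` for all `i`. -/
def IsImproperEigenvector (A : RelSpace →L[ℂ] RelSpace) (c : ℂ) (φ : RelIndex → ℂ) : Prop :=
  ∀ i : RelIndex, HasSum (fun j => ⟪(ket i : RelSpace), A (ket j)⟫_ℂ * φ j) (c * φ i)

/-- The spectral resolution
`A(p) = e^{2ip} P_a + e^{-2ip} P_b + B + ∫ dk e^{-ik} (|φ_f(k)⟩⟨φ_f(k)| + |φ_s(k)⟩⟨φ_s(k)|)`,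
where `B = ∑ μ |φ⟩⟨φ|` over the list `bound` of pairs `(μ, φ)` of an eigenvalue and a bound state.
The integral is understood weakly. -/
def HasSpectralResolution (lam : ℂ) (p : ℝ) (bound : List (ℂ × RelSpace)) : Prop :=
  (∀ b ∈ bound, b.2 ∈ spaceD ∧ ‖b.2‖ = 1 ∧ relA lam p b.2 = b.1 • b.2) ∧
  bound.Pairwise (fun b b' => ⟪b.2, b'.2⟫_ℂ = 0) ∧
  (∀ k : ℝ, IsImproperEigenvector (relA lam p) (exp (-I * k)) (phiFree k)) ∧
  (∀ k : ℝ, IsImproperEigenvector (relA lam p) (exp (-I * k)) (phiScat lam p k)) ∧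
  ∃ Φf Φs : RelSpace →L[ℂ] MomentumSpace,
    IsImproperBasis phiFree spaceC.starProjection Φf ∧
    IsImproperBasis (phiScat lam p)
      (spaceD.starProjection - (bound.map fun b => InnerProductSpace.rankOne ℂ b.2 b.2).sum) Φs ∧
    ∀ u v : RelSpace,
      ⟪u, relA lam p v⟫_ℂ =
        exp (2 * I * p) * ⟪u, spaceA.starProjection v⟫_ℂ
        + exp (-2 * I * p) * ⟪u, spaceB.starProjection v⟫_ℂ
        + ⟪u, (bound.map fun b => b.1 • InnerProductSpace.rankOne ℂ b.2 b.2).sum v⟫_ℂ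
        + ∫ k, exp (-I * k) * (conj (Φf u k) * Φf v k + conj (Φs u k) * Φs v k) ∂circleMeasure

end

end DiracFCA

open DiracFCA

/-!
The automaton conserves the particle number and its interaction is on-site, so everything reduces
to finite-rank algebra at coinciding positions plus shifts.

*Two-particle sector.* The generator `H` of the interaction (on pairs, `pairH`; in the relative
coordinate, `relH`) satisfies `H³ = 2|λ|² H`, so `exp(-iH)` is a quadratic polynomial in `H`
(`exp_neg_I_smul_of_cube`). Normal ordering `O_x` shows that `pairToFock` intertwines `∑_x J_x`
with `pairH`, hence their exponentials; this gives `automaton_pair`. The polynomial is `1` outside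
the internal states `e₁, …, e₆`, so the complementary part is free (`trivialPart_eq`). Fourier
series in the total position give the unitary `fibreUnitary`. Relations of the form "`X` acts as
`Y p` on the fibre at `p`" are closed under products and linear combinations, so the fibre operator
of the step follows from those of shift, swap and generator (`actsFibrewise_nontrivialPart`).

*Fixed total momentum.* The range of `relAnti` is the orthogonal sum of four subspaces
(`sum_starProjection`). On `spaceA` and `spaceB` the step is a phase. On `spaceC` it is a shift,
diagonalized by Fourier series (`isImproperBasis_phiFree`). On `spaceD` it is a shift of the
vectors `g_m = (|e₃⟩|2m⟩ - |e₆⟩|-2m⟩)/√2` with a two-dimensional defect at the origin.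

The formal eigenvectors `φ_s(k)` define a bounded synthesis map `E : L²(-π, π] → spaceD`
(`scatSynthesis`). Its amplitudes at the origin are square integrable because `|d_k^±|` is bounded
by a multiple of `|c_k|`, and `c_k` vanishes only where `sin k = 0`. The eigenvector equation says
`A(p) E = E M` with `M` the multiplication by `e^{-ik}` (`relA_expansion_adjoint`). Instead of
computing inner products of improper eigenvectors, orthonormality and completeness are obtained
from scattering theory. Let `E₊` be the free synthesis map with the outgoing phase `c_k / |c_k|`.
For `n → ∞` one has `E Mⁿ f - E₊ Mⁿ f → 0`, since translation empties a half-line and inner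
products with `Mⁿ f` tend to zero. As `A(p)` is isometric on antisymmetric vectors,
`‖E f‖ = ‖E Mⁿ f‖` tends to `‖f‖`, so `E` is an isometry (`norm_eq_of_asymptotic`).
For `m ≤ 0` the forward orbit of `g_m` is free, and the same comparison shows that `g_m` lies in
the range of `E`; for `m ≥ 1` the backward orbit and the incoming phase do the same
(`eq_of_asymptotic`, `exists_scatExpansion`).

Hence a vector of `spaceD` orthogonal to the range of `E` is supported at the origin. If
`sin(√2|λ|) ≠ 0`, orthogonality to `A(p) g₁` and `A(p)† g₀` imposes two linear equations on its two
amplitudes, with determinant proportional to `sin 2p`; if `sin(√2|λ|) = 0`, both amplitudes are free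
(`eq_originVec_of_expansion_eq_zero`). The stated bound states exhaust the solutions in each case,
and they are orthogonal to the range of `E` because `M` has no eigenvectors
(`expansion_eq_zero_of_eigenvector`, `hasSpectralResolution_of_bound`).
-/

namespace DiracFCA

noncomputable section

/-! ### Basis vectors and weighted pullbacks -/

section Basis

theorem ext_coord {ι : Type} {v w : EllTwo ι} (h : ∀ i, v i = w i) : v = w := lp.ext (funext h)

theorem clm_add_coord {ι : Type} {E : Type*} [NormedAddCommGroup E] [NormedSpace ℂ E]
    (A B : E →L[ℂ] EllTwo ι) (v : E) (i : ι) : (A + B) v i = A v i + B v i := rfl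

theorem clm_neg_coord {ι : Type} {E : Type*} [NormedAddCommGroup E] [NormedSpace ℂ E]
    (A : E →L[ℂ] EllTwo ι) (v : E) (i : ι) : (-A) v i = -A v i := rfl

theorem clm_smul_coord {ι : Type} {E : Type*} [NormedAddCommGroup E] [NormedSpace ℂ E]
    (c : ℂ) (A : E →L[ℂ] EllTwo ι) (v : E) (i : ι) : (c • A) v i = c * A v i := rfl

variable {ι κ : Type} [DecidableEq ι] [DecidableEq κ]

theorem ket_apply (i j : ι) : (ket i : EllTwo ι) j = if j = i then 1 else 0 := by
  rw [ket, lp.single_apply, Pi.single_apply]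

theorem inner_ket_left (i : ι) (v : EllTwo ι) : ⟪(ket i : EllTwo ι), v⟫_ℂ = v i := by
  rw [ket, lp.inner_single_left]; simp

theorem inner_ket_right (i : ι) (v : EllTwo ι) : ⟪v, (ket i : EllTwo ι)⟫_ℂ = conj (v i) := by
  rw [← inner_conj_symm, inner_ket_left]

theorem inner_ket_ket (i j : ι) :
    ⟪(ket i : EllTwo ι), (ket j : EllTwo ι)⟫_ℂ = if i = j then 1 else 0 := by
  rw [inner_ket_left, ket_apply]

theorem hasSum_ket (v : EllTwo ι) : HasSum (fun i => v i • (ket i : EllTwo ι)) v := by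
  have h := lp.hasSum_single (p := 2) (by norm_num) v
  convert h using 2 with i
  rw [ket, ← lp.single_smul, smul_eq_mul, mul_one]

/-- Bounded operators on `ℓ²(ι)` are determined by the basis vectors. -/
theorem clm_ext_ket {E : Type*} [NormedAddCommGroup E] [NormedSpace ℂ E]
    {A B : EllTwo ι →L[ℂ] E} (h : ∀ i, A (ket i) = B (ket i)) : A = B := by
  ext v
  have h1 := (hasSum_ket v).mapL A
  have h2 := (hasSum_ket v).mapL B
  simp only [map_smul, h] at h1 h2
  exact h1.unique h2

/-- A closed subspace that contains the basis vectors is everything. -/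
theorem mem_of_forall_ket {S : Submodule ℂ (EllTwo ι)} (hS : IsClosed (S : Set (EllTwo ι)))
    (h : ∀ i, ket i ∈ S) (v : EllTwo ι) : v ∈ S :=
  hS.mem_of_tendsto (hasSum_ket v)
    (Filter.Eventually.of_forall fun _ => S.sum_mem fun i _ => S.smul_mem _ (h i))

open Classical in
theorem weightedPull_adjoint_ket (s : Set ι) (f : ι → κ) (w : ι → ℂ)
    (hf : Set.InjOn f s) (hw : ∀ i ∈ s, ‖w i‖ ≤ 1) (i : ι) :
    ((weightedPull s f w hf hw)†) (ket i) = if i ∈ s then conj (w i) • ket (f i) else 0 := by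
  refine ext_inner_right ℂ fun v => ?_
  rw [ContinuousLinearMap.adjoint_inner_left, inner_ket_left, weightedPull_apply]
  split_ifs
  · rw [inner_smul_left, inner_ket_left, conj_conj]
  · rw [inner_zero_left]

/-- The action on a basis vector that is hit by the index map. -/
theorem weightedPull_ket (s : Set ι) (f : ι → κ) (w : ι → ℂ)
    (hf : Set.InjOn f s) (hw : ∀ i ∈ s, ‖w i‖ ≤ 1) {i : ι} (hi : i ∈ s) :
    weightedPull s f w hf hw (ket (f i)) = w i • ket i := by
  refine ext_coord fun j => ?_
  rw [weightedPull_apply, ket_apply, lp.coeFn_smul, Pi.smul_apply, ket_apply, smul_eq_mul]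
  by_cases hj : j ∈ s
  · rw [if_pos hj]
    by_cases hji : j = i
    · subst hji; simp
    · rw [if_neg (fun h => hji (hf hj hi h)), if_neg hji]; simp
  · rw [if_neg hj, if_neg (by rintro rfl; exact hj hi), mul_zero]

omit [DecidableEq ι] in
theorem weightedPull_ket_of_notMem (s : Set ι) (f : ι → κ) (w : ι → ℂ)
    (hf : Set.InjOn f s) (hw : ∀ i ∈ s, ‖w i‖ ≤ 1) {k : κ} (hk : ∀ i ∈ s, f i ≠ k) :
    weightedPull s f w hf hw (ket k) = 0 := by
  refine ext_coord fun j => ?_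
  rw [weightedPull_apply, ket_apply]
  by_cases hj : j ∈ s
  · rw [if_pos hj, if_neg (hk j hj), mul_zero]; rfl
  · rw [if_neg hj]; rfl

/-- The adjoint of a weighted pullback along a bijection `s → t` is the weighted pullback along
its inverse. -/
theorem weightedPull_adjoint (s : Set ι) (f : ι → κ) (w : ι → ℂ)
    (hf : Set.InjOn f s) (hw : ∀ i ∈ s, ‖w i‖ ≤ 1) (t : Set κ) (g : κ → ι) (w' : κ → ℂ)
    (hg : Set.InjOn g t) (hw' : ∀ i ∈ t, ‖w' i‖ ≤ 1)
    (hs : ∀ i ∈ s, f i ∈ t ∧ g (f i) = i ∧ w' (f i) = conj (w i))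
    (ht : ∀ j ∈ t, g j ∈ s) :
    (weightedPull s f w hf hw)† = weightedPull t g w' hg hw' := by
  refine clm_ext_ket fun i => ?_
  rw [weightedPull_adjoint_ket]
  split_ifs with hi
  · obtain ⟨h1, h2, h3⟩ := hs i hi
    conv_rhs => rw [← h2]
    rw [weightedPull_ket _ _ _ _ _ h1, h3]
  · rw [weightedPull_ket_of_notMem]
    rintro j hj rfl
    exact hi (ht j hj)

end Basis

/-! ### Exponentials of bounded operators -/

section Exponential

variable {E F : Type*} [NormedAddCommGroup E] [InnerProductSpace ℂ E] [CompleteSpace E]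
  [NormedAddCommGroup F] [InnerProductSpace ℂ F] [CompleteSpace F]

/-- An operator that intertwines `X` and `Y` intertwines their exponentials. -/
theorem exp_intertwine {X : F →L[ℂ] F} {Y : E →L[ℂ] E} {V : E →L[ℂ] F}
    (h : X ∘L V = V ∘L Y) : NormedSpace.exp X ∘L V = V ∘L NormedSpace.exp Y := by
  have hpow : ∀ n : ℕ, (X ^ n) ∘L V = V ∘L (Y ^ n) := by
    intro n
    induction n with
    | zero => ext; simp
    | succ n ih =>
      rw [pow_succ, pow_succ', ContinuousLinearMap.mul_def, ContinuousLinearMap.mul_def,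
        ContinuousLinearMap.comp_assoc, h, ← ContinuousLinearMap.comp_assoc, ih,
        ContinuousLinearMap.comp_assoc, ← ContinuousLinearMap.mul_def,
        ← ContinuousLinearMap.mul_def, ← pow_succ, ← pow_succ']
  have hX := NormedSpace.exp_series_hasSum_exp' (𝕂 := ℂ) X
  have hY := NormedSpace.exp_series_hasSum_exp' (𝕂 := ℂ) Y
  have h1 := hX.mapL ((ContinuousLinearMap.compL ℂ E F F).flip V)
  have h2 := hY.mapL (ContinuousLinearMap.compL ℂ E E F V)
  refine h1.unique (Eq.subst (motive := fun f => HasSum f _) (funext fun n => ?_) h2)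
  symm
  change (((n.factorial : ℂ)⁻¹) • X ^ n) ∘L V = V ∘L (((n.factorial : ℂ)⁻¹) • Y ^ n)
  rw [ContinuousLinearMap.smul_comp, ContinuousLinearMap.comp_smul, hpow]

/-- If `H³ = c² H`, then `exp(-iH)` is a quadratic polynomial in `H`. -/
theorem exp_neg_I_smul_of_cube {𝔸 : Type*} [NormedRing 𝔸] [NormedAlgebra ℂ 𝔸] [CompleteSpace 𝔸]
    {H : 𝔸} {c : ℝ} (hc : c ≠ 0)
    (h : H * H * H = ((c : ℂ) ^ 2) • H) :
    NormedSpace.exp ((-I) • H) = 1 + ((-I) * (Real.sin c : ℂ) / (c : ℂ)) • H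
      + (((Real.cos c : ℂ) - 1) / (c : ℂ) ^ 2) • (H * H) := by
  have hc' : (c : ℂ) ≠ 0 := by exact_mod_cast hc
  have hodd : ∀ n : ℕ, H ^ (2 * n + 1) = ((c : ℂ) ^ (2 * n)) • H := by
    intro n
    induction n with
    | zero => simp
    | succ n ih =>
      rw [show 2 * (n + 1) + 1 = (2 * n + 1) + 2 by ring, pow_add, ih, pow_two, smul_mul_assoc,
        ← mul_assoc, h, smul_smul]
      congr 1; ring
  have heven : ∀ n : ℕ, H ^ (2 * n + 2) = ((c : ℂ) ^ (2 * n)) • (H * H) := by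
    intro n
    rw [pow_succ, hodd, smul_mul_assoc]
  have hI : ∀ n : ℕ, (-I) ^ (2 * n) = (-1 : ℂ) ^ n := by
    intro n; rw [pow_mul]; simp
  have hS : HasSum (fun n : ℕ => ((2 * n + 1).factorial : ℂ)⁻¹ • ((-I) • H) ^ (2 * n + 1))
      (((-I) * (Real.sin c : ℂ) / (c : ℂ)) • H) := by
    have h0 := ((Complex.hasSum_sin (c : ℂ)).mul_left (-I / (c : ℂ))).smul_const H
    rw [← Complex.ofReal_sin] at h0
    convert h0 using 1
    · ext1 n
      rw [smul_pow, hodd, smul_smul, smul_smul, pow_succ (-I), hI]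
      congr 1
      field_simp
      ring
    · congr 1
      ring
  have hC : HasSum (fun n : ℕ => ((2 * n).factorial : ℂ)⁻¹ • ((-I) • H) ^ (2 * n))
      (1 + (((Real.cos c : ℂ) - 1) / (c : ℂ) ^ 2) • (H * H)) := by
    have h0 := ((Complex.hasSum_cos (c : ℂ)).mul_left (((c : ℂ) ^ 2)⁻¹)).smul_const (H * H)
    have h1 := h0.add (hasSum_ite_eq (0 : ℕ) ((1 : 𝔸) - (((c : ℂ) ^ 2)⁻¹) • (H * H)))
    rw [← Complex.ofReal_cos] at h1
    convert h1 using 1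
    · ext1 n
      rcases n with _ | n
      · simp
      · rw [smul_pow, hI, show 2 * (n + 1) = 2 * n + 2 by ring, heven, smul_smul, smul_smul,
          if_neg (by omega), add_zero]
        congr 1
        field_simp
        ring
    · rw [sub_div, sub_smul, div_eq_inv_mul, div_eq_inv_mul, mul_one]
      abel
  have := (HasSum.even_add_odd (f := fun n : ℕ => ((n.factorial : ℂ)⁻¹) • ((-I) • H) ^ n)
    hC hS).unique (NormedSpace.exp_series_hasSum_exp' (𝕂 := ℂ) ((-I) • H))
  rw [← this]; abel

theorem exp_neg_I_smul_unitary {H : E →L[ℂ] E} (hH : H† = H) :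
    (NormedSpace.exp ((-I) • H))† ∘L NormedSpace.exp ((-I) • H) = 1 ∧
      NormedSpace.exp ((-I) • H) ∘L (NormedSpace.exp ((-I) • H))† = 1 := by
  have hmem : (-I) • H ∈ skewAdjoint (E →L[ℂ] E) := by
    rw [skewAdjoint.mem_iff, star_smul, ContinuousLinearMap.star_eq_adjoint, hH]
    simp
  let _ : NormedAlgebra ℚ (E →L[ℂ] E) := NormedAlgebra.restrictScalars ℚ ℂ _
  exact Unitary.mem_iff.1 (NormedSpace.exp_mem_unitary_of_mem_skewAdjoint hmem)

theorem adjoint_smul_add_conj_smul_adjoint (c : ℂ) (T : E →L[ℂ] E) :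
    (c • T + conj c • T†)† = c • T + conj c • T† := by
  rw [map_add, LinearIsometryEquiv.map_smulₛₗ, LinearIsometryEquiv.map_smulₛₗ,
    ContinuousLinearMap.adjoint_adjoint, conj_conj, add_comm]

end Exponential

/-! ### The two-particle step -/

section PairSpace

theorem coupling_sq (lam : ℂ) : (coupling lam : ℂ) ^ 2 = 2 * (lam * conj lam) := by
  rw [coupling, mul_conj, ← ofReal_pow, mul_pow, Real.sq_sqrt (by norm_num), normSq_eq_norm_sq]
  push_cast; ring

/-- The generator `λ 𝐎 + conj λ 𝐎†` of the two-particle interaction. -/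
def pairH (lam : ℂ) : PairSpace →L[ℂ] PairSpace := lam • pairO + conj lam • pairO†

theorem contactHop_adjoint (a b c d : Fin 4) : (contactHop a b c d)† = contactHop b a d c := by
  refine weightedPull_adjoint _ _ _ _ _ _ _ _ _ _ ?_ ?_
  · rintro ⟨⟨x, a'⟩, ⟨y, b'⟩⟩ ⟨h1, h2, h3⟩
    simp only at h1 h2 h3
    subst h1 h2 h3
    simp
  · rintro ⟨⟨x, a'⟩, ⟨y, b'⟩⟩ ⟨h1, h2, h3⟩
    simp only at h1 h2 h3
    subst h1 h2 h3
    simp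

theorem contactHop_apply (a b c d : Fin 4) (v : PairSpace) (x y : ℤ) (a' b' : Fin 4) :
    contactHop a b c d v ((x, a'), (y, b')) =
      if x = y ∧ a' = a ∧ b' = c then v ((x, b), (y, d)) else 0 := by
  refine (weightedPull_apply _ _ _ _ _ _ _).trans ?_
  rw [one_mul]
  simp only [Set.mem_ofPred_eq]

theorem pairH_apply (lam : ℂ) (v : PairSpace) (x y : ℤ) (a b : Fin 4) :
    pairH lam v ((x, a), (y, b)) =
      if x = y then
        -(if a = 2 ∧ b = 3 then lam * (v ((x, 0), (y, 3)) + v ((x, 2), (y, 1)))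
          else if (a = 0 ∧ b = 3) ∨ (a = 2 ∧ b = 1) then conj lam * v ((x, 2), (y, 3))
          else if a = 3 ∧ b = 2 then lam * (v ((x, 3), (y, 0)) + v ((x, 1), (y, 2)))
          else if (a = 3 ∧ b = 0) ∨ (a = 1 ∧ b = 2) then conj lam * v ((x, 3), (y, 2))
          else 0)
      else 0 := by
  have h : pairH lam v ((x, a), (y, b)) =
      -(lam * (contactHop 2 0 3 3 v ((x, a), (y, b)) + contactHop 2 2 3 1 v ((x, a), (y, b))
        + contactHop 3 1 2 2 v ((x, a), (y, b)) + contactHop 3 3 2 0 v ((x, a), (y, b))))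
      - conj lam * (contactHop 0 2 3 3 v ((x, a), (y, b)) + contactHop 2 2 1 3 v ((x, a), (y, b))
        + contactHop 1 3 2 2 v ((x, a), (y, b)) + contactHop 3 3 0 2 v ((x, a), (y, b))) := by
    have h1 : pairH lam = lam • pairO + conj lam • pairO† := rfl
    rw [h1, pairO, map_neg, map_add, map_add, map_add, contactHop_adjoint, contactHop_adjoint,
      contactHop_adjoint, contactHop_adjoint]
    simp only [clm_add_coord, clm_smul_coord, clm_neg_coord]
    ring
  rw [h]
  simp only [contactHop_apply]
  by_cases hxy : x = y
  · subst hxy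
    fin_cases a <;> fin_cases b <;> simp [add_comm]
  · simp [hxy]

theorem swapPair_apply (v : PairSpace) (q : Mode × Mode) : swapPair v q = v q.swap := by
  refine (weightedPull_apply _ _ _ _ _ _ _).trans ?_
  rw [if_pos (Set.mem_univ _), one_mul]

theorem freePair_apply (v : PairSpace) (x y : ℤ) (a b : Fin 4) :
    freePair v ((x, a), (y, b)) = v ((x - direction a, a), (y - direction b, b)) := by
  refine (weightedPull_apply _ _ _ _ _ _ _).trans ?_
  rw [if_pos (Set.mem_univ _), one_mul]

open Classical in
theorem projQ_apply (v : PairSpace) (q : Mode × Mode) :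
    projQ v q = if (q.1.2, q.2.2) ∈ Set.range relLabel then v q else 0 := by
  refine (weightedPull_apply _ _ _ _ _ _ _).trans ?_
  rw [one_mul]
  simp only [Set.mem_ofPred_eq]
  congr

theorem mem_range_relLabel (a b : Fin 4) : (a, b) ∈ Set.range relLabel ↔
    (a = 0 ∧ b = 3) ∨ (a = 2 ∧ b = 1) ∨ (a = 2 ∧ b = 3) ∨ (a = 3 ∧ b = 0) ∨ (a = 1 ∧ b = 2) ∨
      (a = 3 ∧ b = 2) := by
  rw [Set.mem_range]
  revert a b
  decide

/-- The eigenvalues of the generator are `0` and `±√2|λ|`. -/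
theorem pairH_cube (lam : ℂ) :
    pairH lam * pairH lam * pairH lam = ((coupling lam : ℂ) ^ 2) • pairH lam := by
  refine ContinuousLinearMap.ext fun v => ext_coord fun ⟨⟨x, a⟩, ⟨y, b⟩⟩ => ?_
  rw [coupling_sq]
  change pairH lam (pairH lam (pairH lam v)) _ = 2 * (lam * conj lam) * pairH lam v _
  by_cases hxy : x = y
  · subst hxy
    fin_cases a <;> fin_cases b <;> simp [pairH_apply] <;> ring
  · simp [pairH_apply, hxy]

theorem pairH_adjoint (lam : ℂ) : (pairH lam)† = pairH lam :=
  adjoint_smul_add_conj_smul_adjoint lam pairO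

theorem pairJ_eq (lam : ℂ) (h0 : coupling lam ≠ 0) :
    pairJ lam = 1 + ((-I) * (Real.sin (coupling lam) : ℂ) / (coupling lam : ℂ)) • pairH lam
      + (((Real.cos (coupling lam) : ℂ) - 1) / (coupling lam : ℂ) ^ 2) •
        (pairH lam * pairH lam) :=
  exp_neg_I_smul_of_cube h0 (pairH_cube lam)

theorem swapPair_mul_self : swapPair * swapPair = 1 := by
  refine ContinuousLinearMap.ext fun v => ext_coord fun q => ?_
  change swapPair (swapPair v) q = v q
  rw [swapPair_apply, swapPair_apply, Prod.swap_swap]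

theorem swapPair_adjoint : swapPair† = swapPair := by
  refine weightedPull_adjoint _ _ _ _ _ _ _ _ _ _ ?_ ?_ <;> simp

theorem antiPair_adjoint : antiPair† = antiPair := by
  rw [antiPair, LinearIsometryEquiv.map_smulₛₗ, map_sub, swapPair_adjoint,
    ContinuousLinearMap.one_def, ContinuousLinearMap.adjoint_id, map_div₀, map_one, map_ofNat]

theorem half_one_sub_mul_self {R : Type*} [Ring R] [Algebra ℂ R] {S : R} (h : S * S = 1) :
    ((1 / 2 : ℂ) • (1 - S)) * ((1 / 2 : ℂ) • (1 - S)) = (1 / 2 : ℂ) • (1 - S) := by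
  rw [smul_mul_smul_comm, sub_mul, mul_sub, mul_sub, h, one_mul, one_mul, mul_one,
    show (1 : R) - S - (S - 1) = (2 : ℂ) • (1 - S) by rw [two_smul]; abel, smul_smul]
  norm_num

theorem antiPair_mul_self : antiPair * antiPair = antiPair :=
  half_one_sub_mul_self swapPair_mul_self

theorem commute_swapPair_pairH (lam : ℂ) : Commute swapPair (pairH lam) := by
  refine ContinuousLinearMap.ext fun v => ext_coord fun ⟨⟨x, a⟩, ⟨y, b⟩⟩ => ?_
  change swapPair (pairH lam v) _ = pairH lam (swapPair v) _
  rw [swapPair_apply, Prod.swap, pairH_apply, pairH_apply]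
  by_cases hxy : x = y
  · subst hxy
    fin_cases a <;> fin_cases b <;> simp [swapPair_apply]
  · simp [hxy, Ne.symm hxy]

theorem commute_swapPair_freePair : Commute swapPair freePair := by
  refine ContinuousLinearMap.ext fun v => ext_coord fun ⟨⟨x, a⟩, ⟨y, b⟩⟩ => ?_
  change swapPair (freePair v) _ = freePair (swapPair v) _
  rw [swapPair_apply, Prod.swap, freePair_apply, freePair_apply, swapPair_apply, Prod.swap]

theorem commute_exp_of_commute {R : Type*} [NormedRing R] [NormedAlgebra ℂ R] [CompleteSpace R]
    {S H : R} (h : Commute S H) (c : ℂ) : Commute S (NormedSpace.exp (c • H)) := by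
  let _ : NormedAlgebra ℚ R := NormedAlgebra.restrictScalars ℚ ℂ R
  exact (h.smul_right c).exp_right

theorem commute_half_one_sub {R : Type*} [Ring R] [Algebra ℂ R] {S T : R} (h : Commute S T) :
    Commute ((1 / 2 : ℂ) • (1 - S)) T :=
  ((Commute.one_left T).sub_left h).smul_left _

theorem commute_antiPair_pairJ (lam : ℂ) : Commute antiPair (pairJ lam) :=
  commute_half_one_sub (commute_exp_of_commute (commute_swapPair_pairH lam) _)

theorem commute_antiPair_freePair : Commute antiPair freePair :=
  commute_half_one_sub commute_swapPair_freePair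

theorem pairJ_unitary (lam : ℂ) :
    (pairJ lam)† ∘L pairJ lam = 1 ∧ pairJ lam ∘L (pairJ lam)† = 1 :=
  exp_neg_I_smul_unitary (pairH_adjoint lam)

theorem freePair_unitary : freePair† ∘L freePair = 1 ∧ freePair ∘L freePair† = 1 := by
  have h : freePair† = weightedPull Set.univ
      (fun q => ((q.1.1 + direction q.1.2, q.1.2), (q.2.1 + direction q.2.2, q.2.2)))
      (fun _ => 1)
      (fun q _ q' _ h => by
        obtain ⟨⟨x, a⟩, ⟨y, b⟩⟩ := q
        obtain ⟨⟨x', a'⟩, ⟨y', b'⟩⟩ := q'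
        simp only [Prod.mk.injEq] at h ⊢
        obtain ⟨⟨h1, rfl⟩, ⟨h2, rfl⟩⟩ := h
        exact ⟨⟨by linarith, rfl⟩, ⟨by linarith, rfl⟩⟩)
      (fun _ _ => by simp) := by
    refine weightedPull_adjoint _ _ _ _ _ _ _ _ _ _ ?_ ?_ <;> simp
  rw [h]
  constructor
  · refine ContinuousLinearMap.ext fun v => ext_coord fun ⟨⟨x, a⟩, ⟨y, b⟩⟩ => ?_
    rw [ContinuousLinearMap.comp_apply]
    refine (weightedPull_apply _ _ _ _ _ _ _).trans ?_
    simp [freePair_apply]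
  · refine ContinuousLinearMap.ext fun v => ext_coord fun ⟨⟨x, a⟩, ⟨y, b⟩⟩ => ?_
    rw [ContinuousLinearMap.comp_apply, freePair_apply]
    refine (weightedPull_apply _ _ _ _ _ _ _).trans ?_
    simp

theorem swapPair_ket (m n : Mode) : swapPair (ket (m, n)) = ket (n, m) :=
  (weightedPull_ket Set.univ Prod.swap (fun _ => 1) _ _ (i := (n, m)) trivial).trans
    (one_smul ℂ _)

theorem freePair_ket (m₁ m₂ : Mode) :
    freePair (ket (m₁, m₂)) = ket (freeMode m₁, freeMode m₂) := by
  refine Eq.trans (congrArg freePair (congrArg ket ?_))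
    ((weightedPull_ket Set.univ _ _ _ _ (i := (freeMode m₁, freeMode m₂)) trivial).trans
      (one_smul ℂ _))
  simp [freeMode]

/-- Compressing a unitary by a projection that commutes with it gives a unitary on the range. -/
theorem compress_unitary {E : Type*} [NormedAddCommGroup E] [InnerProductSpace ℂ E]
    [CompleteSpace E] {P J F : E →L[ℂ] E} (hP : P† = P) (hPP : P * P = P)
    (hJ : J† ∘L J = 1 ∧ J ∘L J† = 1) (hF : F† ∘L F = 1 ∧ F ∘L F† = 1)
    (hPJ : Commute P J) (hPF : Commute P F) :
    (P ∘L (J ∘L F) ∘L P)† ∘L (P ∘L (J ∘L F) ∘L P) = P ∧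
      (P ∘L (J ∘L F) ∘L P) ∘L (P ∘L (J ∘L F) ∘L P)† = P ∧
      P ∘L (J ∘L F) ∘L P = (J ∘L F) ∘L P ∧ P ∘L (J ∘L F) ∘L P = P ∘L (J ∘L F) := by
  simp only [← ContinuousLinearMap.mul_def, ← ContinuousLinearMap.star_eq_adjoint] at *
  have hc : P * (J * F * P) = J * F * P := by
    rw [← mul_assoc, (hPJ.mul_right hPF).eq, mul_assoc, hPP]
  have hc' : P * (J * F * P) = P * (J * F) := by
    rw [← (hPJ.mul_right hPF).eq, ← mul_assoc, hPP]
  refine ⟨?_, ?_, hc, hc'⟩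
  · rw [hc, star_mul, star_mul, hP]
    calc P * (star F * star J) * (J * F * P) = P * (star F * (star J * J) * F * P) := by
          simp only [mul_assoc]
      _ = P := by rw [hJ.1, mul_one, hF.1, one_mul, hPP]
  · rw [hc', star_mul, star_mul, hP]
    calc P * (J * F) * (star F * star J * P) = P * (J * (F * star F) * star J * P) := by
          simp only [mul_assoc]
      _ = P := by rw [hF.2, mul_one, hJ.2, one_mul, hPP]

/-- The outer or the inner projector of the two-particle step may be dropped, as it commutes
with the interaction and the free step. -/
theorem pairA_unitary (lam : ℂ) :
    (pairA lam)† ∘L pairA lam = antiPair ∧ pairA lam ∘L (pairA lam)† = antiPair ∧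
      pairA lam = (pairJ lam ∘L freePair) ∘L antiPair ∧
      pairA lam = antiPair ∘L (pairJ lam ∘L freePair) :=
  compress_unitary antiPair_adjoint antiPair_mul_self (pairJ_unitary lam) freePair_unitary
    (commute_antiPair_pairJ lam) commute_antiPair_freePair

/-! ### The nontrivial internal states -/

theorem projQ_mul_self : projQ * projQ = projQ := by
  refine ContinuousLinearMap.ext fun v => ext_coord fun q => ?_
  change projQ (projQ v) q = _
  rw [projQ_apply, projQ_apply]
  split_ifs <;> rfl

theorem projQ_mul_pairH (lam : ℂ) : projQ * pairH lam = pairH lam := by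
  refine ContinuousLinearMap.ext fun v => ext_coord fun ⟨⟨x, a⟩, ⟨y, b⟩⟩ => ?_
  change projQ (pairH lam v) _ = _
  rw [projQ_apply]
  simp only [mem_range_relLabel]
  split_ifs with h
  · rfl
  · rw [pairH_apply]
    fin_cases a <;> fin_cases b <;> simp at h ⊢

theorem pairH_mul_projQ (lam : ℂ) : pairH lam * projQ = pairH lam := by
  refine ContinuousLinearMap.ext fun v => ext_coord fun ⟨⟨x, a⟩, ⟨y, b⟩⟩ => ?_
  change pairH lam (projQ v) _ = _
  rw [pairH_apply, pairH_apply]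
  simp only [projQ_apply, mem_range_relLabel]
  simp

theorem commute_projQ_pairJ (lam : ℂ) : Commute projQ (pairJ lam) :=
  commute_exp_of_commute (S := projQ) (H := pairH lam)
    ((projQ_mul_pairH lam).trans (pairH_mul_projQ lam).symm) _

theorem commute_projQ_freePair : Commute projQ freePair := by
  refine ContinuousLinearMap.ext fun v => ext_coord fun ⟨⟨x, a⟩, ⟨y, b⟩⟩ => ?_
  change projQ (freePair v) _ = freePair (projQ v) _
  rw [projQ_apply, freePair_apply, freePair_apply, projQ_apply]

theorem commute_projQ_swapPair : Commute projQ swapPair := by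
  refine ContinuousLinearMap.ext fun v => ext_coord fun ⟨⟨x, a⟩, ⟨y, b⟩⟩ => ?_
  change projQ (swapPair v) _ = swapPair (projQ v) _
  rw [projQ_apply, swapPair_apply, swapPair_apply, projQ_apply]
  simp only [mem_range_relLabel, Prod.swap]
  fin_cases a <;> fin_cases b <;> simp

theorem commute_projQ_antiPair : Commute projQ antiPair :=
  (commute_half_one_sub commute_projQ_swapPair.symm).symm

/-- The interaction does nothing outside the internal states `e₁, …, e₆`. -/
theorem pairJ_mul_one_sub_projQ (lam : ℂ) (h0 : coupling lam ≠ 0) :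
    pairJ lam * (1 - projQ) = 1 - projQ := by
  have h : pairH lam * (1 - projQ) = 0 := by rw [mul_sub, mul_one, pairH_mul_projQ, sub_self]
  rw [pairJ_eq lam h0, add_mul, add_mul, one_mul, smul_mul_assoc, smul_mul_assoc, mul_assoc, h,
    mul_zero, smul_zero, smul_zero, add_zero, add_zero]

theorem pairA_commute_projQ (lam : ℂ) : Commute projQ (pairA lam) :=
  commute_projQ_antiPair.mul_right
    (((commute_projQ_pairJ lam).mul_right commute_projQ_freePair).mul_right commute_projQ_antiPair)

theorem pairA_eq_nontrivialPart_add (lam : ℂ) :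
    pairA lam = nontrivialPart lam + trivialPart lam := by
  have hc := (pairA_commute_projQ lam).eq
  change pairA lam = projQ * (pairA lam * projQ) + (1 - projQ) * (pairA lam * (1 - projQ))
  rw [mul_sub, mul_one, sub_mul, one_mul, mul_sub, ← hc, ← mul_assoc, projQ_mul_self]
  abel

theorem trivialPart_eq (lam : ℂ) (h0 : coupling lam ≠ 0) :
    trivialPart lam =
      (1 - projQ) ∘L (antiPair ∘L freePair ∘L antiPair) ∘L (1 - projQ) := by
  change (1 - projQ) * ((antiPair * ((pairJ lam * freePair) * antiPair)) * (1 - projQ)) =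
    (1 - projQ) * ((antiPair * (freePair * antiPair)) * (1 - projQ))
  have h1 : Commute (1 - projQ) antiPair := (Commute.one_left _).sub_left commute_projQ_antiPair
  have h2 : Commute (1 - projQ) freePair := (Commute.one_left _).sub_left commute_projQ_freePair
  have h3 : ∀ X : PairSpace →L[ℂ] PairSpace, Commute (1 - projQ) X →
      (1 - projQ) * ((antiPair * (X * antiPair)) * (1 - projQ)) =
        antiPair * ((X * (1 - projQ)) * antiPair) * (1 - projQ) := by
    intro X hX
    rw [← hX.eq]
    simp only [mul_assoc]
    rw [← mul_assoc (1 - projQ) antiPair, h1.eq, mul_assoc]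
  have h4 : Commute (1 - projQ) (pairJ lam) := (Commute.one_left _).sub_left (commute_projQ_pairJ lam)
  rw [h3 _ (h4.mul_right h2), h3 _ h2, mul_assoc (pairJ lam), ← h2.eq, ← mul_assoc (pairJ lam),
    pairJ_mul_one_sub_projQ lam h0]

end PairSpace

/-! ### Canonical anticommutation relations -/

section Fock

/-- The lexicographic order of modes that fixes the signs of the field operators. -/
def modeBefore (n m : Mode) : Prop := n.1 < m.1 ∨ (n.1 = m.1 ∧ n.2 < m.2)

instance (n m : Mode) : Decidable (modeBefore n m) :=
  inferInstanceAs (Decidable (n.1 < m.1 ∨ (n.1 = m.1 ∧ n.2 < m.2)))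

theorem not_modeBefore_self (m : Mode) : ¬ modeBefore m m := by
  simp [modeBefore]

theorem modeBefore_swap {m n : Mode} (h : m ≠ n) : modeBefore n m ↔ ¬ modeBefore m n := by
  obtain ⟨x, a⟩ := m
  obtain ⟨y, b⟩ := n
  simp only [modeBefore]
  constructor
  · rintro (h1 | ⟨h1, h2⟩) (h3 | ⟨h3, h4⟩)
    · omega
    · omega
    · omega
    · exact absurd h2 h4.asymm
  · intro h1
    rcases lt_trichotomy x y with h2 | rfl | h2
    · exact absurd (Or.inl h2) h1
    · rcases lt_trichotomy a b with h3 | rfl | h3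
      · exact absurd (Or.inr ⟨rfl, h3⟩) h1
      · exact absurd rfl h
      · exact Or.inr ⟨rfl, h3⟩
    · exact Or.inl h2

theorem orderSign_insert {S : Finset Mode} {m n : Mode} (hn : n ∉ S) :
    orderSign (insert n S) m = (if modeBefore n m then -1 else 1) * orderSign S m := by
  rw [orderSign, orderSign, Finset.filter_insert]
  by_cases h : modeBefore n m
  · rw [if_pos h, if_pos (show n.1 < m.1 ∨ (n.1 = m.1 ∧ n.2 < m.2) from h),
      Finset.card_insert_of_notMem (by simp [hn]), pow_succ, mul_comm]
  · rw [if_neg h, if_neg (show ¬ (n.1 < m.1 ∨ (n.1 = m.1 ∧ n.2 < m.2)) from h), one_mul]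

theorem orderSign_insert_self (S : Finset Mode) (m : Mode) :
    orderSign (insert m S) m = orderSign S m := by
  by_cases h : m ∈ S
  · rw [Finset.insert_eq_of_mem h]
  · rw [orderSign_insert h, if_neg (not_modeBefore_self m), one_mul]

theorem orderSign_mul_self (S : Finset Mode) (m : Mode) : orderSign S m * orderSign S m = 1 := by
  rw [orderSign, ← pow_add, ← two_mul, pow_mul]; simp

theorem annihilate_apply (m : Mode) (v : Fock) (S : Finset Mode) :
    annihilate m v S = if m ∈ S then 0 else orderSign S m * v (insert m S) := by
  refine (weightedPull_apply _ _ _ _ _ _ _).trans ?_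
  by_cases h : m ∈ S <;> simp [h]

theorem create_apply (m : Mode) (v : Fock) (S : Finset Mode) :
    create m v S = if m ∈ S then orderSign S m * v (S.erase m) else 0 := by
  have h : create m = weightedPull {S | m ∈ S} (fun S => S.erase m) (fun S => orderSign S m)
      (fun S hS S' hS' h => by
        have h1 := congrArg (insert m) h
        simpa [Finset.insert_erase hS, Finset.insert_erase hS'] using h1)
      (fun S _ => by simp [orderSign]) := by
    refine weightedPull_adjoint _ _ _ _ _ _ _ _ _ _ ?_ ?_
    · intro S hS
      refine ⟨Finset.mem_insert_self _ _, Finset.erase_insert hS, ?_⟩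
      rw [orderSign_insert_self, orderSign, map_pow, map_neg, map_one]
    · exact fun S _ => Finset.notMem_erase _ _
  rw [h]
  refine (weightedPull_apply _ _ _ _ _ _ _).trans ?_
  by_cases h : m ∈ S <;> simp [h]

theorem annihilate_annihilate (m n : Mode) (v : Fock) :
    annihilate m (annihilate n v) = -annihilate n (annihilate m v) := by
  refine ext_coord fun S => ?_
  rw [annihilate_apply, annihilate_apply]
  change _ = -(annihilate n (annihilate m v) S)
  rw [annihilate_apply, annihilate_apply]
  by_cases hmn : m = n
  · subst hmn; simp
  by_cases hm : m ∈ S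
  · simp [hm]
  by_cases hn : n ∈ S
  · simp [hn]
  rw [if_neg hm, if_neg hn, if_neg (by simp [hn, Ne.symm hmn]), if_neg (by simp [hm, hmn]),
    orderSign_insert hm, orderSign_insert hn, Finset.insert_comm n m]
  by_cases h : modeBefore m n
  · rw [if_pos h, if_neg (fun h' => (modeBefore_swap hmn).1 h' h)]; ring
  · rw [if_neg h, if_pos ((modeBefore_swap hmn).2 h)]; ring

theorem create_create (m n : Mode) (v : Fock) :
    create m (create n v) = -create n (create m v) := by
  refine ext_inner_left ℂ fun w => ?_
  rw [create, create, ContinuousLinearMap.adjoint_inner_right,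
    ContinuousLinearMap.adjoint_inner_right, inner_neg_right,
    ContinuousLinearMap.adjoint_inner_right, ContinuousLinearMap.adjoint_inner_right,
    annihilate_annihilate, inner_neg_left]

theorem create_create_self (m : Mode) (v : Fock) : create m (create m v) = 0 := by
  have h := eq_neg_iff_add_eq_zero.1 (create_create m m v)
  rw [← two_smul ℂ] at h
  exact (smul_eq_zero.1 h).resolve_left two_ne_zero

theorem annihilate_create_of_ne {m n : Mode} (hmn : m ≠ n) (v : Fock) :
    annihilate m (create n v) = -create n (annihilate m v) := by
  refine ext_coord fun S => ?_
  rw [annihilate_apply, create_apply]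
  change _ = -(create n (annihilate m v) S)
  rw [create_apply, annihilate_apply]
  by_cases hm : m ∈ S
  · simp [hm, hmn]
  by_cases hn : n ∈ S
  · have h1 : n ∉ S.erase n := Finset.notMem_erase _ _
    have h2 : orderSign S m = (if modeBefore n m then -1 else 1) * orderSign (S.erase n) m := by
      rw [← orderSign_insert h1, Finset.insert_erase hn]
    rw [if_neg hm, if_pos hn, if_pos (by simp [hn]), if_neg (by simp [hm]),
      orderSign_insert hm, h2, Finset.erase_insert_of_ne hmn]
    by_cases h : modeBefore m n
    · rw [if_pos h, if_neg (fun h' => (modeBefore_swap hmn).1 h' h)]; ring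
    · rw [if_neg h, if_pos ((modeBefore_swap hmn).2 h)]; ring
  · simp [hn, Ne.symm hmn]

theorem annihilate_create_self (m : Mode) (v : Fock) :
    annihilate m (create m v) = v - create m (annihilate m v) := by
  refine ext_coord fun S => ?_
  rw [annihilate_apply, create_apply]
  change _ = v S - create m (annihilate m v) S
  rw [create_apply, annihilate_apply]
  by_cases hm : m ∈ S
  · have h2 : orderSign S m = orderSign (S.erase m) m := by
      rw [← orderSign_insert_self (S.erase m) m, Finset.insert_erase hm]
    rw [if_pos hm, if_pos hm, if_neg (Finset.notMem_erase _ _), ← h2, ← mul_assoc,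
      orderSign_mul_self, one_mul, Finset.insert_erase hm, sub_self]
  · rw [if_neg hm, if_pos (Finset.mem_insert_self _ _), if_neg hm, Finset.erase_insert hm,
      orderSign_insert_self, ← mul_assoc, orderSign_mul_self, one_mul, sub_zero]

theorem annihilate_vacuum (m : Mode) : annihilate m vacuum = 0 := by
  refine ext_coord fun S => ?_
  rw [annihilate_apply, vacuum, ket_apply, if_neg (Finset.insert_ne_empty _ _)]
  simp

theorem annihilate_create_vacuum (m n : Mode) :
    annihilate m (create n vacuum) = if m = n then vacuum else 0 := by
  split_ifs with h
  · subst h; rw [annihilate_create_self, annihilate_vacuum, map_zero, sub_zero]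
  · rw [annihilate_create_of_ne h, annihilate_vacuum, map_zero, neg_zero]

theorem annihilate_pair (k m n : Mode) :
    annihilate k (create m (create n vacuum)) =
      (if k = m then create n vacuum else 0) - if k = n then create m vacuum else 0 := by
  by_cases h : k = m
  · subst h
    rw [annihilate_create_self, annihilate_create_vacuum, if_pos rfl]
    split_ifs <;> simp
  · rw [annihilate_create_of_ne h, annihilate_create_vacuum, if_neg h]
    split_ifs <;> simp

theorem annihilate_annihilate_pair (j k m n : Mode) :
    annihilate j (annihilate k (create m (create n vacuum))) =
      ((if k = m ∧ j = n then 1 else 0) - if k = n ∧ j = m then 1 else 0 : ℂ) • vacuum := by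
  rw [annihilate_pair, map_sub, apply_ite (annihilate j), apply_ite (annihilate j), map_zero,
    annihilate_create_vacuum, annihilate_create_vacuum, sub_smul, ite_smul, ite_smul, one_smul,
    zero_smul, ite_and, ite_and]

/-- In normal order `O_x = ψ†₄ψ†₃ψ₂ψ₃ - ψ†₃ψ†₄ψ₁ψ₄` at site `x`. -/
theorem localO_apply (x : ℤ) (v : Fock) : localO x v =
    create (x, 3) (create (x, 2) (annihilate (x, 1) (annihilate (x, 2) v)))
      + create (x, 2) (create (x, 3) (annihilate (x, 0) (annihilate (x, 3) v))) := by
  change annihilate (x, 1) (create (x, 2) (annihilate (x, 2) (create (x, 3) v)))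
    + annihilate (x, 0) (create (x, 2) (create (x, 3) (annihilate (x, 3) v))) = _
  have h : ∀ a b : Fin 4, a ≠ b → ((x, a) : Mode) ≠ (x, b) := fun a b hab h => hab (by simpa using h)
  rw [annihilate_create_of_ne (h 2 3 (by decide)), map_neg, create_create, neg_neg,
    annihilate_create_of_ne (h 1 3 (by decide)), annihilate_create_of_ne (h 1 2 (by decide)),
    annihilate_create_of_ne (h 0 2 (by decide)), annihilate_create_of_ne (h 0 3 (by decide)),
    map_neg, map_neg, neg_neg, neg_neg]

theorem localO_adjoint_apply (x : ℤ) (v : Fock) : ((localO x)†) v =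
    create (x, 2) (create (x, 1) (annihilate (x, 2) (annihilate (x, 3) v)))
      + create (x, 3) (create (x, 0) (annihilate (x, 3) (annihilate (x, 2) v))) := by
  have hadj : ∀ m : Mode, star (create m) = annihilate m := fun m =>
    ContinuousLinearMap.adjoint_adjoint _
  have hadj' : ∀ m : Mode, star (annihilate m) = create m := fun m => rfl
  rw [← ContinuousLinearMap.star_eq_adjoint, localO, star_add]
  simp only [star_mul, hadj, hadj', add_apply, mul_apply_eq_comp]
  have h : ∀ a b : Fin 4, a ≠ b → ((x, a) : Mode) ≠ (x, b) := fun a b hab h => hab (by simpa using h)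
  simp only [annihilate_create_of_ne (h 2 1 (by decide)), annihilate_create_of_ne (h 3 2 (by decide)),
    annihilate_create_of_ne (h 3 1 (by decide)), annihilate_create_of_ne (h 2 0 (by decide)),
    annihilate_create_of_ne (h 3 0 (by decide)), annihilate_annihilate (x, 3) (x, 2), map_neg,
    neg_neg]

/-! ### The two-particle sector of Fock space -/

theorem modeBefore_trichotomy (m n : Mode) : modeBefore m n ∨ m = n ∨ modeBefore n m := by
  by_cases h : m = n
  · exact Or.inr (Or.inl h)
  · by_cases h' : modeBefore m n
    · exact Or.inl h'
    · exact Or.inr (Or.inr ((modeBefore_swap h).2 h'))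

theorem modeBefore.ne {m n : Mode} (h : modeBefore m n) : m ≠ n := by
  rintro rfl; exact not_modeBefore_self m h

theorem modeBefore.asymm {m n : Mode} (h : modeBefore m n) : ¬ modeBefore n m := by
  rw [modeBefore_swap h.ne]; exact not_not.2 h

/-- Reads off the amplitudes of a Fock vector on ordered pairs of modes. -/
def orderedPairs : Fock →L[ℂ] PairSpace :=
  weightedPull {q : Mode × Mode | modeBefore q.1 q.2} (fun q => ({q.1, q.2} : Finset Mode))
    (fun _ => 1)
    (fun q hq q' hq' h => by
      obtain ⟨m, n⟩ := q
      obtain ⟨m', n'⟩ := q'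
      change modeBefore m n at hq
      change modeBefore m' n' at hq'
      have h1 : m' ∈ ({m, n} : Finset Mode) := by
        rw [show ({m, n} : Finset Mode) = {m', n'} from h]; simp
      have h2 : n' ∈ ({m, n} : Finset Mode) := by
        rw [show ({m, n} : Finset Mode) = {m', n'} from h]; simp
      simp only [Finset.mem_insert, Finset.mem_singleton] at h1 h2
      rcases h1 with rfl | rfl <;> rcases h2 with rfl | rfl
      · exact absurd hq' (not_modeBefore_self _)
      · rfl
      · exact absurd hq' hq.asymm
      · exact absurd hq' (not_modeBefore_self _))
    (fun _ _ => by simp)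

theorem orderedPairs_apply (f : Fock) (m n : Mode) :
    orderedPairs f (m, n) = if modeBefore m n then f {m, n} else 0 := by
  refine (weightedPull_apply _ _ _ _ _ _ _).trans ?_
  by_cases h : modeBefore m n <;> simp [h]

theorem orderedPairs_adjoint_ket (m n : Mode) :
    (orderedPairs†) (ket (m, n)) = if modeBefore m n then ket {m, n} else 0 := by
  refine (weightedPull_adjoint_ket _ _ _ _ _ _).trans ?_
  by_cases h : modeBefore m n <;> simp [h]

theorem orderedPairs_ket {m n : Mode} (h : modeBefore m n) :
    orderedPairs (ket {m, n}) = ket (m, n) := by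
  refine (weightedPull_ket _ _ _ _ _ (i := (m, n)) h).trans ?_
  rw [one_smul]

theorem orderedPairs_ket_of_card_ne {S : Finset Mode} (h : S.card ≠ 2) :
    orderedPairs (ket S) = 0 := by
  refine weightedPull_ket_of_notMem _ _ _ _ _ ?_
  rintro ⟨m, n⟩ hq rfl
  exact h (Finset.card_pair (modeBefore.ne hq))

theorem antiPair_apply (v : PairSpace) (m n : Mode) :
    antiPair v (m, n) = (1 / 2 : ℂ) * (v (m, n) - v (n, m)) := by
  have h : antiPair v (m, n) = (1 / 2 : ℂ) * (v (m, n) - swapPair v (m, n)) := rfl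
  rw [h, swapPair_apply, Prod.swap]

/-- The map `|m₁⟩|m₂⟩ ↦ ψ†_{m₁} ψ†_{m₂} |Ω⟩ / √2`. -/
def pairToFock : PairSpace →L[ℂ] Fock :=
  ((Real.sqrt 2 : ℝ) : ℂ) • (orderedPairs† ∘L antiPair)

theorem sqrt_two_mul_self : ((Real.sqrt 2 : ℝ) : ℂ) * ((Real.sqrt 2 : ℝ) : ℂ) = 2 := by
  rw [← ofReal_mul, Real.mul_self_sqrt (by norm_num)]; norm_num

theorem sqrt_two_ne_zero : ((Real.sqrt 2 : ℝ) : ℂ) ≠ 0 := by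
  intro h; have := sqrt_two_mul_self; rw [h] at this; norm_num at this

theorem create_create_vacuum {m n : Mode} (h : m ≠ n) : create m (create n vacuum) =
    (if modeBefore n m then -1 else 1 : ℂ) • ket {m, n} := by
  refine ext_coord fun S => ?_
  rw [create_apply, create_apply]
  change _ = (if modeBefore n m then -1 else 1 : ℂ) * (ket {m, n} : Fock) S
  rw [vacuum, ket_apply, ket_apply]
  by_cases hS : S = {m, n}
  · subst hS
    rw [if_pos (by simp), if_pos (by simp [h.symm]), if_pos rfl,
      if_pos (by ext k; simp [h]),
      show orderSign {m, n} m = orderSign {n} m from orderSign_insert_self {n} m,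
      show ({m, n} : Finset Mode).erase m = {n} from Finset.erase_insert (by simpa using h),
      show orderSign {n} n = orderSign ∅ n from orderSign_insert_self ∅ n,
      show orderSign {n} m = _ from orderSign_insert (Finset.notMem_empty n)]
    simp [orderSign]
  · rw [if_neg hS, mul_zero]
    split_ifs with h1 h2 h3
    · exfalso
      apply hS
      rw [← Finset.insert_erase h1, ← Finset.insert_erase h2, h3]
      rfl
    · simp
    · simp
    · rfl

theorem pairToFock_ket (m n : Mode) : pairToFock (ket (m, n)) =
    (((Real.sqrt 2 : ℝ) : ℂ)⁻¹) • create m (create n vacuum) := by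
  have h1 : pairToFock (ket (m, n)) = ((Real.sqrt 2 : ℝ) : ℂ) •
      (1 / 2 : ℂ) • ((orderedPairs†) (ket (m, n)) - (orderedPairs†) (ket (n, m))) := by
    rw [← map_sub, ← swapPair_ket m n, ← map_smul]
    rfl
  have h2 : ((Real.sqrt 2 : ℝ) : ℂ) * (1 / 2) = ((Real.sqrt 2 : ℝ) : ℂ)⁻¹ := by
    refine eq_inv_of_mul_eq_one_left ?_
    rw [mul_right_comm, sqrt_two_mul_self]; norm_num
  rw [h1, orderedPairs_adjoint_ket, orderedPairs_adjoint_ket, smul_smul, h2]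
  congr 1
  rcases modeBefore_trichotomy m n with h | rfl | h
  · rw [create_create_vacuum h.ne, if_pos h, if_neg h.asymm, if_neg h.asymm, sub_zero, one_smul]
  · rw [if_neg (not_modeBefore_self m), sub_zero]
    exact (create_create_self m vacuum).symm
  · rw [create_create_vacuum h.ne.symm, if_pos h, if_neg h.asymm, if_pos h, zero_sub,
      Finset.pair_comm, neg_one_smul]

theorem orderedPairs_adjoint_apply (v : PairSpace) {m n : Mode} (h : modeBefore m n) :
    (orderedPairs†) v {m, n} = v (m, n) := by
  rw [← inner_ket_left, ContinuousLinearMap.adjoint_inner_right, orderedPairs_ket h,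
    inner_ket_left]

theorem orderedPairs_adjoint_apply_of_card_ne (v : PairSpace) {S : Finset Mode}
    (h : S.card ≠ 2) : (orderedPairs†) v S = 0 := by
  rw [← inner_ket_left, ContinuousLinearMap.adjoint_inner_right, orderedPairs_ket_of_card_ne h,
    inner_zero_left]

theorem pairToFock_adjoint :
    pairToFock† = ((Real.sqrt 2 : ℝ) : ℂ) • (antiPair ∘L orderedPairs) := by
  rw [pairToFock, LinearIsometryEquiv.map_smulₛₗ, ContinuousLinearMap.adjoint_comp,
    antiPair_adjoint, ContinuousLinearMap.adjoint_adjoint, conj_ofReal]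

theorem pairToFock_adjoint_comp_self : pairToFock† ∘L pairToFock = antiPair := by
  rw [pairToFock_adjoint]
  refine ContinuousLinearMap.ext fun v => ext_coord fun ⟨m, n⟩ => ?_
  have h1 : (((Real.sqrt 2 : ℝ) : ℂ) • (antiPair ∘L orderedPairs)) (pairToFock v) (m, n) =
      ((Real.sqrt 2 : ℝ) : ℂ) * antiPair (orderedPairs (pairToFock v)) (m, n) := rfl
  have h2 : ∀ m n, orderedPairs (pairToFock v) (m, n) =
      ((Real.sqrt 2 : ℝ) : ℂ) * if modeBefore m n then antiPair v (m, n) else 0 := by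
    intro m n
    rw [orderedPairs_apply]
    split_ifs with h
    · change ((Real.sqrt 2 : ℝ) : ℂ) * (orderedPairs†) (antiPair v) {m, n} = _
      rw [orderedPairs_adjoint_apply _ h]
    · rw [mul_zero]
  rw [ContinuousLinearMap.comp_apply, h1, antiPair_apply, h2, h2, ← mul_sub, mul_left_comm,
    ← mul_assoc, ← mul_assoc, mul_assoc (1 / 2 : ℂ), sqrt_two_mul_self, antiPair_apply,
    antiPair_apply]
  rcases modeBefore_trichotomy m n with h | rfl | h
  · rw [if_pos h, if_neg h.asymm]; ring
  · rw [if_neg (not_modeBefore_self m)]; ring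
  · rw [if_pos h, if_neg h.asymm]; ring

/-- The range of `pairToFock` is the two-particle sector. -/
theorem exists_pairToFock_eq_iff (f : Fock) :
    (∃ v, pairToFock v = f) ↔ ∀ S : Finset Mode, S.card ≠ 2 → f S = 0 := by
  constructor
  · rintro ⟨v, rfl⟩ S hS
    change ((Real.sqrt 2 : ℝ) : ℂ) * (orderedPairs†) (antiPair v) S = 0
    rw [orderedPairs_adjoint_apply_of_card_ne _ hS, mul_zero]
  · intro hf
    refine ⟨((Real.sqrt 2 : ℝ) : ℂ) • orderedPairs f, ext_coord fun S => ?_⟩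
    have h1 : pairToFock (((Real.sqrt 2 : ℝ) : ℂ) • orderedPairs f) S =
        ((Real.sqrt 2 : ℝ) : ℂ) * (((Real.sqrt 2 : ℝ) : ℂ) *
          (orderedPairs†) (antiPair (orderedPairs f)) S) := by
      rw [map_smul]; rfl
    rw [h1, ← mul_assoc, sqrt_two_mul_self]
    by_cases hS : S.card = 2
    · have key : ∀ m n : Mode, modeBefore m n →
          2 * (orderedPairs†) (antiPair (orderedPairs f)) {m, n} = f {m, n} := by
        intro m n h
        rw [orderedPairs_adjoint_apply _ h, antiPair_apply, orderedPairs_apply,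
          orderedPairs_apply, if_pos h, if_neg h.asymm]
        ring
      obtain ⟨m, n, hmn, rfl⟩ := Finset.card_eq_two.1 hS
      rcases modeBefore_trichotomy m n with h | h | h
      · exact key m n h
      · exact absurd h hmn
      · rw [Finset.pair_comm]; exact key n m h
    · rw [orderedPairs_adjoint_apply_of_card_ne _ hS, hf S hS, mul_zero]

/-! ### The automaton in the two-particle sector -/

theorem contactHop_ket (a b c d : Fin 4) (x y : ℤ) (b' d' : Fin 4) :
    contactHop a b c d (ket ((x, b'), (y, d'))) =
      if x = y ∧ b' = b ∧ d' = d then ket ((x, a), (y, c)) else 0 := by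
  refine ext_coord fun ⟨⟨x', a'⟩, ⟨y', c'⟩⟩ => ?_
  rw [contactHop_apply, ket_apply, apply_ite (fun v : PairSpace => v ((x', a'), (y', c'))),
    ket_apply]
  change _ = if _ then _ else (0 : ℂ)
  simp only [Prod.mk.injEq]
  grind

theorem pairH_ket (lam : ℂ) (x y : ℤ) (a b : Fin 4) :
    pairH lam (ket ((x, a), (y, b))) =
      lam • -((if x = y ∧ a = 0 ∧ b = 3 then ket ((x, 2), (y, 3)) else 0)
        + (if x = y ∧ a = 2 ∧ b = 1 then ket ((x, 2), (y, 3)) else 0)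
        + (if x = y ∧ a = 1 ∧ b = 2 then ket ((x, 3), (y, 2)) else 0)
        + (if x = y ∧ a = 3 ∧ b = 0 then ket ((x, 3), (y, 2)) else 0)
        : PairSpace)
      + conj lam • -((if x = y ∧ a = 2 ∧ b = 3 then ket ((x, 0), (y, 3)) else 0)
        + (if x = y ∧ a = 2 ∧ b = 3 then ket ((x, 2), (y, 1)) else 0)
        + (if x = y ∧ a = 3 ∧ b = 2 then ket ((x, 1), (y, 2)) else 0)
        + (if x = y ∧ a = 3 ∧ b = 2 then ket ((x, 3), (y, 0)) else 0)
        : PairSpace) := by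
  simp only [← contactHop_ket]
  have h1 : pairH lam = lam • pairO + conj lam • pairO† := rfl
  rw [h1, pairO, map_neg, map_add, map_add, map_add, contactHop_adjoint, contactHop_adjoint,
    contactHop_adjoint, contactHop_adjoint]
  rfl

end Fock

section FockDynamics

theorem sqrt_two_smul_pairToFock_ket (m n : Mode) :
    ((Real.sqrt 2 : ℝ) : ℂ) • pairToFock (ket (m, n)) = create m (create n vacuum) := by
  rw [pairToFock_ket, smul_smul, mul_inv_cancel₀ sqrt_two_ne_zero, one_smul]

/-- The interaction at `z` acts only on pairs with both particles at `z`. -/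
theorem localJ_pair_of_ne (lam : ℂ) {z x y : ℤ} (h : ¬ (z = x ∧ z = y)) (a b : Fin 4) :
    localJ lam z (create (x, a) (create (y, b) vacuum)) = 0 := by
  have key : ∀ c d : Fin 4, ¬ (((z, c) : Mode) = (x, a) ∧ ((z, d) : Mode) = (y, b)) :=
    fun c d h' => h ⟨(Prod.mk.injEq .. ▸ h'.1 : z = x ∧ c = a).1,
      (Prod.mk.injEq .. ▸ h'.2 : z = y ∧ d = b).1⟩
  have key' : ∀ c d : Fin 4, ¬ (((z, c) : Mode) = (y, b) ∧ ((z, d) : Mode) = (x, a)) :=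
    fun c d h' => key d c h'.symm
  change lam • localO z _ + conj lam • ((localO z)†) _ = 0
  rw [localO_apply, localO_adjoint_apply]
  simp only [annihilate_annihilate_pair, if_neg (key _ _), if_neg (key' _ _), sub_self, zero_smul,
    map_zero, add_zero, smul_zero]

theorem localJ_pair_self (lam : ℂ) (x : ℤ) (a b : Fin 4) :
    localJ lam x (create (x, a) (create (x, b) vacuum)) =
      ((Real.sqrt 2 : ℝ) : ℂ) • pairToFock (pairH lam (ket ((x, a), (x, b)))) := by
  change lam • localO x _ + conj lam • ((localO x)†) _ = _
  rw [localO_apply, localO_adjoint_apply, pairH_ket]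
  simp only [annihilate_annihilate_pair, map_add, map_smul, map_neg, smul_add, smul_neg,
    apply_ite pairToFock, map_zero, smul_ite, smul_zero, smul_comm ((Real.sqrt 2 : ℝ) : ℂ),
    sqrt_two_smul_pairToFock_ket, Prod.mk.injEq, true_and]
  rw [create_create (x, 3) (x, 2), create_create (x, 3) (x, 0), create_create (x, 1) (x, 2)]
  fin_cases a <;> fin_cases b <;> (simp; try abel)

theorem sum_localJ_pairToFock (lam : ℂ) (Λ : Finset ℤ) {x y : ℤ} (hx : x ∈ Λ) (a b : Fin 4) :
    (∑ z ∈ Λ, localJ lam z) (pairToFock (ket ((x, a), (y, b)))) =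
      pairToFock (pairH lam (ket ((x, a), (y, b)))) := by
  rw [pairToFock_ket, map_smul, sum_apply]
  by_cases hxy : x = y
  · subst hxy
    rw [Finset.sum_eq_single x, localJ_pair_self, smul_smul, inv_mul_cancel₀ sqrt_two_ne_zero,
      one_smul]
    · exact fun z _ hz => localJ_pair_of_ne lam (fun h => hz h.1) a b
    · exact fun h => absurd hx h
  · rw [Finset.sum_eq_zero fun z _ => localJ_pair_of_ne lam (fun h => hxy (h.1.symm.trans h.2)) a b,
      pairH_ket]
    simp [hxy]

/-- Projector onto the pairs with both particles at sites of `Λ`. -/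
def sitesIn (Λ : Finset ℤ) : PairSpace →L[ℂ] PairSpace :=
  weightedPull {q | q.1.1 ∈ Λ ∧ q.2.1 ∈ Λ} id (fun _ => 1) Function.injective_id.injOn
    (fun _ _ => by simp)

theorem sitesIn_apply (Λ : Finset ℤ) (v : PairSpace) (q : Mode × Mode) :
    sitesIn Λ v q = if q.1.1 ∈ Λ ∧ q.2.1 ∈ Λ then v q else 0 := by
  refine (weightedPull_apply _ _ _ _ _ _ _).trans ?_
  rw [one_mul]
  simp only [Set.mem_ofPred_eq, id]

theorem sitesIn_ket (Λ : Finset ℤ) (q : Mode × Mode) :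
    sitesIn Λ (ket q) = if q.1.1 ∈ Λ ∧ q.2.1 ∈ Λ then ket q else 0 := by
  refine ext_coord fun q' => ?_
  rw [sitesIn_apply, apply_ite (fun v : PairSpace => v q'), ket_apply]
  change _ = if _ then _ else (0 : ℂ)
  by_cases h : q' = q
  · subst h; rfl
  · simp [h]

theorem commute_sitesIn_pairH (Λ : Finset ℤ) (lam : ℂ) : Commute (sitesIn Λ) (pairH lam) := by
  refine ContinuousLinearMap.ext fun v => ext_coord fun ⟨⟨x, a⟩, ⟨y, b⟩⟩ => ?_
  change sitesIn Λ (pairH lam v) _ = pairH lam (sitesIn Λ v) _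
  rw [sitesIn_apply, pairH_apply, pairH_apply]
  simp only [sitesIn_apply]
  by_cases h : x ∈ Λ ∧ y ∈ Λ <;> simp [h]

/-- On pairs at sites of `Λ`, the interaction cut off to `Λ` acts as the two-particle
interaction. -/
theorem exp_sum_localJ_pairToFock (lam : ℂ) (Λ : Finset ℤ) {m n : Mode} (hm : m.1 ∈ Λ)
    (hn : n.1 ∈ Λ) :
    NormedSpace.exp ((-I) • ∑ z ∈ Λ, localJ lam z) (pairToFock (ket (m, n))) =
      pairToFock (pairJ lam (ket (m, n))) := by
  have h : ((-I) • ∑ z ∈ Λ, localJ lam z) ∘L (pairToFock ∘L sitesIn Λ) =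
      (pairToFock ∘L sitesIn Λ) ∘L ((-I) • pairH lam) := by
    rw [ContinuousLinearMap.smul_comp, ContinuousLinearMap.comp_smul]
    congr 1
    rw [ContinuousLinearMap.comp_assoc pairToFock, ← ContinuousLinearMap.mul_def (sitesIn Λ),
      (commute_sitesIn_pairH Λ lam).eq]
    refine clm_ext_ket fun q => ?_
    change (∑ z ∈ Λ, localJ lam z) (pairToFock (sitesIn Λ (ket q))) =
      pairToFock (pairH lam (sitesIn Λ (ket q)))
    rw [sitesIn_ket]
    split_ifs with hq
    · exact sum_localJ_pairToFock lam Λ hq.1 _ _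
    · rw [map_zero, map_zero, map_zero, map_zero]
  have h2 := exp_intertwine h
  have h3 := congrArg (fun A : PairSpace →L[ℂ] Fock => A (ket (m, n))) h2
  have h4 : Commute (sitesIn Λ) (pairJ lam) :=
    commute_exp_of_commute (commute_sitesIn_pairH Λ lam) _
  have h5 : sitesIn Λ (pairJ lam (ket (m, n))) = pairJ lam (sitesIn Λ (ket (m, n))) :=
    congrArg (fun A : PairSpace →L[ℂ] PairSpace => A (ket (m, n))) h4.eq
  change NormedSpace.exp ((-I) • ∑ z ∈ Λ, localJ lam z) (pairToFock (sitesIn Λ (ket (m, n)))) =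
    pairToFock (sitesIn Λ (pairJ lam (ket (m, n)))) at h3
  rwa [h5, sitesIn_ket, if_pos ⟨hm, hn⟩] at h3

theorem localJ_vacuum (lam : ℂ) (x : ℤ) : localJ lam x vacuum = 0 := by
  change lam • localO x _ + conj lam • ((localO x)†) _ = _
  rw [localO_apply, localO_adjoint_apply]
  simp [annihilate_vacuum]

theorem exp_apply_of_apply_eq_zero {E : Type*} [NormedAddCommGroup E] [InnerProductSpace ℂ E]
    [CompleteSpace E] {X : E →L[ℂ] E} {v : E} (h : X v = 0) : NormedSpace.exp X v = v := by
  have h1 : X ∘L ContinuousLinearMap.toSpanSingleton ℂ v =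
      ContinuousLinearMap.toSpanSingleton ℂ v ∘L (0 : ℂ →L[ℂ] ℂ) := by
    ext; simp [h]
  have h2 := congrArg (fun A : ℂ →L[ℂ] E => A 1) (exp_intertwine h1)
  simpa using h2

/-- Two consecutive conjugations telescope, and the interaction fixes the vacuum, so that a single
exponential acts on the freely evolved pair. -/
theorem automaton_pair (lam : ℂ) (Λ : Finset ℤ) {m₁ m₂ : Mode} (h1 : (freeMode m₁).1 ∈ Λ)
    (h2 : (freeMode m₂).1 ∈ Λ) :
    (((Real.sqrt 2 : ℝ) : ℂ)⁻¹) • automaton lam Λ m₁ (automaton lam Λ m₂ vacuum) =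
      pairToFock (pairA lam (ket (m₁, m₂))) := by
  have hvac : NormedSpace.exp (I • ∑ z ∈ Λ, localJ lam z) vacuum = vacuum := by
    apply exp_apply_of_apply_eq_zero
    rw [smul_apply, sum_apply,
      Finset.sum_eq_zero fun z _ => localJ_vacuum lam z, smul_zero]
  have hinv : NormedSpace.exp (I • ∑ z ∈ Λ, localJ lam z) *
      NormedSpace.exp ((-I) • ∑ z ∈ Λ, localJ lam z) = 1 := by
    let _ : NormedAlgebra ℚ (Fock →L[ℂ] Fock) := NormedAlgebra.restrictScalars ℚ ℂ _
    rw [← NormedSpace.exp_add_of_commute, ← add_smul, add_neg_cancel, zero_smul,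
      NormedSpace.exp_zero]
    exact ((Commute.refl _).smul_left _).smul_right _
  have hinv' : ∀ v, NormedSpace.exp (I • ∑ z ∈ Λ, localJ lam z)
      (NormedSpace.exp ((-I) • ∑ z ∈ Λ, localJ lam z) v) = v := fun v =>
    congrArg (fun A : Fock →L[ℂ] Fock => A v) hinv
  have hW : pairToFock ∘L antiPair = pairToFock := by
    rw [pairToFock, ContinuousLinearMap.smul_comp, ContinuousLinearMap.comp_assoc,
      ← ContinuousLinearMap.mul_def antiPair, antiPair_mul_self]
  have hA : pairToFock (pairA lam (ket (m₁, m₂))) =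
      pairToFock (pairJ lam (ket (freeMode m₁, freeMode m₂))) := by
    rw [(pairA_unitary lam).2.2.2, ← freePair_ket]
    exact congrArg (fun A : PairSpace →L[ℂ] Fock => A (pairJ lam (freePair (ket (m₁, m₂))))) hW
  rw [hA, ← exp_sum_localJ_pairToFock lam Λ h1 h2, pairToFock_ket, map_smul]
  congr 1
  change NormedSpace.exp ((-I) • ∑ z ∈ Λ, localJ lam z) (create (freeMode m₁)
    (NormedSpace.exp (I • ∑ z ∈ Λ, localJ lam z) (NormedSpace.exp ((-I) • ∑ z ∈ Λ, localJ lam z)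
      (create (freeMode m₂) (NormedSpace.exp (I • ∑ z ∈ Λ, localJ lam z) vacuum))))) = _
  rw [hvac, hinv']

end FockDynamics

/-! ### The step at fixed total momentum -/

section RelSpace

/-- The generator `λ Õ + conj λ Õ†` of the interaction in the relative coordinate. -/
def relH (lam : ℂ) : RelSpace →L[ℂ] RelSpace := lam • relO + conj lam • relO†

/-- The phases of the free evolution on the six internal states. -/
def relPhase (p : ℝ) : Fin 6 → ℂ :=
  ![exp (2 * I * p), exp (-2 * I * p), 1, exp (2 * I * p), exp (-2 * I * p), 1]

/-- The shifts of the free evolution on the six internal states. -/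
def relShift : Fin 6 → ℤ := ![0, 0, 2, 0, 0, -2]

theorem originHop_adjoint (i j : Fin 6) : (originHop i j)† = originHop j i := by
  refine weightedPull_adjoint _ _ _ _ _ _ _ _ _ _ ?_ ?_
  · rintro q rfl
    simp
  · rintro q rfl
    rfl

theorem originHop_apply (i j : Fin 6) (v : RelSpace) (k : Fin 6) (y : ℤ) :
    originHop i j v (k, y) = if k = i ∧ y = 0 then v (j, 0) else 0 := by
  refine (weightedPull_apply _ _ _ _ _ _ _).trans ?_
  rw [one_mul]
  simp only [Set.mem_ofPred_eq, Prod.mk.injEq]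

theorem relH_eq (lam : ℂ) : relH lam =
    lam • -(originHop 2 0 + originHop 2 1 + originHop 5 3 + originHop 5 4)
      + conj lam • -(originHop 0 2 + originHop 1 2 + originHop 3 5 + originHop 4 5) := by
  have h1 : relH lam = lam • relO + conj lam • relO† := rfl
  rw [h1, relO, map_neg, map_add, map_add, map_add, originHop_adjoint, originHop_adjoint,
    originHop_adjoint, originHop_adjoint]

theorem relH_apply (lam : ℂ) (v : RelSpace) (i : Fin 6) (y : ℤ) :
    relH lam v (i, y) = if y = 0 then
      -(![conj lam * v (2, 0), conj lam * v (2, 0), lam * (v (0, 0) + v (1, 0)),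
        conj lam * v (5, 0), conj lam * v (5, 0), lam * (v (3, 0) + v (4, 0))] : Fin 6 → ℂ) i
      else 0 := by
  rw [relH_eq]
  simp only [clm_add_coord, clm_smul_coord, clm_neg_coord, originHop_apply]
  by_cases hy : y = 0
  · subst hy
    fin_cases i <;> simp <;> ring
  · simp [hy]

theorem relH_cube (lam : ℂ) :
    relH lam * relH lam * relH lam = ((coupling lam : ℂ) ^ 2) • relH lam := by
  refine ContinuousLinearMap.ext fun v => ext_coord fun ⟨i, y⟩ => ?_
  rw [coupling_sq]
  change relH lam (relH lam (relH lam v)) _ = 2 * (lam * conj lam) * relH lam v _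
  by_cases hy : y = 0
  · subst hy
    fin_cases i <;> simp [relH_apply] <;> ring
  · simp [relH_apply, hy]

theorem relH_adjoint (lam : ℂ) : (relH lam)† = relH lam :=
  adjoint_smul_add_conj_smul_adjoint lam relO

theorem relJ_eq (lam : ℂ) (h0 : coupling lam ≠ 0) :
    relJ lam = 1 + ((-I) * (Real.sin (coupling lam) : ℂ) / (coupling lam : ℂ)) • relH lam
      + (((Real.cos (coupling lam) : ℂ) - 1) / (coupling lam : ℂ) ^ 2) •
        (relH lam * relH lam) :=
  exp_neg_I_smul_of_cube h0 (relH_cube lam)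

theorem relSwap_apply (v : RelSpace) (i : Fin 6) (y : ℤ) :
    relSwap v (i, y) = v (i + 3, -y) := by
  refine (weightedPull_apply _ _ _ _ _ _ _).trans ?_
  rw [if_pos (Set.mem_univ _), one_mul]

theorem relFree_apply (p : ℝ) (v : RelSpace) (i : Fin 6) (y : ℤ) :
    relFree p v (i, y) = relPhase p i * v (i, y + relShift i) := by
  refine (weightedPull_apply _ _ _ _ _ _ _).trans ?_
  rw [if_pos (Set.mem_univ _)]
  rfl

theorem fin_six_add_three_add_three (i : Fin 6) : i + 3 + 3 = i := by
  revert i; decide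

theorem relSwap_mul_self : relSwap * relSwap = 1 := by
  refine ContinuousLinearMap.ext fun v => ext_coord fun ⟨i, y⟩ => ?_
  change relSwap (relSwap v) (i, y) = v (i, y)
  rw [relSwap_apply, relSwap_apply, fin_six_add_three_add_three, neg_neg]

theorem relSwap_adjoint : relSwap† = relSwap := by
  refine weightedPull_adjoint _ _ _ _ _ _ _ _ _ _ ?_ ?_ <;>
    simp [fin_six_add_three_add_three]

theorem relAnti_adjoint : relAnti† = relAnti := by
  rw [relAnti, LinearIsometryEquiv.map_smulₛₗ, map_sub, relSwap_adjoint,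
    ContinuousLinearMap.one_def, ContinuousLinearMap.adjoint_id, map_div₀, map_one, map_ofNat]

theorem relAnti_mul_self : relAnti * relAnti = relAnti :=
  half_one_sub_mul_self relSwap_mul_self

theorem relAnti_relAnti (v : RelSpace) : relAnti (relAnti v) = relAnti v :=
  congrArg (fun A : RelSpace →L[ℂ] RelSpace => A v) relAnti_mul_self

theorem relAnti_apply (v : RelSpace) (i : Fin 6) (y : ℤ) :
    relAnti v (i, y) = (1 / 2 : ℂ) * (v (i, y) - v (i + 3, -y)) := by
  have h : relAnti v (i, y) = (1 / 2 : ℂ) * (v (i, y) - relSwap v (i, y)) := rfl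
  rw [h, relSwap_apply]

theorem relAnti_eq_self_iff (v : RelSpace) :
    relAnti v = v ↔ ∀ i y, v (i + 3, -y) = -v (i, y) := by
  constructor
  · intro h i y
    have h1 : relAnti v (i, y) = v (i, y) := by rw [h]
    rw [relAnti_apply] at h1
    linear_combination (-2 : ℂ) * h1
  · intro h
    refine ext_coord fun ⟨i, y⟩ => ?_
    rw [relAnti_apply, h]
    ring

theorem commute_relSwap_relH (lam : ℂ) : Commute relSwap (relH lam) := by
  refine ContinuousLinearMap.ext fun v => ext_coord fun ⟨i, y⟩ => ?_
  change relSwap (relH lam v) _ = relH lam (relSwap v) _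
  rw [relSwap_apply, relH_apply, relH_apply]
  simp only [neg_eq_zero, relSwap_apply]
  congr 1
  fin_cases i <;> rfl

theorem commute_relSwap_relFree (p : ℝ) : Commute relSwap (relFree p) := by
  refine ContinuousLinearMap.ext fun v => ext_coord fun ⟨i, y⟩ => ?_
  change relSwap (relFree p v) _ = relFree p (relSwap v) _
  have h1 : ∀ i : Fin 6, relPhase p (i + 3) = relPhase p i := by
    intro i; fin_cases i <;> rfl
  have h2 : ∀ i : Fin 6, relShift (i + 3) = -relShift i := by decide
  rw [relSwap_apply, relFree_apply, relFree_apply, relSwap_apply, h1, h2, neg_add]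

theorem commute_relAnti_relJ (lam : ℂ) : Commute relAnti (relJ lam) :=
  commute_half_one_sub (commute_exp_of_commute (commute_relSwap_relH lam) _)

theorem commute_relAnti_relFree (p : ℝ) : Commute relAnti (relFree p) :=
  commute_half_one_sub (commute_relSwap_relFree p)

theorem norm_relPhase (p : ℝ) (i : Fin 6) : ‖relPhase p i‖ = 1 := by
  fin_cases i <;> simp [relPhase, Complex.norm_exp]

theorem relFree_adjoint_apply (p : ℝ) (v : RelSpace) (i : Fin 6) (y : ℤ) :
    ((relFree p)†) v (i, y) = conj (relPhase p i) * v (i, y - relShift i) := by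
  have h : (relFree p)† = weightedPull Set.univ (fun q => (q.1, q.2 - relShift q.1))
      (fun q => conj (relPhase p q.1))
      (fun q _ q' _ h => by
        obtain ⟨i, y⟩ := q
        obtain ⟨i', y'⟩ := q'
        simp only [Prod.mk.injEq] at h ⊢
        obtain ⟨rfl, h⟩ := h
        exact ⟨rfl, by simpa using h⟩)
      (fun q _ => by rw [RCLike.norm_conj, norm_relPhase]) := by
    refine weightedPull_adjoint _ _ _ _ _ _ _ _ _ _ ?_ ?_
    · rintro ⟨i, y⟩ -
      refine ⟨trivial, ?_, rfl⟩
      change (i, y + relShift i - relShift i) = (i, y)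
      rw [add_sub_cancel_right]
    · exact fun _ _ => trivial
  rw [h]
  refine (weightedPull_apply _ _ _ _ _ _ _).trans ?_
  rw [if_pos (Set.mem_univ _)]

theorem conj_mul_relPhase (p : ℝ) (i : Fin 6) : conj (relPhase p i) * relPhase p i = 1 := by
  rw [mul_comm, mul_conj, normSq_eq_norm_sq, norm_relPhase]; norm_num

theorem relFree_unitary (p : ℝ) :
    (relFree p)† ∘L relFree p = 1 ∧ relFree p ∘L (relFree p)† = 1 := by
  constructor
  · refine ContinuousLinearMap.ext fun v => ext_coord fun ⟨i, y⟩ => ?_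
    rw [ContinuousLinearMap.comp_apply, relFree_adjoint_apply, relFree_apply, ← mul_assoc,
      conj_mul_relPhase, one_mul, sub_add_cancel]
    rfl
  · refine ContinuousLinearMap.ext fun v => ext_coord fun ⟨i, y⟩ => ?_
    rw [ContinuousLinearMap.comp_apply, relFree_apply, relFree_adjoint_apply, ← mul_assoc,
      mul_comm (relPhase p i), conj_mul_relPhase, one_mul, add_sub_cancel_right]
    rfl

theorem relJ_unitary (lam : ℂ) :
    (relJ lam)† ∘L relJ lam = 1 ∧ relJ lam ∘L (relJ lam)† = 1 :=
  exp_neg_I_smul_unitary (relH_adjoint lam)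

theorem relA_unitary (lam : ℂ) (p : ℝ) :
    (relA lam p)† ∘L relA lam p = relAnti ∧ relA lam p ∘L (relA lam p)† = relAnti ∧
      relA lam p = (relJ lam ∘L relFree p) ∘L relAnti ∧
      relA lam p = relAnti ∘L (relJ lam ∘L relFree p) := by
  have h : relA lam p = relAnti ∘L (relJ lam ∘L relFree p) ∘L relAnti := by
    rw [relA, ContinuousLinearMap.comp_assoc]
  rw [h]
  exact compress_unitary relAnti_adjoint relAnti_mul_self (relJ_unitary lam) (relFree_unitary p)
    (commute_relAnti_relJ lam) (commute_relAnti_relFree p)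

theorem originHop_ket (i j k : Fin 6) (y : ℤ) :
    originHop i j (ket (k, y)) = if k = j ∧ y = 0 then ket (i, 0) else 0 := by
  refine ext_coord fun ⟨l, z⟩ => ?_
  rw [originHop_apply, ket_apply, apply_ite (fun v : RelSpace => v (l, z)), ket_apply]
  change _ = if _ then _ else (0 : ℂ)
  simp only [Prod.mk.injEq]
  grind

/-- The images of the basis vectors at the origin under the generator. -/
def relHColumn (lam : ℂ) : Fin 6 → RelSpace :=
  ![-(lam • ket (2, 0)), -(lam • ket (2, 0)), -(conj lam • (ket (0, 0) + ket (1, 0))),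
    -(lam • ket (5, 0)), -(lam • ket (5, 0)), -(conj lam • (ket (3, 0) + ket (4, 0)))]

theorem relH_ket (lam : ℂ) (i : Fin 6) (y : ℤ) :
    relH lam (ket (i, y)) = if y = 0 then relHColumn lam i else 0 := by
  rw [relH_eq]
  simp only [add_apply, smul_apply, neg_apply, originHop_ket]
  by_cases hy : y = 0
  · subst hy
    fin_cases i <;> simp [relHColumn]
  · simp [hy]

theorem relFree_ket (p : ℝ) (i : Fin 6) (y : ℤ) :
    relFree p (ket (i, y)) = relPhase p i • ket (i, y - relShift i) := by
  refine ext_coord fun ⟨l, z⟩ => ?_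
  rw [relFree_apply, ket_apply]
  change _ = relPhase p i * (ket (i, y - relShift i) : RelSpace) (l, z)
  rw [ket_apply]
  by_cases hl : l = i
  · subst hl
    have : z + relShift l = y ↔ z = y - relShift l := by omega
    simp only [Prod.mk.injEq, true_and, this]
  · simp [hl]

theorem relSwap_ket (i : Fin 6) (y : ℤ) : relSwap (ket (i, y)) = ket (i + 3, -y) := by
  refine ext_coord fun ⟨l, z⟩ => ?_
  rw [relSwap_apply, ket_apply, ket_apply]
  have h : l + 3 = i ↔ l = i + 3 := by revert l i; decide
  have h' : -z = y ↔ z = -y := by omega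
  simp only [Prod.mk.injEq, h, h']

end RelSpace

/-! ### Fourier monomials on `(-π, π]` -/

section Fourier

instance : IsFiniteMeasure circleMeasure := by
  refine ⟨?_⟩
  rw [circleMeasure, Measure.restrict_apply_univ, Real.volume_Ioc]
  exact ENNReal.ofReal_lt_top

theorem integral_circle {E : Type*} [NormedAddCommGroup E] [NormedSpace ℝ E] (f : ℝ → E) :
    ∫ x, f x ∂circleMeasure = ∫ x in (-Real.pi)..Real.pi, f x := by
  rw [intervalIntegral.integral_of_le (by linarith [Real.pi_pos])]; rfl

theorem integral_circle_exp (n : ℤ) :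
    ∫ x : ℝ, exp (I * x * n) ∂circleMeasure = if n = 0 then 2 * (Real.pi : ℂ) else 0 := by
  rw [integral_circle]
  split_ifs with h
  · subst h
    simp; ring
  · have hc : I * (n : ℂ) ≠ 0 := mul_ne_zero I_ne_zero (by exact_mod_cast h)
    have h1 := integral_exp_mul_complex (a := -Real.pi) (b := Real.pi) hc
    have h2 : exp (I * n * (Real.pi : ℝ)) = exp (I * n * ((-Real.pi : ℝ) : ℂ)) := by
      rw [exp_eq_exp_iff_exists_int]
      exact ⟨n, by push_cast; ring⟩
    rw [h2, sub_self, zero_div] at h1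
    rw [← h1]
    congr 1
    ext x
    congr 1
    ring

variable {E : Type*} [NormedAddCommGroup E] [InnerProductSpace ℂ E]

/-- The normalized monomial `p ↦ (2π)^{-1/2} e^{ipz}`. -/
def monomial (z : ℤ) (p : ℝ) : ℂ :=
  ((Real.sqrt (2 * Real.pi) : ℝ) : ℂ)⁻¹ * exp (I * p * z)

theorem continuous_monomial (z : ℤ) : Continuous (monomial z) := by
  unfold monomial; fun_prop

theorem norm_monomial (z : ℤ) (p : ℝ) : ‖monomial z p‖ = (Real.sqrt (2 * Real.pi))⁻¹ := by
  rw [monomial, norm_mul, norm_inv, norm_real, Real.norm_of_nonneg (Real.sqrt_nonneg _),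
    Complex.norm_exp]
  simp

theorem conj_exp_I_mul (p : ℝ) (z : ℤ) : conj (exp (I * p * z)) = exp (I * p * ((-z : ℤ) : ℂ)) := by
  rw [← exp_conj]
  simp

theorem memLp_monomial (z : ℤ) (e : E) :
    MemLp (fun p => monomial z p • e) 2 circleMeasure := by
  refine MemLp.of_bound ((continuous_monomial z).smul continuous_const).aestronglyMeasurable
    ((Real.sqrt (2 * Real.pi))⁻¹ * ‖e‖) (Filter.Eventually.of_forall fun p => ?_)
  rw [norm_smul, norm_monomial]

/-- The element `p ↦ (2π)^{-1/2} e^{ipz} e` of the vector-valued `L²` space. -/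
def fourierVec (z : ℤ) (e : E) : Lp E 2 circleMeasure := (memLp_monomial z e).toLp _

theorem coeFn_fourierVec (z : ℤ) (e : E) :
    (fourierVec z e : ℝ → E) =ᵐ[circleMeasure] fun p => monomial z p • e :=
  MemLp.coeFn_toLp _

theorem inner_fourierVec_left (z : ℤ) (e : E) (f : Lp E 2 circleMeasure) :
    ⟪fourierVec z e, f⟫_ℂ =
      ∫ p, ((Real.sqrt (2 * Real.pi) : ℝ) : ℂ)⁻¹ * (exp (I * p * ((-z : ℤ) : ℂ)) * ⟪e, f p⟫_ℂ)
        ∂circleMeasure := by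
  rw [L2.inner_def]
  refine integral_congr_ae ?_
  filter_upwards [coeFn_fourierVec z e] with p hp
  rw [hp, inner_smul_left, monomial, map_mul, conj_exp_I_mul, map_inv₀, conj_ofReal, mul_assoc]

theorem inv_sqrt_two_pi_mul_self : ((Real.sqrt (2 * Real.pi) : ℝ) : ℂ)⁻¹ *
    ((Real.sqrt (2 * Real.pi) : ℝ) : ℂ)⁻¹ = (2 * (Real.pi : ℂ))⁻¹ := by
  rw [← mul_inv, ← ofReal_mul, Real.mul_self_sqrt (by positivity)]
  push_cast; rfl

theorem inner_fourierVec (z z' : ℤ) (e e' : E) :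
    ⟪fourierVec z e, fourierVec z' e'⟫_ℂ = if z = z' then ⟪e, e'⟫_ℂ else 0 := by
  rw [inner_fourierVec_left]
  have h : ∫ p, ((Real.sqrt (2 * Real.pi) : ℝ) : ℂ)⁻¹ *
      (exp (I * p * ((-z : ℤ) : ℂ)) * ⟪e, fourierVec z' e' p⟫_ℂ) ∂circleMeasure =
      ∫ p : ℝ, exp (I * p * ((z' - z : ℤ) : ℂ)) * ((2 * (Real.pi : ℂ))⁻¹ * ⟪e, e'⟫_ℂ)
        ∂circleMeasure := by
    refine integral_congr_ae ?_
    filter_upwards [coeFn_fourierVec z' e'] with p hp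
    rw [hp, inner_smul_right, monomial, ← inv_sqrt_two_pi_mul_self,
      show I * (p : ℂ) * ((z' - z : ℤ) : ℂ) = I * p * ((-z : ℤ) : ℂ) + I * p * z' by
        push_cast; ring, exp_add]
    ring
  rw [h, integral_mul_const, integral_circle_exp]
  have hpi : (2 * (Real.pi : ℂ)) ≠ 0 := by simp [Real.pi_ne_zero]
  by_cases hz : z = z'
  · subst hz
    rw [sub_self, if_pos rfl, if_pos rfl, ← mul_assoc, mul_inv_cancel₀ hpi, one_mul]
  · rw [if_neg hz, if_neg (sub_ne_zero.2 (Ne.symm hz)), zero_mul]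

/-- A square integrable function with vanishing Fourier coefficients vanishes. -/
theorem ae_eq_zero_of_fourier {g : ℝ → ℂ} (hg : MemLp g 2 circleMeasure)
    (h : ∀ z : ℤ, ∫ p : ℝ, exp (I * p * ((-z : ℤ) : ℂ)) * g p ∂circleMeasure = 0) :
    g =ᵐ[circleMeasure] 0 := by
  have hlt : -Real.pi < Real.pi := by linarith [Real.pi_pos]
  have h1 := hasSum_sq_fourierCoeffOn hlt hg
  have h2 : ∀ n, fourierCoeffOn hlt g n = 0 := by
    intro n
    rw [fourierCoeffOn_eq_integral, ← integral_circle]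
    have h3 : ∫ x : ℝ, fourier (-n) (x : AddCircle (Real.pi - -Real.pi)) • g x ∂circleMeasure =
        ∫ p : ℝ, exp (I * p * ((-n : ℤ) : ℂ)) * g p ∂circleMeasure := by
      congr 1
      ext x
      rw [fourier_coe_apply, smul_eq_mul]
      congr 2
      have hpi : (Real.pi : ℂ) ≠ 0 := by simp [Real.pi_ne_zero]
      push_cast
      field_simp
      ring
    rw [h3, h, smul_zero]
  simp only [h2, norm_zero, ne_eq, OfNat.ofNat_ne_zero, not_false_eq_true, zero_pow] at h1
  have h4 := h1.unique hasSum_zero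
  rw [smul_eq_zero, ← integral_circle] at h4
  have h5 : ∫ x, ‖g x‖ ^ 2 ∂circleMeasure = 0 :=
    h4.resolve_left (inv_ne_zero (by linarith [Real.pi_pos]))
  rw [integral_eq_zero_iff_of_nonneg (fun x => by positivity)
    ((memLp_two_iff_integrable_sq_norm hg.1).1 hg)] at h5
  filter_upwards [h5] with x hx
  simpa using hx

theorem inner_ae_eq_zero_of_fourierVec (e : E) (f : Lp E 2 circleMeasure)
    (h : ∀ z : ℤ, ⟪fourierVec z e, f⟫_ℂ = 0) :
    (fun p => ⟪e, f p⟫_ℂ) =ᵐ[circleMeasure] 0 := by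
  refine ae_eq_zero_of_fourier ((Lp.memLp f).const_inner e) fun z => ?_
  have h1 := h z
  rw [inner_fourierVec_left, integral_const_mul] at h1
  refine (mul_eq_zero.1 h1).resolve_left (inv_ne_zero ?_)
  have : Real.sqrt (2 * Real.pi) ≠ 0 := (Real.sqrt_pos.2 (by positivity)).ne'
  exact_mod_cast this

theorem orthonormal_fourierVec_ket {J : Type} [DecidableEq J] :
    Orthonormal ℂ (fun q : J × ℤ => fourierVec q.2 (ket q.1 : EllTwo J)) := by
  rw [orthonormal_iff_ite]
  rintro ⟨i, z⟩ ⟨i', z'⟩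
  rw [inner_fourierVec, inner_ket_ket]
  simp only [Prod.mk.injEq]
  by_cases h : i = i' <;> by_cases h' : z = z' <;> simp [h, h']

theorem fourierVec_ket_orthogonal_eq_bot {J : Type} [DecidableEq J] [Countable J] :
    (Submodule.span ℂ (Set.range fun q : J × ℤ => fourierVec q.2 (ket q.1 : EllTwo J)))ᗮ = ⊥ := by
  rw [Submodule.eq_bot_iff]
  intro f hf
  rw [Submodule.mem_orthogonal] at hf
  have h1 : ∀ j : J, (fun p => ⟪(ket j : EllTwo J), f p⟫_ℂ) =ᵐ[circleMeasure] 0 := fun j =>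
    inner_ae_eq_zero_of_fourierVec _ f fun z =>
      hf _ (Submodule.subset_span ⟨(j, z), rfl⟩)
  rw [Lp.eq_zero_iff_ae_eq_zero]
  filter_upwards [ae_all_iff.2 h1] with p hp
  refine ext_coord fun j => ?_
  rw [← inner_ket_left, hp]
  rfl

/-- The Hilbert basis of scalar monomials. -/
def fourierMonomialBasis : HilbertBasis ℤ ℂ MomentumSpace :=
  HilbertBasis.mkOfOrthogonalEqBot (v := fun z => fourierVec z (1 : ℂ))
    (by
      rw [orthonormal_iff_ite]
      intro z z'
      rw [inner_fourierVec]
      simp)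
    (by
      rw [Submodule.eq_bot_iff]
      intro f hf
      rw [Submodule.mem_orthogonal] at hf
      have h1 := inner_ae_eq_zero_of_fourierVec (1 : ℂ) f fun z =>
        hf _ (Submodule.subset_span ⟨z, rfl⟩)
      rw [Lp.eq_zero_iff_ae_eq_zero]
      filter_upwards [h1] with p hp
      simpa using hp)

theorem fourierMonomialBasis_apply (z : ℤ) :
    fourierMonomialBasis z = fourierVec z (1 : ℂ) := by
  rw [fourierMonomialBasis, HilbertBasis.coe_mkOfOrthogonalEqBot]

end Fourier

/-! ### Direct integral over the total momentum -/

section DirectIntegral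

/-- The Hilbert basis `p ↦ (2π)^{-1/2} e^{ipz} |e_i⟩|y⟩` of `L²((-π, π]; ℂ⁶ ⊗ ℓ²(ℤ))`. -/
def fibreBasis : HilbertBasis (Fin 6 × ℤ × ℤ) ℂ (Lp RelSpace 2 circleMeasure) :=
  HilbertBasis.mkOfOrthogonalEqBot
    (v := fun q => fourierVec q.2.2 (ket (q.1, q.2.1) : RelSpace))
    (orthonormal_fourierVec_ket.comp (fun q : Fin 6 × ℤ × ℤ => ((q.1, q.2.1), q.2.2))
      (Equiv.prodAssoc (Fin 6) ℤ ℤ).symm.injective)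
    (by
      rw [← fourierVec_ket_orthogonal_eq_bot (J := RelIndex),
        ← (Equiv.prodAssoc (Fin 6) ℤ ℤ).symm.surjective.range_comp]
      rfl)

/-- The unitary onto the direct integral over the total momentum. -/
def fibreUnitary : EllTwo (Fin 6 × ℤ × ℤ) ≃ₗᵢ[ℂ] Lp RelSpace 2 circleMeasure :=
  fibreBasis.repr.symm

theorem fibreUnitary_ket (i : Fin 6) (y z : ℤ) :
    fibreUnitary (ket (i, y, z)) = fourierVec z (ket (i, y) : RelSpace) := by
  rw [fibreUnitary, ket, HilbertBasis.repr_symm_single, fibreBasis,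
    HilbertBasis.coe_mkOfOrthogonalEqBot]

/-- The pair basis vector `|e_i⟩|x⟩|y⟩`. -/
def labelKet (i : Fin 6) (x y : ℤ) : PairSpace :=
  ket ((x, (relLabel i).1), (y, (relLabel i).2))

theorem toRelative_labelKet (i : Fin 6) (x y : ℤ) :
    toRelative (labelKet i x y) = ket (i, x - y, x + y) := by
  refine Eq.trans (congrArg toRelative (congrArg ket ?_))
    ((weightedPull_ket _ _ _ _ _ (i := (i, x - y, x + y)) ?_).trans (one_smul ℂ _))
  · rw [show x + y + (x - y) = 2 * x by ring, show x + y - (x - y) = 2 * y by ring,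
      Int.mul_ediv_cancel_left _ two_ne_zero, Int.mul_ediv_cancel_left _ two_ne_zero]
  · exact ⟨x, by ring⟩

theorem toRelative_adjoint_ket (i : Fin 6) (x y : ℤ) :
    (toRelative†) (ket (i, x - y, x + y)) = labelKet i x y := by
  refine (weightedPull_adjoint_ket _ _ _ _ _ _).trans ?_
  rw [if_pos (show (i, x - y, x + y) ∈ {q : Fin 6 × ℤ × ℤ | Even (q.2.2 + q.2.1)} from
    ⟨x, by ring⟩), map_one, one_smul]
  rw [show x + y + (x - y) = 2 * x by ring, show x + y - (x - y) = 2 * y by ring,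
    Int.mul_ediv_cancel_left _ two_ne_zero, Int.mul_ediv_cancel_left _ two_ne_zero]
  rfl

theorem projQ_labelKet (i : Fin 6) (x y : ℤ) : projQ (labelKet i x y) = labelKet i x y :=
  (weightedPull_ket {q : Mode × Mode | (q.1.2, q.2.2) ∈ Set.range relLabel} id _ _ _
    (i := ((x, (relLabel i).1), (y, (relLabel i).2))) ⟨i, rfl⟩).trans (one_smul ℂ _)

theorem projQ_ket_of_notMem {q : Mode × Mode} (hq : (q.1.2, q.2.2) ∉ Set.range relLabel) :
    projQ (ket q) = 0 := by
  refine weightedPull_ket_of_notMem _ _ _ _ _ ?_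
  rintro q' hq' rfl
  exact hq hq'

theorem toRelative_ket_of_notMem {q : Mode × Mode} (hq : (q.1.2, q.2.2) ∉ Set.range relLabel) :
    toRelative (ket q) = 0 := by
  refine weightedPull_ket_of_notMem _ _ _ _ _ ?_
  rintro r hr rfl
  exact hq ⟨r.1, rfl⟩

theorem eq_labelKet {q : Mode × Mode} (hq : (q.1.2, q.2.2) ∈ Set.range relLabel) :
    ∃ i, ket q = labelKet i q.1.1 q.2.1 := by
  obtain ⟨⟨x, a⟩, ⟨y, b⟩⟩ := q
  obtain ⟨i, hi⟩ := hq
  refine ⟨i, ?_⟩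
  simp only at hi
  rw [labelKet, hi]

theorem toRelative_adjoint_comp_self : toRelative† ∘L toRelative = projQ := by
  refine clm_ext_ket fun q => ?_
  rw [ContinuousLinearMap.comp_apply]
  by_cases hq : (q.1.2, q.2.2) ∈ Set.range relLabel
  · obtain ⟨i, hi⟩ := eq_labelKet hq
    rw [hi, toRelative_labelKet, toRelative_adjoint_ket, projQ_labelKet]
  · rw [toRelative_ket_of_notMem hq, projQ_ket_of_notMem hq, map_zero]

theorem toRelative_projQ (v : PairSpace) : toRelative (projQ v) = toRelative v := by
  have h : toRelative ∘L projQ = toRelative := by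
    refine clm_ext_ket fun q => ?_
    rw [ContinuousLinearMap.comp_apply]
    by_cases hq : (q.1.2, q.2.2) ∈ Set.range relLabel
    · obtain ⟨i, hi⟩ := eq_labelKet hq
      rw [hi, projQ_labelKet]
    · rw [toRelative_ket_of_notMem hq, projQ_ket_of_notMem hq, map_zero]
  exact congrArg (fun A : PairSpace →L[ℂ] EllTwo (Fin 6 × ℤ × ℤ) => A v) h

/-- The map of pairs to fibres over the total momentum. -/
def toFibres : PairSpace →L[ℂ] Lp RelSpace 2 circleMeasure :=
  (fibreUnitary.toContinuousLinearEquiv : EllTwo (Fin 6 × ℤ × ℤ) →L[ℂ] _) ∘L toRelative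

theorem toFibres_labelKet (i : Fin 6) (x y : ℤ) :
    toFibres (labelKet i x y) = fourierVec (x + y) (ket (i, x - y) : RelSpace) := by
  rw [← fibreUnitary_ket, ← toRelative_labelKet]; rfl

theorem toFibres_projQ (v : PairSpace) : toFibres (projQ v) = toFibres v := by
  rw [toFibres, ContinuousLinearMap.comp_apply, ContinuousLinearMap.comp_apply, toRelative_projQ]

theorem toFibres_ket_of_notMem {q : Mode × Mode} (hq : (q.1.2, q.2.2) ∉ Set.range relLabel) :
    toFibres (ket q) = 0 := by
  rw [toFibres, ContinuousLinearMap.comp_apply, toRelative_ket_of_notMem hq, map_zero]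

/-- The operator `X` on pairs acts as `Y p` on the fibre at total momentum `p`. -/
def ActsFibrewise (X : PairSpace →L[ℂ] PairSpace) (Y : ℝ → RelSpace →L[ℂ] RelSpace) : Prop :=
  ∀ v : PairSpace, (toFibres (X v) : ℝ → RelSpace) =ᵐ[circleMeasure]
    fun p => Y p ((toFibres v : ℝ → RelSpace) p)

theorem ActsFibrewise.mul {X X' : PairSpace →L[ℂ] PairSpace} {Y Y' : ℝ → RelSpace →L[ℂ] RelSpace}
    (h : ActsFibrewise X Y) (h' : ActsFibrewise X' Y') :
    ActsFibrewise (X * X') (fun p => Y p * Y' p) := by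
  intro v
  filter_upwards [h (X' v), h' v] with p h1 h2
  rw [mul_apply_eq_comp, h1, h2]
  rfl

theorem ActsFibrewise.add {X X' : PairSpace →L[ℂ] PairSpace} {Y Y' : ℝ → RelSpace →L[ℂ] RelSpace}
    (h : ActsFibrewise X Y) (h' : ActsFibrewise X' Y') :
    ActsFibrewise (X + X') (fun p => Y p + Y' p) := by
  intro v
  have h0 := Lp.coeFn_add (toFibres (X v)) (toFibres (X' v))
  rw [← map_add] at h0
  filter_upwards [h v, h' v, h0] with p h1 h2 h3
  refine h3.trans ?_
  rw [Pi.add_apply, h1, h2]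
  rfl

theorem ActsFibrewise.smul (c : ℂ) {X : PairSpace →L[ℂ] PairSpace}
    {Y : ℝ → RelSpace →L[ℂ] RelSpace} (h : ActsFibrewise X Y) :
    ActsFibrewise (c • X) (fun p => c • Y p) := by
  intro v
  have h0 := Lp.coeFn_smul c (toFibres (X v))
  rw [← map_smul] at h0
  filter_upwards [h v, h0] with p h1 h3
  refine h3.trans ?_
  rw [Pi.smul_apply, h1]
  rfl

theorem actsFibrewise_one : ActsFibrewise 1 (fun _ => 1) := fun _ => Filter.EventuallyEq.rfl

theorem actsFibrewise_projQ : ActsFibrewise projQ (fun _ => 1) := by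
  intro v
  rw [toFibres_projQ]
  exact Filter.EventuallyEq.rfl

/-- The fibrewise action can be checked on the vectors `|e_i⟩|x⟩|y⟩`, as convergence in `L²`
implies convergence almost everywhere along a subsequence. -/
theorem actsFibrewise_of_labelKet {X : PairSpace →L[ℂ] PairSpace}
    {Y : ℝ → RelSpace →L[ℂ] RelSpace} (hX : Commute projQ X)
    (h : ∀ (i : Fin 6) (x y : ℤ),
      (toFibres (X (labelKet i x y)) : ℝ → RelSpace) =ᵐ[circleMeasure]
        fun p => monomial (x + y) p • Y p (ket (i, x - y))) : ActsFibrewise X Y := by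
  let S : Submodule ℂ PairSpace :=
    { carrier := {v | (toFibres (X v) : ℝ → RelSpace) =ᵐ[circleMeasure]
        fun p => Y p ((toFibres v : ℝ → RelSpace) p)}
      zero_mem' := by
        change (toFibres (X 0) : ℝ → RelSpace) =ᵐ[circleMeasure]
          fun p => Y p ((toFibres (0 : PairSpace) : ℝ → RelSpace) p)
        rw [map_zero, map_zero]
        filter_upwards [Lp.coeFn_zero RelSpace 2 circleMeasure] with p hp
        rw [hp, Pi.zero_apply, map_zero]
      add_mem' := by
        intro v w hv hw
        change (toFibres (X (v + w)) : ℝ → RelSpace) =ᵐ[circleMeasure]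
          fun p => Y p ((toFibres (v + w) : ℝ → RelSpace) p)
        rw [map_add, map_add, map_add]
        filter_upwards [hv, hw, Lp.coeFn_add (toFibres (X v)) (toFibres (X w)),
          Lp.coeFn_add (toFibres v) (toFibres w)] with p h1 h2 h3 h4
        rw [h3, h4, Pi.add_apply, Pi.add_apply, h1, h2, map_add]
      smul_mem' := by
        intro c v hv
        change (toFibres (X (c • v)) : ℝ → RelSpace) =ᵐ[circleMeasure]
          fun p => Y p ((toFibres (c • v) : ℝ → RelSpace) p)
        rw [map_smul, map_smul, map_smul]
        filter_upwards [hv, Lp.coeFn_smul c (toFibres (X v)), Lp.coeFn_smul c (toFibres v)]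
          with p h1 h3 h4
        rw [h3, h4, Pi.smul_apply, Pi.smul_apply, h1, map_smul] }
  have hclosed : IsClosed (S : Set PairSpace) := by
    refine IsSeqClosed.isClosed fun u v hu huv => ?_
    have h1 : Filter.Tendsto (fun n => toFibres (X (u n))) Filter.atTop
        (nhds (toFibres (X v))) := ((toFibres ∘L X).continuous.tendsto v).comp huv
    have h2 : Filter.Tendsto (fun n => toFibres (u n)) Filter.atTop (nhds (toFibres v)) :=
      (toFibres.continuous.tendsto v).comp huv
    obtain ⟨ns, hns, h3⟩ := (tendstoInMeasure_of_tendsto_Lp h1).exists_seq_tendsto_ae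
    obtain ⟨ms, hms, h4⟩ := (tendstoInMeasure_of_tendsto_Lp
      (h2.comp hns.tendsto_atTop)).exists_seq_tendsto_ae
    have h5 : ∀ᵐ p ∂circleMeasure, ∀ n, (toFibres (X (u n)) : ℝ → RelSpace) p =
        Y p ((toFibres (u n) : ℝ → RelSpace) p) := ae_all_iff.2 hu
    filter_upwards [h3, h4, h5] with p h6 h7 h8
    have h9 := ((Y p).continuous.tendsto _).comp h7
    refine tendsto_nhds_unique (h6.comp hms.tendsto_atTop) (h9.congr fun n => ?_)
    exact (h8 _).symm
  intro v
  refine mem_of_forall_ket hclosed (fun q => ?_) v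
  change (toFibres (X (ket q)) : ℝ → RelSpace) =ᵐ[circleMeasure]
    fun p => Y p ((toFibres (ket q) : ℝ → RelSpace) p)
  by_cases hq : (q.1.2, q.2.2) ∈ Set.range relLabel
  · obtain ⟨i, hi⟩ := eq_labelKet hq
    rw [hi]
    filter_upwards [h i q.1.1 q.2.1, coeFn_fourierVec (q.1.1 + q.2.1)
      (ket (i, q.1.1 - q.2.1) : RelSpace)] with p h1 h2
    rw [h1, toFibres_labelKet, h2, map_smul]
  · have h1 : X (projQ (ket q)) = projQ (X (ket q)) :=
      congrArg (fun A : PairSpace →L[ℂ] PairSpace => A (ket q)) hX.symm.eq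
    rw [← toFibres_projQ, ← h1, projQ_ket_of_notMem hq, map_zero, toFibres_ket_of_notMem hq,
      map_zero]
    filter_upwards [Lp.coeFn_zero RelSpace 2 circleMeasure] with p hp
    rw [hp, Pi.zero_apply, map_zero]

theorem monomial_add (z z' : ℤ) (p : ℝ) :
    monomial (z + z') p = exp (I * p * z') * monomial z p := by
  rw [monomial, monomial, mul_left_comm, ← exp_add]
  congr 2
  push_cast; ring

theorem relLabel_direction (i : Fin 6) (p : ℝ) :
    direction (relLabel i).1 - direction (relLabel i).2 = -relShift i ∧
      exp (I * p * ((direction (relLabel i).1 + direction (relLabel i).2 : ℤ) : ℂ)) =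
        relPhase p i := by
  fin_cases i <;> simp [direction, relLabel, relShift, relPhase] <;> ring_nf

theorem actsFibrewise_freePair : ActsFibrewise freePair relFree := by
  refine actsFibrewise_of_labelKet commute_projQ_freePair fun i x y => ?_
  have h : freePair (labelKet i x y) =
      labelKet i (x + direction (relLabel i).1) (y + direction (relLabel i).2) :=
    freePair_ket _ _
  rw [h, toFibres_labelKet]
  filter_upwards [coeFn_fourierVec (x + direction (relLabel i).1 + (y + direction (relLabel i).2))
    (ket (i, x + direction (relLabel i).1 - (y + direction (relLabel i).2)) : RelSpace)] with p hp
  obtain ⟨h1, h2⟩ := relLabel_direction i p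
  rw [hp, relFree_ket, show x + direction (relLabel i).1 + (y + direction (relLabel i).2) =
    x + y + (direction (relLabel i).1 + direction (relLabel i).2) by ring, monomial_add, h2,
    smul_smul, mul_comm,
    show x + direction (relLabel i).1 - (y + direction (relLabel i).2) =
      x - y + (direction (relLabel i).1 - direction (relLabel i).2) by ring, h1, sub_eq_add_neg,
    sub_eq_add_neg]

theorem relLabel_add_three (i : Fin 6) : relLabel (i + 3) = (relLabel i).swap := by
  revert i; decide

theorem actsFibrewise_swapPair : ActsFibrewise swapPair (fun _ => relSwap) := by
  refine actsFibrewise_of_labelKet commute_projQ_swapPair fun i x y => ?_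
  have h : swapPair (labelKet i x y) = labelKet (i + 3) y x := by
    rw [labelKet, labelKet, swapPair_ket, relLabel_add_three]; rfl
  rw [h, toFibres_labelKet]
  filter_upwards [coeFn_fourierVec (y + x) (ket (i + 3, y - x) : RelSpace)] with p hp
  rw [hp, relSwap_ket, add_comm y x, neg_sub]

theorem actsFibrewise_antiPair : ActsFibrewise antiPair (fun _ => relAnti) := by
  have h := (actsFibrewise_one.add (actsFibrewise_swapPair.smul (-1))).smul (1 / 2)
  have h1 : antiPair = (1 / 2 : ℂ) • (1 + (-1 : ℂ) • swapPair) := by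
    rw [antiPair, neg_one_smul, sub_eq_add_neg]
  have h2 : relAnti = (1 / 2 : ℂ) • (1 + (-1 : ℂ) • relSwap) := by
    rw [relAnti, neg_one_smul, sub_eq_add_neg]
  rw [h1, h2]
  exact h

theorem pairH_labelKet (lam : ℂ) (i : Fin 6) (x y : ℤ) :
    pairH lam (labelKet i x y) = if x = y then
      (![-(lam • labelKet 2 x y), -(lam • labelKet 2 x y),
        -(conj lam • (labelKet 0 x y + labelKet 1 x y)),
        -(lam • labelKet 5 x y), -(lam • labelKet 5 x y),
        -(conj lam • (labelKet 3 x y + labelKet 4 x y))] : Fin 6 → PairSpace) i else 0 := by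
  rw [labelKet, pairH_ket]
  by_cases hxy : x = y
  · subst hxy
    fin_cases i <;> (simp [labelKet, relLabel]; try abel)
  · simp [hxy]

theorem fourierVec_smul {E : Type*} [NormedAddCommGroup E] [InnerProductSpace ℂ E] (z : ℤ) (c : ℂ)
    (e : E) : fourierVec z (c • e) = c • fourierVec z e := by
  refine Lp.ext ?_
  filter_upwards [coeFn_fourierVec z (c • e), coeFn_fourierVec z e,
    Lp.coeFn_smul c (fourierVec z e)] with p h1 h2 h3
  rw [h1, h3, Pi.smul_apply, h2, smul_comm]

theorem fourierVec_add {E : Type*} [NormedAddCommGroup E] [InnerProductSpace ℂ E] (z : ℤ)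
    (e e' : E) : fourierVec z (e + e') = fourierVec z e + fourierVec z e' := by
  refine Lp.ext ?_
  filter_upwards [coeFn_fourierVec z (e + e'), coeFn_fourierVec z e, coeFn_fourierVec z e',
    Lp.coeFn_add (fourierVec z e) (fourierVec z e')] with p h1 h2 h3 h4
  rw [h1, h4, Pi.add_apply, h2, h3, smul_add]

theorem fourierVec_neg {E : Type*} [NormedAddCommGroup E] [InnerProductSpace ℂ E] (z : ℤ)
    (e : E) : fourierVec z (-e) = -fourierVec z e := by
  rw [← neg_one_smul ℂ, fourierVec_smul, neg_one_smul]

theorem actsFibrewise_pairH (lam : ℂ) : ActsFibrewise (pairH lam) (fun _ => relH lam) := by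
  refine actsFibrewise_of_labelKet
    ((projQ_mul_pairH lam).trans (pairH_mul_projQ lam).symm) fun i x y => ?_
  have h : toFibres (pairH lam (labelKet i x y)) =
      fourierVec (x + y) (relH lam (ket (i, x - y))) := by
    rw [pairH_labelKet, relH_ket]
    by_cases hxy : x = y
    · subst hxy
      rw [if_pos rfl, if_pos (sub_self x)]
      fin_cases i <;>
        simp [relHColumn, toFibres_labelKet, fourierVec_neg, fourierVec_smul, fourierVec_add]
    · rw [if_neg hxy, if_neg (sub_ne_zero.2 hxy), map_zero, ← zero_smul ℂ (0 : RelSpace),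
        fourierVec_smul, zero_smul]
  rw [h]
  exact coeFn_fourierVec _ _

theorem actsFibrewise_pairJ (lam : ℂ) (h0 : coupling lam ≠ 0) :
    ActsFibrewise (pairJ lam) (fun _ => relJ lam) := by
  rw [pairJ_eq lam h0, relJ_eq lam h0]
  exact (actsFibrewise_one.add ((actsFibrewise_pairH lam).smul _)).add
    (((actsFibrewise_pairH lam).mul (actsFibrewise_pairH lam)).smul _)

theorem actsFibrewise_nontrivialPart (lam : ℂ) (h0 : coupling lam ≠ 0) :
    ActsFibrewise (nontrivialPart lam) (relA lam) := by
  have h := actsFibrewise_projQ.mul ((actsFibrewise_antiPair.mul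
    (((actsFibrewise_pairJ lam h0).mul actsFibrewise_freePair).mul actsFibrewise_antiPair)).mul
      actsFibrewise_projQ)
  have h1 : relA lam = fun p => 1 * (relAnti * (relJ lam * relFree p * relAnti) * 1) := by
    funext p
    rw [one_mul, mul_one, mul_assoc (relJ lam)]
    rfl
  rw [h1]
  exact h

end DirectIntegral

/-! ### Improper eigenvectors -/

section ImproperEigenvectors

theorem relFree_adjoint_ket (p : ℝ) (i : Fin 6) (y : ℤ) :
    ((relFree p)†) (ket (i, y)) = conj (relPhase p i) • ket (i, y + relShift i) := by
  refine ext_coord fun ⟨l, z⟩ => ?_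
  rw [relFree_adjoint_apply, ket_apply]
  change _ = conj (relPhase p i) * (ket (i, y + relShift i) : RelSpace) (l, z)
  rw [ket_apply]
  by_cases hl : l = i
  · subst hl
    have : z - relShift l = y ↔ z = y + relShift l := by omega
    simp only [Prod.mk.injEq, true_and, this]
  · simp [hl]

/-- `sin(√2|λ|) / (√2|λ|)`. -/
def sinCoupling (lam : ℂ) : ℂ := (Real.sin (coupling lam) : ℂ) / (coupling lam : ℂ)

/-- `cos(√2|λ|)`. -/
def cosCoupling (lam : ℂ) : ℂ := (Real.cos (coupling lam) : ℂ)

theorem conj_sinCoupling (lam : ℂ) : conj (sinCoupling lam) = sinCoupling lam := by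
  rw [sinCoupling, map_div₀, conj_ofReal, conj_ofReal]

theorem conj_cosCoupling (lam : ℂ) : conj (cosCoupling lam) = cosCoupling lam := conj_ofReal _

theorem two_mul_sinCoupling_sq (lam : ℂ) (h0 : coupling lam ≠ 0) :
    2 * sinCoupling lam ^ 2 * (lam * conj lam) = 1 - cosCoupling lam ^ 2 := by
  have hc : (coupling lam : ℂ) ≠ 0 := by exact_mod_cast h0
  have h1 : (Real.sin (coupling lam) : ℂ) ^ 2 + cosCoupling lam ^ 2 = 1 := by
    rw [cosCoupling]; exact_mod_cast Real.sin_sq_add_cos_sq (coupling lam)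
  have h2 := coupling_sq lam
  rw [sinCoupling, div_pow, eq_sub_iff_add_eq, ← h1]
  congr 1
  field_simp
  rw [h2]; ring

/-- The quadratic polynomials in the generator that occur as the interaction and its adjoint. -/
def relHPoly (lam x : ℂ) : RelSpace →L[ℂ] RelSpace :=
  1 + x • relH lam + ((cosCoupling lam - 1) / (coupling lam : ℂ) ^ 2) • (relH lam * relH lam)

theorem relJ_eq_relHPoly (lam : ℂ) (h0 : coupling lam ≠ 0) :
    relJ lam = relHPoly lam (-(I * sinCoupling lam)) := by
  rw [relJ_eq lam h0, relHPoly, sinCoupling, cosCoupling, mul_div_assoc, neg_mul]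

theorem relJ_adjoint_eq (lam : ℂ) (h0 : coupling lam ≠ 0) :
    (relJ lam)† = relHPoly lam (I * sinCoupling lam) := by
  rw [relJ_eq_relHPoly lam h0, relHPoly, relHPoly, map_add, map_add,
    LinearIsometryEquiv.map_smulₛₗ, LinearIsometryEquiv.map_smulₛₗ, ContinuousLinearMap.mul_def,
    ContinuousLinearMap.adjoint_comp, relH_adjoint, ContinuousLinearMap.one_def,
    ContinuousLinearMap.adjoint_id]
  congr 2
  · rw [map_neg, map_mul, conj_sinCoupling, conj_I, neg_mul, neg_neg]
  · rw [map_div₀, map_pow, map_sub, conj_ofReal, conj_cosCoupling, map_one]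

theorem relHPoly_ket_of_ne (lam x : ℂ) (i : Fin 6) {y : ℤ}
    (hy : y ≠ 0) : relHPoly lam x (ket (i, y)) = ket (i, y) := by
  rw [relHPoly]
  simp only [add_apply, smul_apply, mul_apply_eq_comp, one_apply_eq_self, relH_ket, if_neg hy,
    map_zero, smul_zero, add_zero]

theorem cosCoupling_sub_one_div (lam : ℂ) (h0 : coupling lam ≠ 0) :
    (cosCoupling lam - 1) / 2 =
      (cosCoupling lam - 1) / (coupling lam : ℂ) ^ 2 * (lam * conj lam) := by
  have hc : (coupling lam : ℂ) ≠ 0 := by exact_mod_cast h0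
  have h2 := coupling_sq lam
  rw [div_mul_eq_mul_div, div_eq_div_iff two_ne_zero (pow_ne_zero 2 hc), h2]; ring

theorem relHPoly_ket_zero (lam x : ℂ) (h0 : coupling lam ≠ 0) :
    relHPoly lam x (ket (0, 0)) = ket (0, 0)
      + ((cosCoupling lam - 1) / 2) • (ket (0, 0) + ket (1, 0)) - (x * lam) • ket (2, 0) := by
  rw [relHPoly, cosCoupling_sub_one_div lam h0]
  simp only [add_apply, smul_apply, mul_apply_eq_comp, one_apply_eq_self, relH_ket, if_true,
    relHColumn, Matrix.cons_val, map_neg, map_smul]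
  module

theorem relHPoly_ket_one (lam x : ℂ) (h0 : coupling lam ≠ 0) :
    relHPoly lam x (ket (1, 0)) = ket (1, 0)
      + ((cosCoupling lam - 1) / 2) • (ket (0, 0) + ket (1, 0)) - (x * lam) • ket (2, 0) := by
  rw [relHPoly, cosCoupling_sub_one_div lam h0]
  simp only [add_apply, smul_apply, mul_apply_eq_comp, one_apply_eq_self, relH_ket, if_true,
    relHColumn, Matrix.cons_val, map_neg, map_smul]
  module

theorem relHPoly_ket_two (lam x : ℂ) (h0 : coupling lam ≠ 0) :
    relHPoly lam x (ket (2, 0)) = cosCoupling lam • ket (2, 0)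
      - (x * conj lam) • (ket (0, 0) + ket (1, 0)) := by
  have h1 : cosCoupling lam = 1 + (cosCoupling lam - 1) / (coupling lam : ℂ) ^ 2 *
      (lam * conj lam) * 2 := by
    rw [← cosCoupling_sub_one_div lam h0]; ring
  rw [relHPoly]
  conv_rhs => rw [h1]
  simp only [add_apply, smul_apply, mul_apply_eq_comp, one_apply_eq_self, relH_ket, if_true,
    relHColumn, Matrix.cons_val, map_neg, map_smul, map_add]
  module

theorem relA_adjoint_eq (lam : ℂ) (p : ℝ) :
    (relA lam p)† = relAnti ∘L ((relFree p)† ∘L (relJ lam)†) := by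
  rw [(relA_unitary lam p).2.2.1, ContinuousLinearMap.adjoint_comp,
    ContinuousLinearMap.adjoint_comp, relAnti_adjoint]

theorem hasSum_congr_fun {ι : Type*} {f g : ι → ℂ} {s : ℂ} (h : ∀ i, f i = g i) :
    HasSum f s ↔ HasSum g s := by
  rw [funext h]

/-- The formal pairing `⟨w|φ⟩` of a vector `w` with formal components `φ` converges to `s`. -/
def FormalPairing (φ : RelIndex → ℂ) (w : RelSpace) (s : ℂ) : Prop :=
  HasSum (fun j => conj (w j) * φ j) s

theorem FormalPairing.add {φ : RelIndex → ℂ} {w w' : RelSpace} {s s' : ℂ}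
    (h : FormalPairing φ w s) (h' : FormalPairing φ w' s') :
    FormalPairing φ (w + w') (s + s') := by
  refine (hasSum_congr_fun fun j => ?_).1 (HasSum.add h h')
  rw [lp.coeFn_add, Pi.add_apply, map_add, add_mul]

theorem FormalPairing.smul {φ : RelIndex → ℂ} {w : RelSpace} {s : ℂ} (c : ℂ)
    (h : FormalPairing φ w s) : FormalPairing φ (c • w) (conj c * s) := by
  refine (hasSum_congr_fun fun j => ?_).1 (HasSum.mul_left (conj c) h)
  rw [lp.coeFn_smul, Pi.smul_apply, smul_eq_mul, map_mul, mul_assoc]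

theorem formalPairing_ket (φ : RelIndex → ℂ) (i : RelIndex) : FormalPairing φ (ket i) (φ i) := by
  refine (hasSum_congr_fun fun j => ?_).1 (hasSum_ite_eq i (φ i))
  rw [ket_apply]
  by_cases h : j = i
  · subst h; simp
  · simp [h]

/-- Components antisymmetric under the exchange of the particles. -/
def IsAntisymmetric (φ : RelIndex → ℂ) : Prop := ∀ i y, φ (i + 3, -y) = -φ (i, y)

theorem FormalPairing.relAnti {φ : RelIndex → ℂ} (hφ : IsAntisymmetric φ) {w : RelSpace} {s : ℂ}
    (h : FormalPairing φ w s) : FormalPairing φ (relAnti w) s := by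
  let σ : RelIndex ≃ RelIndex :=
    { toFun := fun q => (q.1 + 3, -q.2)
      invFun := fun q => (q.1 + 3, -q.2)
      left_inv := fun q => by simp [fin_six_add_three_add_three]
      right_inv := fun q => by simp [fin_six_add_three_add_three] }
  have h1 : HasSum (fun j => conj (w (σ j)) * φ (σ j)) s := (Equiv.hasSum_iff σ).2 h
  have h2 := (HasSum.add h h1).mul_left (1 / 2 : ℂ)
  have h3 : (1 / 2 : ℂ) * (s + s) = s := by ring
  rw [h3] at h2
  refine (hasSum_congr_fun fun ⟨i, y⟩ => ?_).1 h2
  rw [relAnti_apply, map_mul, map_sub, show φ (σ (i, y)) = -φ (i, y) from hφ i y,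
    map_div₀, map_one, map_ofNat]
  change _ * (_ + conj (w (i + 3, -y)) * _) = _
  ring

theorem isImproperEigenvector_iff (A : RelSpace →L[ℂ] RelSpace) (c : ℂ) (φ : RelIndex → ℂ) :
    IsImproperEigenvector A c φ ↔ ∀ i, FormalPairing φ ((A†) (ket i)) (c * φ i) := by
  refine forall_congr' fun i => hasSum_congr_fun fun j => ?_
  rw [← ContinuousLinearMap.adjoint_inner_left, inner_ket_right]

theorem relA_adjoint_relSwap (lam : ℂ) (p : ℝ) (v : RelSpace) :
    ((relA lam p)†) (relSwap v) = -((relA lam p)†) v := by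
  have h : relAnti * relSwap = -relAnti := by
    rw [relAnti, smul_mul_assoc, sub_mul, relSwap_mul_self, one_mul, ← smul_neg, neg_sub]
  have h1 : (relA lam p)† = (relA lam p)† * relAnti := by
    rw [relA, ContinuousLinearMap.mul_def, ContinuousLinearMap.adjoint_comp, relAnti_adjoint,
      ContinuousLinearMap.adjoint_comp, ContinuousLinearMap.comp_assoc _ relAnti relAnti,
      ← ContinuousLinearMap.mul_def relAnti relAnti, relAnti_mul_self]
  have h2 : (relA lam p)† * relSwap = -(relA lam p)† := by
    rw [h1, mul_assoc, h, mul_neg]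
  exact congrArg (fun A : RelSpace →L[ℂ] RelSpace => A v) h2

/-- The eigenvector equation in components. By antisymmetry three of the six internal states
suffice. -/
theorem isImproperEigenvector_relA (lam : ℂ) (h0 : coupling lam ≠ 0) (p : ℝ) (μ : ℂ)
    (φ : RelIndex → ℂ) (hφ : IsAntisymmetric φ)
    (ha : ∀ y : ℤ, y ≠ 0 → φ (0, y) = 0) (hb : ∀ y : ℤ, y ≠ 0 → φ (1, y) = 0)
    (hg : ∀ y : ℤ, y ≠ 0 → φ (2, y + 2) = μ * φ (2, y))
    (ha0 : exp (2 * I * p) * φ (0, 0) + (cosCoupling lam - 1) / 2 *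
      (exp (2 * I * p) * φ (0, 0) + exp (-2 * I * p) * φ (1, 0))
        + I * sinCoupling lam * conj lam * φ (2, 2) = μ * φ (0, 0))
    (hb0 : exp (-2 * I * p) * φ (1, 0) + (cosCoupling lam - 1) / 2 *
      (exp (2 * I * p) * φ (0, 0) + exp (-2 * I * p) * φ (1, 0))
        + I * sinCoupling lam * conj lam * φ (2, 2) = μ * φ (1, 0))
    (hg0 : cosCoupling lam * φ (2, 2) + I * sinCoupling lam * lam *
      (exp (2 * I * p) * φ (0, 0) + exp (-2 * I * p) * φ (1, 0)) = μ * φ (2, 0)) :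
    IsImproperEigenvector (relA lam p) μ φ := by
  rw [isImproperEigenvector_iff]
  have hfree : ∀ (i : Fin 6) (y : ℤ), FormalPairing φ (((relFree p)†) (ket (i, y)))
      (relPhase p i * φ (i, y + relShift i)) := by
    intro i y
    rw [relFree_adjoint_ket]
    have h := (formalPairing_ket φ (i, y + relShift i)).smul (conj (relPhase p i))
    rwa [conj_conj] at h
  have hp0 : relPhase p 0 = exp (2 * I * p) := rfl
  have hp1 : relPhase p 1 = exp (-2 * I * p) := rfl
  have hp2 : relPhase p 2 = 1 := rfl
  have hs0 : relShift 0 = 0 := rfl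
  have hs1 : relShift 1 = 0 := rfl
  have hs2 : relShift 2 = 2 := rfl
  have hf0 := hfree 0 0
  have hf1 := hfree 1 0
  have hf2 := hfree 2 0
  rw [hp0, hs0, add_zero] at hf0
  rw [hp1, hs1, add_zero] at hf1
  rw [hp2, hs2, one_mul, zero_add] at hf2
  have hI : ∀ x : ℂ, conj (-(I * sinCoupling lam * x)) = I * sinCoupling lam * conj x := by
    intro x
    rw [map_neg, map_mul, map_mul, conj_I, conj_sinCoupling]; ring
  have hC : conj ((cosCoupling lam - 1) / 2) = (cosCoupling lam - 1) / 2 := by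
    rw [map_div₀, map_sub, conj_cosCoupling, map_one, map_ofNat]
  -- the rows of the internal states `e₁, e₂, e₃`
  have hrow : ∀ i : Fin 6, (i = 0 ∨ i = 1 ∨ i = 2) → ∀ y : ℤ,
      FormalPairing φ (((relFree p)†) (((relJ lam)†) (ket (i, y)))) (μ * φ (i, y)) := by
    intro i hi y
    by_cases hy : y = 0
    · subst hy
      rcases hi with rfl | rfl | rfl
      · rw [relJ_adjoint_eq lam h0, relHPoly_ket_zero lam _ h0, ← ha0, sub_eq_add_neg, ← neg_smul]
        simp only [map_add, map_smul]
        have h := (hf0.add ((hf0.add hf1).smul ((cosCoupling lam - 1) / 2))).add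
          (hf2.smul (-(I * sinCoupling lam * lam)))
        rwa [hI, hC] at h
      · rw [relJ_adjoint_eq lam h0, relHPoly_ket_one lam _ h0, ← hb0, sub_eq_add_neg, ← neg_smul]
        simp only [map_add, map_smul]
        have h := (hf1.add ((hf0.add hf1).smul ((cosCoupling lam - 1) / 2))).add
          (hf2.smul (-(I * sinCoupling lam * lam)))
        rwa [hI, hC] at h
      · rw [relJ_adjoint_eq lam h0, relHPoly_ket_two lam _ h0, ← hg0, sub_eq_add_neg, ← neg_smul]
        simp only [map_add, map_smul]
        have h := (hf2.smul (cosCoupling lam)).add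
          ((hf0.add hf1).smul (-(I * sinCoupling lam * conj lam)))
        rwa [hI, conj_cosCoupling, conj_conj] at h
    · rw [relJ_adjoint_eq lam h0, relHPoly_ket_of_ne lam _ _ hy]
      have h := hfree i y
      rcases hi with rfl | rfl | rfl
      · rw [hs0, add_zero, ha y hy, mul_zero] at h
        rwa [ha y hy, mul_zero]
      · rw [hs1, add_zero, hb y hy, mul_zero] at h
        rwa [hb y hy, mul_zero]
      · rwa [hs2, hp2, one_mul, hg y hy] at h
  have hrow' : ∀ i : Fin 6, (i = 0 ∨ i = 1 ∨ i = 2) → ∀ y : ℤ,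
      FormalPairing φ (((relA lam p)†) (ket (i, y))) (μ * φ (i, y)) := by
    intro i hi y
    rw [relA_adjoint_eq]
    exact (hrow i hi y).relAnti hφ
  rintro ⟨i, y⟩
  by_cases hi : i = 0 ∨ i = 1 ∨ i = 2
  · exact hrow' i hi y
  · have hi' : i + 3 = 0 ∨ i + 3 = 1 ∨ i + 3 = 2 := by revert i; decide
    have h := (hrow' (i + 3) hi' (-y)).smul (-1)
    rw [← relSwap_ket, relA_adjoint_relSwap, hφ, neg_one_smul, neg_neg, map_neg, map_one] at h
    convert h using 1
    ring

theorem isAntisymmetric_phiFree (k : ℝ) : IsAntisymmetric (phiFree k) := by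
  intro i y
  simp only [phiFree, odd_neg]
  split_ifs with h
  · fin_cases i <;> simp
  · simp

theorem isImproperEigenvector_phiFree (lam : ℂ) (h0 : coupling lam ≠ 0) (p k : ℝ) :
    IsImproperEigenvector (relA lam p) (exp (-I * k)) (phiFree k) := by
  have h2 : ¬ Odd (2 : ℤ) := by decide
  refine isImproperEigenvector_relA lam h0 p _ _ (isAntisymmetric_phiFree k) ?_ ?_ ?_ ?_ ?_ ?_
  · intro y _; simp [phiFree]
  · intro y _; simp [phiFree]
  · intro y _
    simp only [phiFree]
    have h3 : Odd (y + 2) ↔ Odd y := by simp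
    by_cases h : Odd y
    · rw [if_pos h, if_pos (h3.2 h), mul_left_comm]
      congr 1
      simp only [Matrix.cons_val]
      rw [← exp_add, show (y + 2 - 1) / 2 = (y - 1) / 2 + 1 by omega]
      congr 1
      push_cast; ring
    · rw [if_neg h, if_neg (fun h' => h (h3.1 h')), mul_zero]
  all_goals simp [phiFree, h2]

theorem isAntisymmetric_phiScat (lam : ℂ) (p k : ℝ) : IsAntisymmetric (phiScat lam p k) := by
  intro i y
  simp only [phiScat, even_neg, neg_eq_zero, neg_neg]
  rw [← mul_neg]
  congr 1
  fin_cases i <;> simp <;> split_ifs <;> simp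

theorem conj_exp_neg_I_mul (k : ℝ) : conj (exp (-I * k)) = exp (I * k) := by
  rw [← exp_conj]; simp

theorem conj_scatC (lam : ℂ) (p k : ℝ) : conj (scatC lam p k) =
    cosCoupling lam * (exp (I * k) - (Real.cos (2 * p) : ℂ))
      + (exp (-I * k) - (Real.cos (2 * p) : ℂ)) := by
  have h : conj (exp (I * k)) = exp (-I * k) := by rw [← conj_exp_neg_I_mul, conj_conj]
  rw [scatC, map_add, map_mul, map_sub, map_sub, conj_ofReal, conj_ofReal, conj_exp_neg_I_mul, h]
  rfl

theorem two_mul_cos_two_mul (p : ℝ) :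
    2 * (Real.cos (2 * p) : ℂ) = exp (2 * I * p) + exp (-2 * I * p) := by
  rw [ofReal_cos, Complex.cos, mul_div_cancel₀ _ two_ne_zero]
  congr 2 <;> push_cast <;> ring

theorem isImproperEigenvector_phiScat (lam : ℂ) (h0 : coupling lam ≠ 0) (p k : ℝ) :
    IsImproperEigenvector (relA lam p) (exp (-I * k)) (phiScat lam p k) := by
  have hz : exp (I * k) * exp (-I * k) = 1 := by rw [← exp_add]; simp
  have hp : exp (2 * I * p) * exp (-2 * I * p) = 1 := by rw [← exp_add]; simp
  have hcos := two_mul_cos_two_mul p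
  have hS := two_mul_sinCoupling_sq lam h0
  have hd : ∀ s : ℝ, scatD lam p k s =
      I * sinCoupling lam * conj lam * (exp (-I * k) - exp (-2 * I * s * p)) := by
    intro s; rw [scatD, sinCoupling]; ring
  have hd1 : scatD lam p k 1 =
      I * sinCoupling lam * conj lam * (exp (-I * k) - exp (-2 * I * p)) := by
    rw [hd]; congr 3; push_cast; ring
  have hd2 : scatD lam p k (-1) =
      I * sinCoupling lam * conj lam * (exp (-I * k) - exp (2 * I * p)) := by
    rw [hd]; congr 3; push_cast; ring
  have hφ0 : phiScat lam p k (0, 0) = (scatNorm lam p k : ℂ)⁻¹ * scatD lam p k 1 := by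
    simp [phiScat]
  have hφ1 : phiScat lam p k (1, 0) = (scatNorm lam p k : ℂ)⁻¹ * scatD lam p k (-1) := by
    simp [phiScat]
  have hφ2 : phiScat lam p k (2, 0) = (scatNorm lam p k : ℂ)⁻¹ * scatC lam p k := by
    simp [phiScat, scatAmplitude]
  have hφ22 : phiScat lam p k (2, 2) =
      (scatNorm lam p k : ℂ)⁻¹ * (conj (scatC lam p k) * exp (-I * k)) := by
    simp [phiScat, scatAmplitude]
  have hc : scatC lam p k = cosCoupling lam * (exp (-I * k) - (Real.cos (2 * p) : ℂ))
      + (exp (I * k) - (Real.cos (2 * p) : ℂ)) := rfl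
  have hI := I_mul_I
  refine isImproperEigenvector_relA lam h0 p _ _ (isAntisymmetric_phiScat lam p k) ?_ ?_ ?_ ?_ ?_ ?_
  · intro y hy; simp [phiScat, hy]
  · intro y hy; simp [phiScat, hy]
  · intro y hy
    simp only [phiScat, Matrix.cons_val]
    have h3 : Even (y + 2) ↔ Even y := by simp
    rw [mul_left_comm]
    congr 1
    by_cases h : Even y
    · rw [if_pos h, if_pos (h3.2 h), scatAmplitude, scatAmplitude]
      obtain ⟨m, rfl⟩ := h
      have e1 : (m + m + 2) / 2 = m + 1 := by omega
      have e2 : (m + m) / 2 = m := by omega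
      have e3 : 1 ≤ m + 1 ↔ 1 ≤ m := by omega
      simp only [e1, e2, e3]
      rw [mul_left_comm, ← exp_add]
      congr 2
      push_cast; ring
    · rw [if_neg h, if_neg (fun h' => h (h3.1 h')), mul_zero]
  all_goals
    rw [hφ0, hφ1, hφ22, conj_scatC]
    try rw [hφ2, hc]
    rw [hd1, hd2]
    generalize (scatNorm lam p k : ℂ)⁻¹ = N
    generalize exp (I * k) = z at *
    generalize exp (-I * k) = w at *
    generalize exp (2 * I * p) = s at *
    generalize exp (-2 * I * p) = t at *
    generalize (Real.cos (2 * p) : ℂ) = q at *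
    generalize cosCoupling lam = C at *
    generalize sinCoupling lam = S at *
    have hq : q = (s + t) / 2 := by linear_combination hcos / 2
    subst hq
  · linear_combination (N * I * S * conj lam * C) * (hz - hp)
  · linear_combination (N * I * S * conj lam * C) * (hz - hp)
  · linear_combination N * (C ^ 2 - 1) * (hz - hp)
      + N * S ^ 2 * lam * conj lam * ((s + t) * w - 2 * s * t) * hI
      - N * ((s + t) / 2 * w - s * t) * hS

end ImproperEigenvectors

/-! ### Comparison with a free evolution -/

section Asymptotics

open Filter Topology

/-- Uniformly bounded operators that tend to zero on a Hilbert basis tend to zero strongly. -/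
theorem tendsto_zero_of_hilbertBasis {L R : Type*} [NormedAddCommGroup L] [InnerProductSpace ℂ L]
    [NormedAddCommGroup R] [InnerProductSpace ℂ R] {ι : Type*} (b : HilbertBasis ι ℂ L) (T : ℕ → L →L[ℂ] R)
    {K : ℝ} (hK : ∀ n h, ‖T n h‖ ≤ K * ‖h‖) (hb : ∀ j, Tendsto (fun n => T n (b j)) atTop (𝓝 0))
    (h : L) : Tendsto (fun n => T n h) atTop (𝓝 0) := by
  have hspan : ∀ g ∈ Submodule.span ℂ (Set.range b), Tendsto (fun n => T n g) atTop (𝓝 0) := by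
    intro g hg
    induction hg using Submodule.span_induction with
    | mem x hx => obtain ⟨j, rfl⟩ := hx; exact hb j
    | zero => simp
    | add x y _ _ hx hy => simpa using hx.add hy
    | smul c x _ hx => simpa using hx.const_smul c
  have hmem : h ∈ closure (Submodule.span ℂ (Set.range b) : Set L) := by
    rw [← Submodule.topologicalClosure_coe, b.dense_span]; trivial
  have hK1 : 0 < |K| + 1 := by positivity
  rw [Metric.tendsto_atTop]
  intro ε hε
  obtain ⟨g, hg, hgh⟩ := Metric.mem_closure_iff.1 hmem (ε / 2 / (|K| + 1)) (by positivity)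
  obtain ⟨N, hN⟩ := Metric.tendsto_atTop.1 (hspan g hg) (ε / 2) (by positivity)
  refine ⟨N, fun n hn => ?_⟩
  have h1 := hN n hn
  rw [dist_zero_right] at h1 ⊢
  have h2 : ‖T n (h - g)‖ ≤ ε / 2 := by
    rw [dist_eq_norm] at hgh
    calc ‖T n (h - g)‖ ≤ K * ‖h - g‖ := hK n _
      _ ≤ (|K| + 1) * ‖h - g‖ :=
        mul_le_mul_of_nonneg_right ((le_abs_self K).trans (by linarith)) (norm_nonneg _)
      _ ≤ (|K| + 1) * (ε / 2 / (|K| + 1)) := mul_le_mul_of_nonneg_left hgh.le hK1.le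
      _ = ε / 2 := mul_div_cancel₀ _ hK1.ne'
  calc ‖T n h‖ = ‖T n (h - g) + T n g‖ := by rw [← map_add, sub_add_cancel]
    _ ≤ ‖T n (h - g)‖ + ‖T n g‖ := norm_add_le _ _
    _ < ε := by linarith

/-- A map that intertwines the unitary `N` with a norm-preserving evolution, and that is
asymptotic to an isometry along the orbits of `N`, is an isometry. -/
theorem norm_eq_of_asymptotic {L R : Type*} [NormedAddCommGroup L] [NormedAddCommGroup R]
    {E E₀ : L → R} {N : L → L} (hE : ∀ f, ‖E (N f)‖ = ‖E f‖)
    (hE₀ : ∀ f, ‖E₀ f‖ = ‖f‖) (hN : ∀ f, ‖N f‖ = ‖f‖)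
    (hlim : ∀ f, Tendsto (fun n => E (N^[n] f) - E₀ (N^[n] f)) atTop (𝓝 0)) (f : L) :
    ‖E f‖ = ‖f‖ := by
  have h1 : ∀ n, ‖E (N^[n] f)‖ = ‖E f‖ := by
    intro n
    induction n with
    | zero => rfl
    | succ n ih => rw [Function.iterate_succ_apply', hE, ih]
  have h2 : ∀ n, ‖E₀ (N^[n] f)‖ = ‖f‖ := by
    intro n
    rw [hE₀]
    induction n with
    | zero => rfl
    | succ n ih => rw [Function.iterate_succ_apply', hN, ih]
  have h3 : Tendsto (fun _ : ℕ => |‖E f‖ - ‖f‖|) atTop (𝓝 0) := by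
    refine squeeze_zero (fun _ => abs_nonneg _) (fun n => ?_) (tendsto_zero_iff_norm_tendsto_zero.1 (hlim f))
    rw [← h1 n, ← h2 n]
    exact abs_norm_sub_norm_le _ _
  have h4 := tendsto_nhds_unique h3 tendsto_const_nhds
  exact sub_eq_zero.1 (abs_eq_zero.1 h4.symm)

/-- If the `A`-orbit of `E₀ f` is exactly the `E₀`-image of the `N`-orbit of `f`, and `E` and `E₀`
agree asymptotically along that orbit, then `E f = E₀ f`. The evolution `A` has to be isometric
only on an invariant subspace. -/
theorem eq_of_asymptotic {L R : Type*} [NormedAddCommGroup R] [InnerProductSpace ℂ R]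
    {A : R →L[ℂ] R} {S : Submodule ℂ R} {E E₀ : L → R} {N : L → L}
    (hA : ∀ v ∈ S, A v ∈ S ∧ ‖A v‖ = ‖v‖) (hES : ∀ f, E f ∈ S) (hES₀ : ∀ f, E₀ f ∈ S)
    (hE : ∀ f, E (N f) = A (E f)) {f : L} (hf : ∀ n, A (E₀ (N^[n] f)) = E₀ (N (N^[n] f)))
    (hlim : Tendsto (fun n => E (N^[n] f) - E₀ (N^[n] f)) atTop (𝓝 0)) : E f = E₀ f := by
  have h1 : ∀ n, ‖E (N^[n] f) - E₀ (N^[n] f)‖ = ‖E f - E₀ f‖ := by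
    intro n
    induction n with
    | zero => rfl
    | succ n ih =>
      rw [Function.iterate_succ_apply', hE, ← hf, ← map_sub,
        (hA _ (S.sub_mem (hES _) (hES₀ _))).2, ih]
  have h2 := tendsto_zero_iff_norm_tendsto_zero.1 hlim
  simp only [h1] at h2
  have h3 := tendsto_nhds_unique h2 tendsto_const_nhds
  exact sub_eq_zero.1 (norm_eq_zero.1 h3.symm)

end Asymptotics

/-! ### Multiplication operators on `L²(-π, π]` -/

section Multiplication

theorem memLp_bounded_mul {h : ℝ → ℂ} (hm : Measurable h) (hb : ∀ k, ‖h k‖ ≤ 1)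
    (f : MomentumSpace) : MemLp (fun k => h k * f k) 2 circleMeasure := by
  refine (Lp.memLp f).mono (hm.aestronglyMeasurable.mul (Lp.aestronglyMeasurable f))
    (Filter.Eventually.of_forall fun k => ?_)
  rw [norm_mul]
  exact mul_le_of_le_one_left (norm_nonneg _) (hb k)

/-- Multiplication by a measurable function bounded by one. -/
def mulOp (h : ℝ → ℂ) (hm : Measurable h) (hb : ∀ k, ‖h k‖ ≤ 1) :
    MomentumSpace →L[ℂ] MomentumSpace :=
  LinearMap.mkContinuous
    { toFun := fun f => (memLp_bounded_mul hm hb f).toLp _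
      map_add' := fun f g => by
        refine Lp.ext ?_
        filter_upwards [(memLp_bounded_mul hm hb (f + g)).coeFn_toLp,
          (memLp_bounded_mul hm hb f).coeFn_toLp, (memLp_bounded_mul hm hb g).coeFn_toLp,
          Lp.coeFn_add f g, Lp.coeFn_add ((memLp_bounded_mul hm hb f).toLp _)
            ((memLp_bounded_mul hm hb g).toLp _)] with k h1 h2 h3 h4 h5
        rw [h1, h5, Pi.add_apply, h2, h3, h4, Pi.add_apply, mul_add]
      map_smul' := fun c f => by
        refine Lp.ext ?_
        filter_upwards [(memLp_bounded_mul hm hb (c • f)).coeFn_toLp,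
          (memLp_bounded_mul hm hb f).coeFn_toLp,
          Lp.coeFn_smul c f, Lp.coeFn_smul c ((memLp_bounded_mul hm hb f).toLp _)]
          with k h1 h2 h4 h5
        rw [RingHom.id_apply, h1, h5, Pi.smul_apply, h2, h4, Pi.smul_apply, smul_eq_mul,
          smul_eq_mul, mul_left_comm] }
    1
    (fun f => by
      rw [one_mul]
      refine Lp.norm_le_norm_of_ae_le ?_
      filter_upwards [(memLp_bounded_mul hm hb f).coeFn_toLp] with k h1
      change ‖((memLp_bounded_mul hm hb f).toLp _ : ℝ → ℂ) k‖ ≤ _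
      rw [h1, norm_mul]
      exact mul_le_of_le_one_left (norm_nonneg _) (hb k))

theorem coeFn_mulOp (h : ℝ → ℂ) (hm : Measurable h) (hb : ∀ k, ‖h k‖ ≤ 1) (f : MomentumSpace) :
    (mulOp h hm hb f : ℝ → ℂ) =ᵐ[circleMeasure] fun k => h k * f k :=
  (memLp_bounded_mul hm hb f).coeFn_toLp

theorem mulOp_adjoint (h : ℝ → ℂ) (hm : Measurable h) (hb : ∀ k, ‖h k‖ ≤ 1) (g : ℝ → ℂ)
    (hgm : Measurable g) (hgb : ∀ k, ‖g k‖ ≤ 1) (hg : ∀ k, g k = conj (h k)) :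
    (mulOp h hm hb)† = mulOp g hgm hgb := by
  symm
  rw [ContinuousLinearMap.eq_adjoint_iff]
  intro f f'
  rw [L2.inner_def, L2.inner_def]
  refine integral_congr_ae ?_
  filter_upwards [coeFn_mulOp h hm hb f', coeFn_mulOp g hgm hgb f] with k h1 h2
  rw [h1, h2, RCLike.inner_apply, RCLike.inner_apply, map_mul, hg, conj_conj]
  ring

theorem mulOp_comm (h : ℝ → ℂ) (hm : Measurable h) (hb : ∀ k, ‖h k‖ ≤ 1) (g : ℝ → ℂ)
    (hgm : Measurable g) (hgb : ∀ k, ‖g k‖ ≤ 1) (f : MomentumSpace) :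
    mulOp h hm hb (mulOp g hgm hgb f) = mulOp g hgm hgb (mulOp h hm hb f) := by
  refine Lp.ext ?_
  filter_upwards [coeFn_mulOp h hm hb f, coeFn_mulOp g hgm hgb f,
    coeFn_mulOp h hm hb (mulOp g hgm hgb f), coeFn_mulOp g hgm hgb (mulOp h hm hb f)]
    with k h1 h2 h3 h4
  rw [h3, h4, h1, h2, mul_left_comm]

theorem mulOp_mulOp_of_ae_eq_one (h : ℝ → ℂ) (hm : Measurable h) (hb : ∀ k, ‖h k‖ ≤ 1)
    (g : ℝ → ℂ) (hgm : Measurable g) (hgb : ∀ k, ‖g k‖ ≤ 1)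
    (hhg : ∀ᵐ k ∂circleMeasure, h k * g k = 1) (f : MomentumSpace) :
    mulOp h hm hb (mulOp g hgm hgb f) = f := by
  refine Lp.ext ?_
  filter_upwards [hhg, coeFn_mulOp g hgm hgb f, coeFn_mulOp h hm hb (mulOp g hgm hgb f)]
    with k h1 h2 h3
  rw [h3, h2, ← mul_assoc, h1, one_mul]

theorem norm_mulOp_of_ae_norm_eq_one (h : ℝ → ℂ) (hm : Measurable h) (hb : ∀ k, ‖h k‖ ≤ 1)
    (hh : ∀ᵐ k ∂circleMeasure, ‖h k‖ = 1) (f : MomentumSpace) : ‖mulOp h hm hb f‖ = ‖f‖ := by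
  refine le_antisymm (Lp.norm_le_norm_of_ae_le ?_) (Lp.norm_le_norm_of_ae_le ?_) <;>
  · filter_upwards [hh, coeFn_mulOp h hm hb f] with k h1 h2
    rw [h2, norm_mul, h1, one_mul]

/-- Multiplication by `e^{-ink}`. -/
def phaseOp (n : ℤ) : MomentumSpace →L[ℂ] MomentumSpace :=
  mulOp (fun k => exp (I * k * ((-n : ℤ) : ℂ))) (by fun_prop)
    (fun k => by rw [Complex.norm_exp]; simp)

theorem coeFn_phaseOp (n : ℤ) (f : MomentumSpace) :
    (phaseOp n f : ℝ → ℂ) =ᵐ[circleMeasure] fun k => exp (I * k * ((-n : ℤ) : ℂ)) * f k :=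
  coeFn_mulOp _ _ _ f

theorem phaseOp_adjoint (n : ℤ) : (phaseOp n)† = phaseOp (-n) :=
  mulOp_adjoint _ _ _ _ _ _ fun k => by rw [conj_exp_I_mul]

theorem norm_phaseOp (n : ℤ) (f : MomentumSpace) : ‖phaseOp n f‖ = ‖f‖ :=
  norm_mulOp_of_ae_norm_eq_one _ _ _
    (Filter.Eventually.of_forall fun k => by rw [Complex.norm_exp]; simp) f

theorem phaseOp_phaseOp (n m : ℤ) (f : MomentumSpace) :
    phaseOp n (phaseOp m f) = phaseOp (n + m) f := by
  refine Lp.ext ?_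
  filter_upwards [coeFn_phaseOp m f, coeFn_phaseOp n (phaseOp m f), coeFn_phaseOp (n + m) f]
    with k h1 h2 h3
  rw [h2, h1, h3, ← mul_assoc, ← exp_add]
  congr 2
  push_cast; ring

theorem phaseOp_zero (f : MomentumSpace) : phaseOp 0 f = f := by
  refine Lp.ext ?_
  filter_upwards [coeFn_phaseOp 0 f] with k h1
  rw [h1]; simp

theorem phaseOp_iterate (s : ℤ) (n : ℕ) (f : MomentumSpace) :
    (phaseOp s)^[n] f = phaseOp (n * s) f := by
  induction n with
  | zero => rw [Function.iterate_zero_apply]; simp [phaseOp_zero]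
  | succ n ih =>
    rw [Function.iterate_succ_apply', ih, phaseOp_phaseOp]
    congr 1
    push_cast; ring_nf

theorem phaseOp_fourierVec (n z : ℤ) (c : ℂ) :
    phaseOp n (fourierVec z c) = fourierVec (z - n) c := by
  refine Lp.ext ?_
  filter_upwards [coeFn_phaseOp n (fourierVec z c), coeFn_fourierVec z c,
    coeFn_fourierVec (z - n) c] with k h1 h2 h3
  rw [h1, h2, h3, sub_eq_add_neg, monomial_add, smul_eq_mul, smul_eq_mul]
  ring

end Multiplication

/-! ### Antisymmetrized basis vectors -/

section AntiKets

/-- The normalized antisymmetrization `(|e_i⟩|y⟩ - |e_{i+3}⟩|-y⟩) / √2`. -/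
def antiKet (q : RelIndex) : RelSpace := ((Real.sqrt 2 : ℝ) : ℂ) • relAnti (ket q)

theorem relAnti_antiKet (q : RelIndex) : relAnti (antiKet q) = antiKet q := by
  rw [antiKet, map_smul, relAnti_relAnti]

theorem inner_antiKet_left (q : RelIndex) (v : RelSpace) :
    ⟪antiKet q, v⟫_ℂ = ((Real.sqrt 2 : ℝ) : ℂ) * relAnti v q := by
  rw [antiKet, inner_smul_left, conj_ofReal, ← relAnti_adjoint,
    ContinuousLinearMap.adjoint_inner_left, inner_ket_left, relAnti_adjoint]

theorem relAnti_ket (i : Fin 6) (y : ℤ) :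
    relAnti (ket (i, y)) = (1 / 2 : ℂ) • (ket (i, y) - ket (i + 3, -y)) := by
  rw [relAnti, smul_apply, sub_apply, one_apply_eq_self, relSwap_ket]

theorem antiKet_eq (i : Fin 6) (y : ℤ) :
    antiKet (i, y) = ((Real.sqrt 2 : ℝ) : ℂ)⁻¹ • (ket (i, y) - ket (i + 3, -y)) := by
  rw [antiKet, relAnti_ket, smul_smul]
  congr 1
  refine eq_inv_of_mul_eq_one_left ?_
  rw [mul_right_comm, sqrt_two_mul_self]; norm_num

theorem ket_sub_ket (i : Fin 6) (y : ℤ) :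
    (ket (i, y) - ket (i + 3, -y) : RelSpace) = ((Real.sqrt 2 : ℝ) : ℂ) • antiKet (i, y) := by
  rw [antiKet_eq, smul_smul, mul_inv_cancel₀ sqrt_two_ne_zero, one_smul]

theorem inner_antiKet_antiKet (i j : Fin 6) (y z : ℤ) :
    ⟪antiKet (i, y), antiKet (j, z)⟫_ℂ =
      (if i = j ∧ y = z then 1 else 0) - if i = j + 3 ∧ y = -z then 1 else 0 := by
  rw [inner_antiKet_left, relAnti_antiKet, antiKet_eq]
  change ((Real.sqrt 2 : ℝ) : ℂ) * (((Real.sqrt 2 : ℝ) : ℂ)⁻¹ *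
    ((ket (j, z) : RelSpace) (i, y) - (ket (j + 3, -z) : RelSpace) (i, y))) = _
  rw [← mul_assoc, mul_inv_cancel₀ sqrt_two_ne_zero, one_mul, ket_apply, ket_apply]
  simp only [Prod.mk.injEq]

theorem inner_antiKet_of_anti {v : RelSpace} (hv : relAnti v = v) (q : RelIndex) :
    ⟪antiKet q, v⟫_ℂ = ((Real.sqrt 2 : ℝ) : ℂ) * v q := by
  rw [inner_antiKet_left, hv]

/-- An antisymmetric vector vanishes if its components in the internal states `e₁, e₂, e₃` do. -/
theorem eq_zero_of_inner_antiKet {v : RelSpace} (hv : relAnti v = v)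
    (h : ∀ i : Fin 6, (i = 0 ∨ i = 1 ∨ i = 2) → ∀ y, ⟪antiKet (i, y), v⟫_ℂ = 0) : v = 0 := by
  have h1 : ∀ i : Fin 6, (i = 0 ∨ i = 1 ∨ i = 2) → ∀ y, v (i, y) = 0 := by
    intro i hi y
    have h2 := h i hi y
    rw [inner_antiKet_of_anti hv] at h2
    exact (mul_eq_zero.1 h2).resolve_left sqrt_two_ne_zero
  refine ext_coord fun ⟨i, y⟩ => ?_
  by_cases hi : i = 0 ∨ i = 1 ∨ i = 2
  · exact h1 i hi y
  · have hi' : i + 3 = 0 ∨ i + 3 = 1 ∨ i + 3 = 2 := by revert i; decide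
    have h3 := (relAnti_eq_self_iff v).1 hv i y
    rw [h1 _ hi', eq_comm, neg_eq_zero] at h3
    exact h3

theorem relA_antiKet (lam : ℂ) (p : ℝ) (i : Fin 6) (y : ℤ) : relA lam p (antiKet (i, y)) =
    ((Real.sqrt 2 : ℝ) : ℂ) • relAnti (relPhase p i • relJ lam (ket (i, y - relShift i))) := by
  rw [← relAnti_antiKet, antiKet, map_smul, map_smul, relAnti_relAnti,
    ← map_smul (relJ lam), ← relFree_ket]
  congr 1
  rw [(relA_unitary lam p).2.2.1]
  have hc : Commute relAnti (relJ lam * relFree p) :=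
    (commute_relAnti_relJ lam).mul_right (commute_relAnti_relFree p)
  have h := congrArg (fun A : RelSpace →L[ℂ] RelSpace => A (ket (i, y))) hc.eq
  change relAnti (relJ lam (relFree p (ket (i, y)))) =
    relJ lam (relFree p (relAnti (ket (i, y)))) at h
  rw [h, ContinuousLinearMap.comp_apply, ContinuousLinearMap.comp_apply, relAnti_relAnti]

theorem relA_antiKet_of_ne (lam : ℂ) (h0 : coupling lam ≠ 0) (p : ℝ) (i : Fin 6) {y : ℤ}
    (hy : y ≠ relShift i) :
    relA lam p (antiKet (i, y)) = relPhase p i • antiKet (i, y - relShift i) := by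
  rw [relA_antiKet, relJ_eq_relHPoly lam h0, relHPoly_ket_of_ne lam _ _ (sub_ne_zero.2 hy),
    map_smul, smul_comm]
  rfl

theorem relA_antiKet_zero (lam : ℂ) (h0 : coupling lam ≠ 0) (p : ℝ) :
    relA lam p (antiKet (0, 0)) = exp (2 * I * p) • (antiKet (0, 0)
      + ((cosCoupling lam - 1) / 2) • (antiKet (0, 0) + antiKet (1, 0))
      + (I * sinCoupling lam * lam) • antiKet (2, 0)) := by
  rw [relA_antiKet, relJ_eq_relHPoly lam h0, show (0 : ℤ) - relShift 0 = 0 from rfl,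
    relHPoly_ket_zero lam _ h0]
  simp only [antiKet, map_add, map_sub, map_smul]
  rw [show relPhase p 0 = exp (2 * I * p) from rfl]
  module

theorem relA_antiKet_one (lam : ℂ) (h0 : coupling lam ≠ 0) (p : ℝ) :
    relA lam p (antiKet (1, 0)) = exp (-2 * I * p) • (antiKet (1, 0)
      + ((cosCoupling lam - 1) / 2) • (antiKet (0, 0) + antiKet (1, 0))
      + (I * sinCoupling lam * lam) • antiKet (2, 0)) := by
  rw [relA_antiKet, relJ_eq_relHPoly lam h0, show (0 : ℤ) - relShift 1 = 0 from rfl,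
    relHPoly_ket_one lam _ h0]
  simp only [antiKet, map_add, map_sub, map_smul]
  rw [show relPhase p 1 = exp (-2 * I * p) from rfl]
  module

/-- The collision: a pair in the third internal state arrives at the origin. -/
theorem relA_antiKet_two_two (lam : ℂ) (h0 : coupling lam ≠ 0) (p : ℝ) :
    relA lam p (antiKet (2, 2)) = cosCoupling lam • antiKet (2, 0)
      + (I * sinCoupling lam * conj lam) • (antiKet (0, 0) + antiKet (1, 0)) := by
  rw [relA_antiKet, relJ_eq_relHPoly lam h0, show (2 : ℤ) - relShift 2 = 0 from rfl,
    relHPoly_ket_two lam _ h0]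
  simp only [antiKet, map_add, map_sub, map_smul]
  rw [show relPhase p 2 = 1 from rfl]
  module

theorem relA_adjoint_relA (lam : ℂ) (p : ℝ) {v : RelSpace} (hv : relAnti v = v) :
    ((relA lam p)†) (relA lam p v) = v := by
  conv_rhs => rw [← hv]
  exact congrArg (fun A : RelSpace →L[ℂ] RelSpace => A v) (relA_unitary lam p).1

theorem relAnti_relA (lam : ℂ) (p : ℝ) (v : RelSpace) :
    relAnti (relA lam p v) = relA lam p v := by
  rw [(relA_unitary lam p).2.2.2, ContinuousLinearMap.comp_apply, relAnti_relAnti]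

theorem relAnti_relA_adjoint (lam : ℂ) (p : ℝ) (v : RelSpace) :
    relAnti (((relA lam p)†) v) = ((relA lam p)†) v := by
  rw [relA_adjoint_eq, ContinuousLinearMap.comp_apply, relAnti_relAnti]

theorem norm_relA (lam : ℂ) (p : ℝ) {v : RelSpace} (hv : relAnti v = v) :
    ‖relA lam p v‖ = ‖v‖ := by
  have h : ⟪relA lam p v, relA lam p v⟫_ℂ = ⟪v, v⟫_ℂ := by
    rw [← ContinuousLinearMap.adjoint_inner_left, relA_adjoint_relA lam p hv]
  rw [@norm_eq_sqrt_re_inner ℂ, @norm_eq_sqrt_re_inner ℂ, h]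

theorem norm_relA_adjoint (lam : ℂ) (p : ℝ) {v : RelSpace} (hv : relAnti v = v) :
    ‖((relA lam p)†) v‖ = ‖v‖ := by
  have h : ⟪((relA lam p)†) v, ((relA lam p)†) v⟫_ℂ = ⟪v, v⟫_ℂ := by
    rw [ContinuousLinearMap.adjoint_inner_left]
    congr 1
    conv_rhs => rw [← hv]
    exact congrArg (fun A : RelSpace →L[ℂ] RelSpace => A v) (relA_unitary lam p).2.1
  rw [@norm_eq_sqrt_re_inner ℂ, @norm_eq_sqrt_re_inner ℂ, h]

/-! ### The four invariant subspaces -/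

theorem subset_fixed_of_generators {S : Set RelSpace} (hS : ∀ v ∈ S, relAnti v = v) :
    ∀ v ∈ (Submodule.span ℂ S).topologicalClosure, relAnti v = v := by
  have h : (Submodule.span ℂ S).topologicalClosure ≤
      LinearMap.eqLocus (relAnti : RelSpace →ₗ[ℂ] RelSpace) LinearMap.id :=
    Submodule.topologicalClosure_minimal _ (Submodule.span_le.2 hS)
      (isClosed_eq relAnti.continuous continuous_id)
  exact fun v hv => h hv

theorem spaceA_eq : spaceA = (Submodule.span ℂ
    {v | ∃ y : ℤ, y ≠ 0 ∧ v = ((Real.sqrt 2 : ℝ) : ℂ) • antiKet (0, y)}).topologicalClosure := by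
  simp only [← ket_sub_ket]; rfl

theorem spaceB_eq : spaceB = (Submodule.span ℂ
    {v | ∃ y : ℤ, y ≠ 0 ∧ v = ((Real.sqrt 2 : ℝ) : ℂ) • antiKet (1, y)}).topologicalClosure := by
  simp only [← ket_sub_ket]; rfl

theorem spaceC_eq : spaceC = (Submodule.span ℂ
    {v | ∃ y : ℤ, v = ((Real.sqrt 2 : ℝ) : ℂ) • antiKet (2, 2 * y + 1)}).topologicalClosure := by
  simp only [← ket_sub_ket, spaceC]
  congr 3
  ext v
  refine exists_congr fun y => ?_
  rw [show -2 * y - 1 = -(2 * y + 1) by ring]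
  rfl

theorem mem_orthogonal_of_generators {S : Set RelSpace} {v : RelSpace}
    (h : ∀ w ∈ S, ⟪w, v⟫_ℂ = 0) : v ∈ ((Submodule.span ℂ S).topologicalClosure)ᗮ := by
  rw [Submodule.orthogonal_closure, Submodule.mem_orthogonal]
  intro w hw
  induction hw using Submodule.span_induction with
  | mem x hx => exact h x hx
  | zero => exact inner_zero_left _
  | add x y _ _ hx hy => rw [inner_add_left, hx, hy, add_zero]
  | smul c x _ hx => rw [inner_smul_left, hx, mul_zero]

theorem mem_orthogonal_spaceA {v : RelSpace} (h : ∀ y : ℤ, y ≠ 0 → ⟪antiKet (0, y), v⟫_ℂ = 0) :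
    v ∈ spaceAᗮ := by
  rw [spaceA_eq]
  refine mem_orthogonal_of_generators ?_
  rintro w ⟨y, hy, rfl⟩
  rw [inner_smul_left, h y hy, mul_zero]

theorem mem_orthogonal_spaceB {v : RelSpace} (h : ∀ y : ℤ, y ≠ 0 → ⟪antiKet (1, y), v⟫_ℂ = 0) :
    v ∈ spaceBᗮ := by
  rw [spaceB_eq]
  refine mem_orthogonal_of_generators ?_
  rintro w ⟨y, hy, rfl⟩
  rw [inner_smul_left, h y hy, mul_zero]

theorem mem_orthogonal_spaceC {v : RelSpace} (h : ∀ y : ℤ, ⟪antiKet (2, 2 * y + 1), v⟫_ℂ = 0) :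
    v ∈ spaceCᗮ := by
  rw [spaceC_eq]
  refine mem_orthogonal_of_generators ?_
  rintro w ⟨y, rfl⟩
  rw [inner_smul_left, h y, mul_zero]

theorem antiKet_mem_of_smul_mem {S : Submodule ℂ RelSpace} {q : RelIndex}
    (h : ((Real.sqrt 2 : ℝ) : ℂ) • antiKet q ∈ S) : antiKet q ∈ S :=
  (S.smul_mem_iff sqrt_two_ne_zero).1 h

theorem antiKet_mem_spaceA {y : ℤ} (hy : y ≠ 0) : antiKet (0, y) ∈ spaceA := by
  rw [spaceA_eq]
  exact antiKet_mem_of_smul_mem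
    (Submodule.le_topologicalClosure _ (Submodule.subset_span ⟨y, hy, rfl⟩))

theorem antiKet_mem_spaceB {y : ℤ} (hy : y ≠ 0) : antiKet (1, y) ∈ spaceB := by
  rw [spaceB_eq]
  exact antiKet_mem_of_smul_mem
    (Submodule.le_topologicalClosure _ (Submodule.subset_span ⟨y, hy, rfl⟩))

theorem antiKet_mem_spaceC (y : ℤ) : antiKet (2, 2 * y + 1) ∈ spaceC := by
  rw [spaceC_eq]
  exact antiKet_mem_of_smul_mem
    (Submodule.le_topologicalClosure _ (Submodule.subset_span ⟨y, rfl⟩))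

theorem relAnti_of_mem_spaceA {v : RelSpace} (hv : v ∈ spaceA) : relAnti v = v := by
  rw [spaceA_eq] at hv
  refine subset_fixed_of_generators ?_ v hv
  rintro _ ⟨y, _, rfl⟩
  rw [map_smul, relAnti_antiKet]

theorem relAnti_of_mem_spaceB {v : RelSpace} (hv : v ∈ spaceB) : relAnti v = v := by
  rw [spaceB_eq] at hv
  refine subset_fixed_of_generators ?_ v hv
  rintro _ ⟨y, _, rfl⟩
  rw [map_smul, relAnti_antiKet]

theorem relAnti_of_mem_spaceC {v : RelSpace} (hv : v ∈ spaceC) : relAnti v = v := by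
  rw [spaceC_eq] at hv
  refine subset_fixed_of_generators ?_ v hv
  rintro _ ⟨y, rfl⟩
  rw [map_smul, relAnti_antiKet]

theorem relAnti_of_mem_spaceD {v : RelSpace} (hv : v ∈ spaceD) : relAnti v = v := hv.1

theorem spaceA_le_orthogonal_spaceB : spaceA ≤ spaceBᗮ := by
  rw [spaceA_eq]
  refine Submodule.topologicalClosure_minimal _ (Submodule.span_le.2 ?_)
    (Submodule.isClosed_orthogonal _)
  rintro _ ⟨y, _, rfl⟩
  refine Submodule.smul_mem _ _ (mem_orthogonal_spaceB fun z _ => ?_)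
  rw [inner_antiKet_antiKet]; simp

theorem spaceA_le_orthogonal_spaceC : spaceA ≤ spaceCᗮ := by
  rw [spaceA_eq]
  refine Submodule.topologicalClosure_minimal _ (Submodule.span_le.2 ?_)
    (Submodule.isClosed_orthogonal _)
  rintro _ ⟨y, _, rfl⟩
  refine Submodule.smul_mem _ _ (mem_orthogonal_spaceC fun z => ?_)
  rw [inner_antiKet_antiKet]; simp

theorem spaceB_le_orthogonal_spaceC : spaceB ≤ spaceCᗮ := by
  rw [spaceB_eq]
  refine Submodule.topologicalClosure_minimal _ (Submodule.span_le.2 ?_)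
    (Submodule.isClosed_orthogonal _)
  rintro _ ⟨y, _, rfl⟩
  refine Submodule.smul_mem _ _ (mem_orthogonal_spaceC fun z => ?_)
  rw [inner_antiKet_antiKet]; simp

theorem mem_spaceD_iff (v : RelSpace) :
    v ∈ spaceD ↔ relAnti v = v ∧ v ∈ spaceAᗮ ∧ v ∈ spaceBᗮ ∧ v ∈ spaceCᗮ := by
  rw [spaceD, Submodule.mem_inf, ← Submodule.inf_orthogonal, ← Submodule.inf_orthogonal,
    Submodule.mem_inf, Submodule.mem_inf, and_assoc]
  rfl

theorem mem_spaceD_of_inner {v : RelSpace} (hv : relAnti v = v)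
    (ha : ∀ y : ℤ, y ≠ 0 → ⟪antiKet (0, y), v⟫_ℂ = 0)
    (hb : ∀ y : ℤ, y ≠ 0 → ⟪antiKet (1, y), v⟫_ℂ = 0)
    (hg : ∀ y : ℤ, ⟪antiKet (2, 2 * y + 1), v⟫_ℂ = 0) : v ∈ spaceD :=
  (mem_spaceD_iff v).2
    ⟨hv, mem_orthogonal_spaceA ha, mem_orthogonal_spaceB hb, mem_orthogonal_spaceC hg⟩

/-- The antisymmetric subspace is the orthogonal sum of the four subspaces. -/
theorem sum_starProjection : spaceA.starProjection + spaceB.starProjection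
    + spaceC.starProjection + spaceD.starProjection = relAnti := by
  refine ContinuousLinearMap.ext fun v => ?_
  have hA : spaceA.starProjection v ∈ spaceA := Submodule.starProjection_apply_mem _ _
  have hB : spaceB.starProjection v ∈ spaceB := Submodule.starProjection_apply_mem _ _
  have hC : spaceC.starProjection v ∈ spaceC := Submodule.starProjection_apply_mem _ _
  have hvA : v - spaceA.starProjection v ∈ spaceAᗮ := Submodule.sub_starProjection_mem_orthogonal v
  have hvB : v - spaceB.starProjection v ∈ spaceBᗮ := Submodule.sub_starProjection_mem_orthogonal v
  have hvC : v - spaceC.starProjection v ∈ spaceCᗮ := Submodule.sub_starProjection_mem_orthogonal v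
  have hBA : spaceB ≤ spaceAᗮ := (Submodule.isOrtho_iff_le.2 spaceA_le_orthogonal_spaceB).symm
  have hCA : spaceC ≤ spaceAᗮ := (Submodule.isOrtho_iff_le.2 spaceA_le_orthogonal_spaceC).symm
  have hCB : spaceC ≤ spaceBᗮ := (Submodule.isOrtho_iff_le.2 spaceB_le_orthogonal_spaceC).symm
  -- the antisymmetric subspace is a complement of its orthogonal `v - relAnti v`
  have hperp : ∀ w : RelSpace, relAnti w = w → ⟪w, v - relAnti v⟫_ℂ = 0 := by
    intro w hw
    rw [← hw, ← relAnti_adjoint, ContinuousLinearMap.adjoint_inner_left, relAnti_adjoint, map_sub,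
      relAnti_relAnti, sub_self, inner_zero_right]
  have hanti : ∀ K : Submodule ℂ RelSpace, (∀ w ∈ K, relAnti w = w) → v - relAnti v ∈ Kᗮ :=
    fun K hK => (Submodule.mem_orthogonal _ _).2 fun w hw => hperp w (hK w hw)
  set a := spaceA.starProjection v
  set b := spaceB.starProjection v
  set c := spaceC.starProjection v
  have hD : spaceD.starProjection v = relAnti v - a - b - c := by
    refine Submodule.eq_starProjection_of_mem_orthogonal ?_ ?_
    · rw [mem_spaceD_iff]
      refine ⟨?_, ?_, ?_, ?_⟩
      · rw [map_sub, map_sub, map_sub, relAnti_relAnti, relAnti_of_mem_spaceA hA,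
          relAnti_of_mem_spaceB hB, relAnti_of_mem_spaceC hC]
      · rw [show relAnti v - a - b - c = (v - a) - (v - relAnti v) - b - c by abel]
        exact Submodule.sub_mem _ (Submodule.sub_mem _ (Submodule.sub_mem _ hvA
          (hanti _ fun _ h => relAnti_of_mem_spaceA h)) (hBA hB)) (hCA hC)
      · rw [show relAnti v - a - b - c = (v - b) - (v - relAnti v) - a - c by abel]
        exact Submodule.sub_mem _ (Submodule.sub_mem _ (Submodule.sub_mem _ hvB
          (hanti _ fun _ h => relAnti_of_mem_spaceB h)) (spaceA_le_orthogonal_spaceB hA)) (hCB hC)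
      · rw [show relAnti v - a - b - c = (v - c) - (v - relAnti v) - a - b by abel]
        exact Submodule.sub_mem _ (Submodule.sub_mem _ (Submodule.sub_mem _ hvC
          (hanti _ fun _ h => relAnti_of_mem_spaceC h)) (spaceA_le_orthogonal_spaceC hA))
          (spaceB_le_orthogonal_spaceC hB)
    · rw [show v - (relAnti v - a - b - c) = (v - relAnti v) + a + b + c by abel]
      have hle : ∀ K : Submodule ℂ RelSpace, (∀ w ∈ spaceD, w ∈ Kᗮ) → K ≤ spaceDᗮ :=
        fun K hK => (Submodule.isOrtho_iff_le.2 hK).symm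
      exact Submodule.add_mem _ (Submodule.add_mem _ (Submodule.add_mem _
        (hanti _ fun _ h => relAnti_of_mem_spaceD h)
        (hle spaceA (fun w hw => ((mem_spaceD_iff w).1 hw).2.1) hA))
        (hle spaceB (fun w hw => ((mem_spaceD_iff w).1 hw).2.2.1) hB))
        (hle spaceC (fun w hw => ((mem_spaceD_iff w).1 hw).2.2.2) hC)
  change a + b + c + spaceD.starProjection v = relAnti v
  rw [hD]; abel

theorem relA_of_mem_spaceA (lam : ℂ) (h0 : coupling lam ≠ 0) (p : ℝ) {v : RelSpace}
    (hv : v ∈ spaceA) : relA lam p v = exp (2 * I * p) • v := by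
  have h : spaceA ≤ LinearMap.eqLocus (relA lam p : RelSpace →ₗ[ℂ] RelSpace)
      ((exp (2 * I * p) • (1 : RelSpace →L[ℂ] RelSpace) : RelSpace →L[ℂ] RelSpace) :
        RelSpace →ₗ[ℂ] RelSpace) := by
    rw [spaceA_eq]
    refine Submodule.topologicalClosure_minimal _ (Submodule.span_le.2 ?_)
      (isClosed_eq (relA lam p).continuous (ContinuousLinearMap.continuous _))
    rintro _ ⟨y, hy, rfl⟩
    refine Submodule.smul_mem _ _ ?_
    change relA lam p (antiKet (0, y)) = exp (2 * I * p) • antiKet (0, y)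
    rw [relA_antiKet_of_ne lam h0 p 0 hy, show y - relShift 0 = y from sub_zero y]
    rfl
  exact h hv

theorem relA_of_mem_spaceB (lam : ℂ) (h0 : coupling lam ≠ 0) (p : ℝ) {v : RelSpace}
    (hv : v ∈ spaceB) : relA lam p v = exp (-2 * I * p) • v := by
  have h : spaceB ≤ LinearMap.eqLocus (relA lam p : RelSpace →ₗ[ℂ] RelSpace)
      ((exp (-2 * I * p) • (1 : RelSpace →L[ℂ] RelSpace) : RelSpace →L[ℂ] RelSpace) :
        RelSpace →ₗ[ℂ] RelSpace) := by
    rw [spaceB_eq]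
    refine Submodule.topologicalClosure_minimal _ (Submodule.span_le.2 ?_)
      (isClosed_eq (relA lam p).continuous (ContinuousLinearMap.continuous _))
    rintro _ ⟨y, hy, rfl⟩
    refine Submodule.smul_mem _ _ ?_
    change relA lam p (antiKet (1, y)) = exp (-2 * I * p) • antiKet (1, y)
    rw [relA_antiKet_of_ne lam h0 p 1 hy, show y - relShift 1 = y from sub_zero y]
    rfl
  exact h hv

end AntiKets

/-! ### Synthesis of vectors from momentum functions -/

section Synthesis

open Filter Topology

theorem eq_of_inner_fourierVec {f g : MomentumSpace}
    (h : ∀ z : ℤ, ⟪fourierVec z (1 : ℂ), f⟫_ℂ = ⟪fourierVec z (1 : ℂ), g⟫_ℂ) : f = g := by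
  refine fourierMonomialBasis.repr.injective (lp.ext (funext fun z => ?_))
  rw [HilbertBasis.repr_apply_apply, HilbertBasis.repr_apply_apply, fourierMonomialBasis_apply, h]

theorem clm_ext_fourierVec {E : Type*} [NormedAddCommGroup E] [NormedSpace ℂ E]
    {A B : MomentumSpace →L[ℂ] E} (h : ∀ z : ℤ, A (fourierVec z (1 : ℂ)) = B (fourierVec z (1 : ℂ))) :
    A = B := by
  refine ContinuousLinearMap.ext_on (s := Set.range fourierMonomialBasis) ?_ ?_
  · have h1 := fourierMonomialBasis.dense_span
    rwa [← Submodule.dense_iff_topologicalClosure_eq_top] at h1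
  · rintro _ ⟨z, rfl⟩
    rw [fourierMonomialBasis_apply]
    exact h z

/-- Bessel's inequality in the form of the Riemann–Lebesgue lemma. -/
theorem tendsto_inner_fourierVec (χ : MomentumSpace) {g : ℕ → ℤ} (hg : Function.Injective g) :
    Tendsto (fun n => ⟪χ, fourierVec (g n) (1 : ℂ)⟫_ℂ) atTop (𝓝 0) := by
  have h1 := (fourierMonomialBasis.orthonormal.inner_products_summable (x := χ)).tendsto_cofinite_zero
  have h2 := h1.comp hg.tendsto_cofinite
  rw [Nat.cofinite_eq_atTop] at h2
  rw [tendsto_zero_iff_norm_tendsto_zero]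
  have h3 := h2.sqrt
  rw [Real.sqrt_zero] at h3
  refine h3.congr fun n => ?_
  change Real.sqrt (‖⟪fourierMonomialBasis (g n), χ⟫_ℂ‖ ^ 2) = _
  rw [Real.sqrt_sq (norm_nonneg _), fourierMonomialBasis_apply, norm_inner_symm]

/-- The restriction of a sequence to the index set `s`. -/
def restrictTo (s : Set ℤ) : EllTwo ℤ →L[ℂ] EllTwo ℤ :=
  weightedPull s id (fun _ => 1) Function.injective_id.injOn (fun _ _ => by simp)

theorem norm_restrictTo (s : Set ℤ) (v : EllTwo ℤ) : ‖restrictTo s v‖ ≤ ‖v‖ := by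
  exact lp.norm_le_of_forall_sum_le (by norm_num) (norm_nonneg _)
    (sum_pull_le s id (fun _ => 1) Function.injective_id.injOn (fun _ _ => by simp) v)

variable {v : ℤ → RelSpace} (hv : Orthonormal ℂ v)

/-- The synthesis map `(2π)^{-1/2} e^{imk} ↦ v m` of an orthonormal sequence, cut off to the
indices `m ∈ s`. -/
def synthesis (s : Set ℤ) : MomentumSpace →L[ℂ] RelSpace :=
  hv.orthogonalFamily.linearIsometry.toContinuousLinearMap ∘L restrictTo s ∘L
    fourierMonomialBasis.repr.toContinuousLinearEquiv.toContinuousLinearMap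

open Classical in
theorem synthesis_fourierVec (s : Set ℤ) (m : ℤ) :
    synthesis hv s (fourierVec m (1 : ℂ)) = if m ∈ s then v m else 0 := by
  change hv.orthogonalFamily.linearIsometry (restrictTo s
    (fourierMonomialBasis.repr (fourierVec m (1 : ℂ)))) = _
  rw [← fourierMonomialBasis_apply, HilbertBasis.repr_self]
  have h : restrictTo s (lp.single 2 m (1 : ℂ)) = if m ∈ s then lp.single 2 m (1 : ℂ) else 0 := by
    refine ext_coord fun j => ?_
    refine (weightedPull_apply _ _ _ _ _ _ _).trans ?_
    rw [apply_ite (fun w : EllTwo ℤ => w j), one_mul, id, lp.single_apply, Pi.single_apply]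
    change _ = if m ∈ s then _ else (0 : ℂ)
    grind
  rw [h]
  split_ifs
  · rw [OrthogonalFamily.linearIsometry_apply_single]
    exact one_smul ℂ _
  · rw [map_zero]

theorem norm_synthesis_le (s : Set ℤ) (f : MomentumSpace) : ‖synthesis hv s f‖ ≤ ‖f‖ := by
  change ‖hv.orthogonalFamily.linearIsometry (restrictTo s (fourierMonomialBasis.repr f))‖ ≤ _
  rw [LinearIsometry.norm_map]
  refine (norm_restrictTo s _).trans ?_
  rw [LinearIsometryEquiv.norm_map]

theorem norm_synthesis_univ (f : MomentumSpace) : ‖synthesis hv Set.univ f‖ = ‖f‖ := by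
  change ‖hv.orthogonalFamily.linearIsometry (restrictTo Set.univ
    (fourierMonomialBasis.repr f))‖ = _
  have h : restrictTo Set.univ (fourierMonomialBasis.repr f) = fourierMonomialBasis.repr f := by
    refine ext_coord fun j => ?_
    refine (weightedPull_apply _ _ _ _ _ _ _).trans ?_
    rw [if_pos (Set.mem_univ j), one_mul]; rfl
  rw [h, LinearIsometry.norm_map, LinearIsometryEquiv.norm_map]

theorem synthesis_add_compl (s : Set ℤ) (f : MomentumSpace) :
    synthesis hv s f + synthesis hv sᶜ f = synthesis hv Set.univ f := by
  have h : synthesis hv s + synthesis hv sᶜ = synthesis hv Set.univ := by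
    refine clm_ext_fourierVec fun z => ?_
    rw [add_apply, synthesis_fourierVec, synthesis_fourierVec, synthesis_fourierVec]
    by_cases hz : z ∈ s <;> simp [hz]
  exact congrArg (fun A : MomentumSpace →L[ℂ] RelSpace => A f) h

theorem synthesis_adjoint_eq_zero (s : Set ℤ) {w : RelSpace} (h : ∀ m ∈ s, ⟪v m, w⟫_ℂ = 0) :
    ((synthesis hv s)†) w = 0 := by
  refine eq_of_inner_fourierVec fun z => ?_
  rw [ContinuousLinearMap.adjoint_inner_right, synthesis_fourierVec, inner_zero_right]
  split_ifs with hz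
  · exact h z hz
  · exact inner_zero_left _

theorem synthesis_adjoint_self (s : Set ℤ) {m : ℤ} (hm : m ∈ s) :
    ((synthesis hv s)†) (v m) = fourierVec m (1 : ℂ) := by
  classical
  refine eq_of_inner_fourierVec fun z => ?_
  rw [ContinuousLinearMap.adjoint_inner_right, synthesis_fourierVec, inner_fourierVec]
  by_cases hz : z = m
  · subst hz
    rw [if_pos hm, if_pos rfl, inner_self_eq_norm_sq_to_K, hv.1]; simp
  · rw [if_neg hz]
    split_ifs
    · exact hv.2 hz
    · exact inner_zero_left _

/-- The evolution by phases translates the indices, so that a set which every index leaves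
eventually carries no amplitude in the limit. -/
theorem tendsto_synthesis_phaseOp (s : Set ℤ) (ε : ℤ)
    (hs : ∀ z : ℤ, ∀ᶠ n : ℕ in atTop, z - n * ε ∉ s) (f : MomentumSpace) :
    Tendsto (fun n : ℕ => synthesis hv s (phaseOp (n * ε) f)) atTop (𝓝 0) := by
  refine tendsto_zero_of_hilbertBasis fourierMonomialBasis
    (fun n : ℕ => synthesis hv s ∘L phaseOp (n * ε)) (K := 1) (fun n h => ?_) (fun z => ?_) f
  · rw [one_mul]
    exact (norm_synthesis_le hv s _).trans (norm_phaseOp _ _).le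
  · refine tendsto_const_nhds.congr' ?_
    filter_upwards [hs z] with n hn
    rw [ContinuousLinearMap.comp_apply, fourierMonomialBasis_apply, phaseOp_fourierVec,
      synthesis_fourierVec, if_neg hn]

theorem tendsto_inner_phaseOp (χ : MomentumSpace) {ε : ℤ} (hε : ε ≠ 0) (f : MomentumSpace) :
    Tendsto (fun n : ℕ => ⟪χ, phaseOp (n * ε) f⟫_ℂ) atTop (𝓝 0) := by
  refine tendsto_zero_of_hilbertBasis fourierMonomialBasis
    (fun n : ℕ => innerSL ℂ χ ∘L phaseOp (n * ε)) (K := ‖χ‖) (fun n h => ?_) (fun z => ?_) f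
  · exact (norm_inner_le_norm (𝕜 := ℂ) χ _).trans
      (mul_le_mul_of_nonneg_left (norm_phaseOp _ _).le (norm_nonneg _))
  · have h := tendsto_inner_fourierVec χ (g := fun n : ℕ => z - n * ε)
      (fun n n' hn => by simpa [hε] using hn)
    refine h.congr fun n => ?_
    rw [ContinuousLinearMap.comp_apply, fourierMonomialBasis_apply, phaseOp_fourierVec]
    rfl

end Synthesis

/-! ### Expansion maps -/

section Expansion

theorem relAnti_ket_eq_smul_antiKet (i : Fin 6) (y : ℤ) :
    relAnti (ket (i, y)) = ((Real.sqrt 2 : ℝ) : ℂ)⁻¹ • antiKet (i, y) := by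
  rw [antiKet, smul_smul, inv_mul_cancel₀ sqrt_two_ne_zero, one_smul]

theorem antiKet_add_three (i : Fin 6) (y : ℤ) : antiKet (i + 3, -y) = -antiKet (i, y) := by
  rw [antiKet_eq, antiKet_eq, fin_six_add_three_add_three, neg_neg, ← smul_neg, neg_sub]

/-- An expansion map that vanishes on symmetric vectors is determined by the antisymmetrized
basis vectors in the internal states `e₁, e₂, e₃`. -/
theorem expansion_ket {φ : ℝ → RelIndex → ℂ} (hφ : ∀ k, IsAntisymmetric (φ k))
    {Φ : RelSpace →L[ℂ] MomentumSpace} (hΦ : ∀ v, Φ (relAnti v) = Φ v)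
    (h : ∀ i : Fin 6, (i = 0 ∨ i = 1 ∨ i = 2) → ∀ y : ℤ,
      (Φ (antiKet (i, y)) : ℝ → ℂ) =ᵐ[circleMeasure]
        fun k => ((Real.sqrt 2 : ℝ) : ℂ) * conj (φ k (i, y))) (q : RelIndex) :
    (Φ (ket q) : ℝ → ℂ) =ᵐ[circleMeasure] fun k => conj (φ k q) := by
  obtain ⟨i, y⟩ := q
  rw [← hΦ, relAnti_ket_eq_smul_antiKet, map_smul]
  by_cases hi : i = 0 ∨ i = 1 ∨ i = 2
  · filter_upwards [h i hi y, Lp.coeFn_smul (((Real.sqrt 2 : ℝ) : ℂ)⁻¹) (Φ (antiKet (i, y)))]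
      with k h1 h2
    rw [h2, Pi.smul_apply, h1, smul_eq_mul, ← mul_assoc, inv_mul_cancel₀ sqrt_two_ne_zero, one_mul]
  · have hi' : i + 3 = 0 ∨ i + 3 = 1 ∨ i + 3 = 2 := by revert i; decide
    have h3 := antiKet_add_three (i + 3) (-y)
    rw [fin_six_add_three_add_three, neg_neg] at h3
    rw [h3, map_neg]
    filter_upwards [h _ hi' (-y), Lp.coeFn_neg (Φ (antiKet (i + 3, -y))),
      Lp.coeFn_smul (((Real.sqrt 2 : ℝ) : ℂ)⁻¹) (-Φ (antiKet (i + 3, -y)))] with k h1 h4 h2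
    rw [h2, Pi.smul_apply, h4, Pi.neg_apply, h1, smul_eq_mul, hφ k i y, map_neg, mul_neg, mul_neg, mul_neg, neg_neg,
      ← mul_assoc, inv_mul_cancel₀ sqrt_two_ne_zero, one_mul]

theorem relH_mem_span_ket (lam : ℂ) {w : RelSpace}
    (hw : w ∈ Submodule.span ℂ (Set.range (ket : RelIndex → RelSpace))) :
    relH lam w ∈ Submodule.span ℂ (Set.range (ket : RelIndex → RelSpace)) := by
  have hk : ∀ q : RelIndex, ket q ∈ Submodule.span ℂ (Set.range (ket : RelIndex → RelSpace)) :=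
    fun q => Submodule.subset_span ⟨q, rfl⟩
  induction hw using Submodule.span_induction with
  | mem x hx =>
    obtain ⟨⟨i, y⟩, rfl⟩ := hx
    rw [relH_ket]
    split_ifs
    · fin_cases i <;>
      exact Submodule.neg_mem _ (Submodule.smul_mem _ _
        (by first | exact hk _ | exact Submodule.add_mem _ (hk _) (hk _)))
    · exact Submodule.zero_mem _
  | zero => rw [map_zero]; exact Submodule.zero_mem _
  | add x y _ _ hx hy => rw [map_add]; exact Submodule.add_mem _ hx hy
  | smul c x _ hx => rw [map_smul]; exact Submodule.smul_mem _ _ hx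

theorem relA_adjoint_ket_mem_span (lam : ℂ) (h0 : coupling lam ≠ 0) (p : ℝ) (q : RelIndex) :
    ((relA lam p)†) (ket q) ∈ Submodule.span ℂ (Set.range (ket : RelIndex → RelSpace)) := by
  have hk : ∀ q : RelIndex, ket q ∈ Submodule.span ℂ (Set.range (ket : RelIndex → RelSpace)) :=
    fun q => Submodule.subset_span ⟨q, rfl⟩
  have h1 : ((relJ lam)†) (ket q) ∈ Submodule.span ℂ (Set.range (ket : RelIndex → RelSpace)) := by
    rw [relJ_adjoint_eq lam h0, relHPoly]
    exact Submodule.add_mem _ (Submodule.add_mem _ (hk q)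
      (Submodule.smul_mem _ _ (relH_mem_span_ket lam (hk q))))
      (Submodule.smul_mem _ _ (relH_mem_span_ket lam (relH_mem_span_ket lam (hk q))))
  rw [relA_adjoint_eq]
  change relAnti (((relFree p)†) (((relJ lam)†) (ket q))) ∈ _
  generalize ((relJ lam)†) (ket q) = w at h1
  induction h1 using Submodule.span_induction with
  | mem x hx =>
    obtain ⟨⟨i, y⟩, rfl⟩ := hx
    rw [relFree_adjoint_ket, map_smul, relAnti_ket]
    exact Submodule.smul_mem _ _ (Submodule.smul_mem _ _ (Submodule.sub_mem _ (hk _) (hk _)))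
  | zero => rw [map_zero, map_zero]; exact Submodule.zero_mem _
  | add x y _ _ hx hy => rw [map_add, map_add]; exact Submodule.add_mem _ hx hy
  | smul c x _ hx => rw [map_smul, map_smul]; exact Submodule.smul_mem _ _ hx

/-- On finite combinations of basis vectors the expansion map is the formal pairing. -/
theorem expansion_eq_formalPairing {φ : ℝ → RelIndex → ℂ} {Φ : RelSpace →L[ℂ] MomentumSpace}
    (hΦ : ∀ i, (Φ (ket i) : ℝ → ℂ) =ᵐ[circleMeasure] fun k => conj (φ k i)) {w : RelSpace}
    (hw : w ∈ Submodule.span ℂ (Set.range (ket : RelIndex → RelSpace))) :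
    ∃ s : ℝ → ℂ, (∀ k, FormalPairing (φ k) w (s k)) ∧
      (Φ w : ℝ → ℂ) =ᵐ[circleMeasure] fun k => conj (s k) := by
  induction hw using Submodule.span_induction with
  | mem x hx =>
    obtain ⟨i, rfl⟩ := hx
    exact ⟨fun k => φ k i, fun k => formalPairing_ket _ i, hΦ i⟩
  | zero =>
    refine ⟨fun _ => 0, fun k => (hasSum_congr_fun fun j => ?_).1 hasSum_zero, ?_⟩
    · change _ = conj (0 : ℂ) * φ k j
      rw [map_zero, zero_mul]
    · rw [map_zero]
      filter_upwards [Lp.coeFn_zero ℂ 2 circleMeasure] with k h1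
      rw [h1, map_zero]; rfl
  | add x y _ _ hx hy =>
    obtain ⟨s, hs, hs'⟩ := hx
    obtain ⟨t, ht, ht'⟩ := hy
    refine ⟨fun k => s k + t k, fun k => (hs k).add (ht k), ?_⟩
    rw [map_add]
    filter_upwards [hs', ht', Lp.coeFn_add (Φ x) (Φ y)] with k h1 h2 h3
    rw [h3, Pi.add_apply, h1, h2, map_add]
  | smul c x _ hx =>
    obtain ⟨s, hs, hs'⟩ := hx
    refine ⟨fun k => conj c * s k, fun k => (hs k).smul c, ?_⟩
    rw [map_smul]
    filter_upwards [hs', Lp.coeFn_smul c (Φ x)] with k h1 h3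
    rw [h3, Pi.smul_apply, h1, map_mul, conj_conj, smul_eq_mul]

/-- The eigenvector equation says that the expansion map intertwines `A(p)†` with multiplication
by `e^{ik}`. -/
theorem expansion_relA_adjoint (lam : ℂ) (h0 : coupling lam ≠ 0) (p : ℝ)
    {φ : ℝ → RelIndex → ℂ} {Φ : RelSpace →L[ℂ] MomentumSpace}
    (hΦ : ∀ i, (Φ (ket i) : ℝ → ℂ) =ᵐ[circleMeasure] fun k => conj (φ k i))
    (hφ : ∀ k : ℝ, IsImproperEigenvector (relA lam p) (exp (-I * k)) (φ k)) (v : RelSpace) :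
    Φ (((relA lam p)†) v) = phaseOp (-1) (Φ v) := by
  have h : Φ ∘L (relA lam p)† = phaseOp (-1) ∘L Φ := by
    refine clm_ext_ket fun i => ?_
    refine Lp.ext ?_
    obtain ⟨s, hs, hs'⟩ := expansion_eq_formalPairing hΦ (relA_adjoint_ket_mem_span lam h0 p i)
    change (Φ (((relA lam p)†) (ket i)) : ℝ → ℂ) =ᵐ[circleMeasure] phaseOp (-1) (Φ (ket i))
    filter_upwards [hs', hΦ i, coeFn_phaseOp (-1) (Φ (ket i))] with k h1 h2 h3
    have h4 : s k = exp (-I * k) * φ k i :=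
      (hs k).unique ((isImproperEigenvector_iff _ _ _).1 (hφ k) i)
    rw [h1, h3, h2, h4, map_mul, conj_exp_neg_I_mul]
    simp
  exact congrArg (fun A : RelSpace →L[ℂ] MomentumSpace => A v) h

theorem relA_expansion_adjoint (lam : ℂ) (h0 : coupling lam ≠ 0) (p : ℝ)
    {φ : ℝ → RelIndex → ℂ} {Φ : RelSpace →L[ℂ] MomentumSpace}
    (hΦ : ∀ i, (Φ (ket i) : ℝ → ℂ) =ᵐ[circleMeasure] fun k => conj (φ k i))
    (hφ : ∀ k : ℝ, IsImproperEigenvector (relA lam p) (exp (-I * k)) (φ k)) (f : MomentumSpace) :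
    relA lam p ((Φ†) f) = (Φ†) (phaseOp 1 f) := by
  refine ext_inner_right ℂ fun w => ?_
  rw [ContinuousLinearMap.adjoint_inner_left, ← ContinuousLinearMap.adjoint_inner_right,
    ContinuousLinearMap.adjoint_inner_left, expansion_relA_adjoint lam h0 p hΦ hφ,
    ← ContinuousLinearMap.adjoint_inner_left, phaseOp_adjoint, neg_neg]

theorem relAnti_expansion_adjoint {Φ : RelSpace →L[ℂ] MomentumSpace}
    (hΦ : ∀ v, Φ (relAnti v) = Φ v) (f : MomentumSpace) : relAnti ((Φ†) f) = (Φ†) f := by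
  refine ext_inner_right ℂ fun w => ?_
  rw [← ContinuousLinearMap.adjoint_inner_right, relAnti_adjoint,
    ContinuousLinearMap.adjoint_inner_left, hΦ, ContinuousLinearMap.adjoint_inner_left]

theorem relA_adjoint_expansion_adjoint (lam : ℂ) (h0 : coupling lam ≠ 0) (p : ℝ)
    {φ : ℝ → RelIndex → ℂ} {Φ : RelSpace →L[ℂ] MomentumSpace}
    (hΦ : ∀ i, (Φ (ket i) : ℝ → ℂ) =ᵐ[circleMeasure] fun k => conj (φ k i))
    (hφ : ∀ k : ℝ, IsImproperEigenvector (relA lam p) (exp (-I * k)) (φ k))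
    (hanti : ∀ v, Φ (relAnti v) = Φ v) (f : MomentumSpace) :
    ((relA lam p)†) ((Φ†) f) = (Φ†) (phaseOp (-1) f) := by
  have h : f = phaseOp 1 (phaseOp (-1) f) := by
    rw [phaseOp_phaseOp, show (1 : ℤ) + -1 = 0 by norm_num, phaseOp_zero]
  conv_lhs => rw [h]
  rw [← relA_expansion_adjoint lam h0 p hΦ hφ, relA_adjoint_relA lam p
    (relAnti_expansion_adjoint hanti _)]

/-- An expansion map with `Φ Φ† = 1` is a partial isometry with initial space `K` as soon as `Φ†`
maps into `K` and `Φ` is injective on `K`. -/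
theorem adjoint_comp_self_eq {Φ : RelSpace →L[ℂ] MomentumSpace}
    {K : Submodule ℂ RelSpace} [K.HasOrthogonalProjection]
    (hΦ : Φ ∘L Φ† = ContinuousLinearMap.id ℂ MomentumSpace)
    (hK : ∀ f, (Φ†) f ∈ K) (hker : ∀ v ∈ K, Φ v = 0 → v = 0) : Φ† ∘L Φ = K.starProjection := by
  have hΦΦ : ∀ f, Φ ((Φ†) f) = f := fun f =>
    congrArg (fun A : MomentumSpace →L[ℂ] MomentumSpace => A f) hΦ
  refine ContinuousLinearMap.ext fun v => ?_
  have hperp : ∀ w ∈ Kᗮ, Φ w = 0 := by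
    intro w hw
    refine ext_inner_left ℂ fun f => ?_
    rw [← ContinuousLinearMap.adjoint_inner_left, inner_zero_right]
    exact (Submodule.mem_orthogonal _ _).1 hw _ (hK f)
  have h1 : Φ v = Φ (K.starProjection v) := by
    rw [← sub_eq_zero, ← map_sub]
    exact hperp _ (Submodule.sub_starProjection_mem_orthogonal v)
  change (Φ†) (Φ v) = _
  rw [← sub_eq_zero]
  refine hker _ (Submodule.sub_mem _ (hK _) (Submodule.starProjection_apply_mem _ _)) ?_
  rw [map_sub, hΦΦ, h1, sub_self]

end Expansion

/-! ### The free branch -/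

section FreeBranch

theorem orthonormal_antiKet_two (r : ℤ) :
    Orthonormal ℂ (fun m : ℤ => antiKet ((2 : Fin 6), 2 * m + r)) := by
  rw [orthonormal_iff_ite]
  intro m m'
  rw [inner_antiKet_antiKet]
  simp

/-- The expansion map of the vectors `φ_f(k)`. -/
def freeExpansion : RelSpace →L[ℂ] MomentumSpace :=
  (synthesis (orthonormal_antiKet_two 1) Set.univ)†

theorem inner_antiKet_relAnti (q : RelIndex) (v : RelSpace) :
    ⟪antiKet q, relAnti v⟫_ℂ = ⟪antiKet q, v⟫_ℂ := by
  rw [inner_antiKet_left, inner_antiKet_left, relAnti_relAnti]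

theorem synthesis_adjoint_relAnti (r : ℤ) (s : Set ℤ) (v : RelSpace) :
    ((synthesis (orthonormal_antiKet_two r) s)†) (relAnti v) =
      ((synthesis (orthonormal_antiKet_two r) s)†) v := by
  rw [← sub_eq_zero, ← map_sub]
  refine synthesis_adjoint_eq_zero _ _ fun m _ => ?_
  rw [inner_sub_right, inner_antiKet_relAnti, sub_self]

theorem freeExpansion_relAnti (v : RelSpace) : freeExpansion (relAnti v) = freeExpansion v :=
  synthesis_adjoint_relAnti 1 _ v

theorem sqrt_two_mul_inv_sqrt_four_pi : ((Real.sqrt 2 : ℝ) : ℂ) *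
    ((Real.sqrt (4 * Real.pi) : ℝ) : ℂ)⁻¹ = ((Real.sqrt (2 * Real.pi) : ℝ) : ℂ)⁻¹ := by
  rw [show 4 * Real.pi = 2 * (2 * Real.pi) by ring, Real.sqrt_mul (by norm_num), ofReal_mul,
    mul_inv, ← mul_assoc, mul_inv_cancel₀ sqrt_two_ne_zero, one_mul]

theorem freeExpansion_ket (q : RelIndex) :
    (freeExpansion (ket q) : ℝ → ℂ) =ᵐ[circleMeasure] fun k => conj (phiFree k q) := by
  have hzero : ∀ w : RelSpace, (∀ m : ℤ, ⟪antiKet (2, 2 * m + 1), w⟫_ℂ = 0) →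
      (freeExpansion w : ℝ → ℂ) =ᵐ[circleMeasure] fun _ => 0 := by
    intro w hw
    rw [freeExpansion, synthesis_adjoint_eq_zero _ _ fun m _ => hw m]
    exact Lp.coeFn_zero ℂ 2 circleMeasure
  refine expansion_ket isAntisymmetric_phiFree freeExpansion_relAnti ?_ q
  rintro i (rfl | rfl | rfl) y
  · refine (hzero _ fun m => ?_).trans (Filter.Eventually.of_forall fun k => ?_)
    · rw [inner_antiKet_antiKet]; simp
    · simp [phiFree]
  · refine (hzero _ fun m => ?_).trans (Filter.Eventually.of_forall fun k => ?_)
    · rw [inner_antiKet_antiKet]; simp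
    · simp [phiFree]
  · by_cases hy : Odd y
    · obtain ⟨m, rfl⟩ := hy
      rw [freeExpansion, synthesis_adjoint_self (orthonormal_antiKet_two 1) _ (Set.mem_univ m)]
      filter_upwards [coeFn_fourierVec m (1 : ℂ)] with k hk
      have h1 : (2 * m + 1 - 1) / 2 = m := by omega
      rw [hk, phiFree, if_pos ⟨m, rfl⟩, monomial, smul_eq_mul, mul_one]
      simp only [Matrix.cons_val]
      rw [h1, map_mul, map_inv₀, conj_ofReal, ← mul_assoc, sqrt_two_mul_inv_sqrt_four_pi, ← exp_conj]
      congr 2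
      simp
    · refine (hzero _ fun m => ?_).trans (Filter.Eventually.of_forall fun k => ?_)
      · rw [inner_antiKet_antiKet, if_neg, if_neg]
        · simp
        · rintro ⟨h, -⟩; revert h; decide
        · rintro ⟨-, rfl⟩; exact hy ⟨m, rfl⟩
      · simp [phiFree, hy]

theorem freeExpansion_comp_adjoint :
    freeExpansion ∘L freeExpansion† = ContinuousLinearMap.id ℂ MomentumSpace := by
  rw [freeExpansion, ContinuousLinearMap.adjoint_adjoint]
  exact (ContinuousLinearMap.norm_map_iff_adjoint_comp_self _).1 (norm_synthesis_univ _)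

theorem mem_of_forall_fourierVec {K : Submodule ℂ RelSpace} (hK : IsClosed (K : Set RelSpace))
    (T : MomentumSpace →L[ℂ] RelSpace) (h : ∀ z : ℤ, T (fourierVec z (1 : ℂ)) ∈ K)
    (f : MomentumSpace) : T f ∈ K := by
  have h1 : (K.comap (T : MomentumSpace →ₗ[ℂ] RelSpace)) = ⊤ := by
    rw [eq_top_iff, ← fourierMonomialBasis.dense_span]
    refine Submodule.topologicalClosure_minimal _ (Submodule.span_le.2 ?_)
      (hK.preimage T.continuous)
    rintro _ ⟨z, rfl⟩
    rw [fourierMonomialBasis_apply]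
    exact h z
  have h2 : f ∈ K.comap (T : MomentumSpace →ₗ[ℂ] RelSpace) := by rw [h1]; trivial
  exact h2

theorem isImproperBasis_phiFree :
    IsImproperBasis phiFree spaceC.starProjection freeExpansion := by
  refine ⟨freeExpansion_ket, freeExpansion_comp_adjoint,
    adjoint_comp_self_eq freeExpansion_comp_adjoint ?_ ?_⟩
  · refine mem_of_forall_fourierVec (Submodule.isClosed_topologicalClosure _) _ fun z => ?_
    rw [freeExpansion, ContinuousLinearMap.adjoint_adjoint, synthesis_fourierVec,
      if_pos (Set.mem_univ z)]
    exact antiKet_mem_spaceC z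
  · intro v hv h
    have hperp : v ∈ spaceCᗮ := by
      refine mem_orthogonal_spaceC fun z => ?_
      have h1 := congrArg (fun g : MomentumSpace => ⟪fourierVec z (1 : ℂ), g⟫_ℂ) h
      simp only [freeExpansion, ContinuousLinearMap.adjoint_inner_right, synthesis_fourierVec,
        Set.mem_univ, if_true, inner_zero_right] at h1
      exact h1
    exact inner_self_eq_zero.1 ((Submodule.mem_orthogonal _ _).1 hperp v hv)

end FreeBranch

/-! ### The scattering branch -/

section Scattering

open Filter Topology

theorem continuous_scatC (lam : ℂ) (p : ℝ) : Continuous (scatC lam p) := by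
  unfold scatC; fun_prop

theorem continuous_scatD (lam : ℂ) (p s : ℝ) : Continuous (fun k => scatD lam p k s) := by
  unfold scatD; fun_prop

theorem scatC_im (lam : ℂ) (p k : ℝ) :
    (scatC lam p k).im = (1 - Real.cos (coupling lam)) * Real.sin k := by
  have h1 : (exp (I * k)).im = Real.sin k := by rw [mul_comm, exp_ofReal_mul_I_im]
  have h2 : (exp (-I * k)).im = -Real.sin k := by
    rw [← conj_conj (exp (-I * k)), conj_exp_neg_I_mul, conj_im, h1]
  rw [scatC, add_im, im_ofReal_mul, sub_im, sub_im, h1, h2, ofReal_im]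
  ring

/-- The denominator `c_k` vanishes only where `sin k` does, since `cos(√2|λ|) ≠ 1`. -/
theorem ae_scatC_ne_zero (lam : ℂ) (p : ℝ) (hC : Real.cos (coupling lam) ≠ 1) :
    ∀ᵐ k ∂circleMeasure, scatC lam p k ≠ 0 := by
  refine ae_restrict_of_ae ?_
  have hsub : {k : ℝ | ¬ scatC lam p k ≠ 0} ⊆ Set.range fun n : ℤ => (n : ℝ) * Real.pi := by
    intro k hk
    have h1 := congrArg Complex.im (not_not.1 hk)
    rw [scatC_im, zero_im] at h1
    exact Real.sin_eq_zero_iff.1 ((mul_eq_zero.1 h1).resolve_left (sub_ne_zero.2 hC.symm))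
  exact measure_mono_null hsub ((Set.countable_range _).measure_zero volume)

/-- The scattering phase `c_k / |c_k|`. -/
def scatPhase (lam : ℂ) (p k : ℝ) : ℂ := scatC lam p k / (‖scatC lam p k‖ : ℂ)

theorem measurable_scatPhase (lam : ℂ) (p : ℝ) : Measurable (scatPhase lam p) := by
  have h := (continuous_scatC lam p).measurable
  exact h.div (measurable_ofReal.comp h.norm)

theorem norm_scatPhase_of_ne {lam : ℂ} {p k : ℝ} (h : scatC lam p k ≠ 0) :
    ‖scatPhase lam p k‖ = 1 := by
  rw [scatPhase, norm_div, norm_real, norm_norm, div_self (norm_ne_zero_iff.2 h)]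

theorem norm_scatPhase_le (lam : ℂ) (p k : ℝ) : ‖scatPhase lam p k‖ ≤ 1 := by
  by_cases h : scatC lam p k = 0
  · rw [scatPhase, h, zero_div, norm_zero]; exact zero_le_one
  · exact (norm_scatPhase_of_ne h).le

/-- Multiplication by the scattering phase. -/
def scatPhaseOp (lam : ℂ) (p : ℝ) : MomentumSpace →L[ℂ] MomentumSpace :=
  mulOp (scatPhase lam p) (measurable_scatPhase lam p) (norm_scatPhase_le lam p)

/-- Multiplication by the complex conjugate of the scattering phase. -/
def scatPhaseConjOp (lam : ℂ) (p : ℝ) : MomentumSpace →L[ℂ] MomentumSpace :=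
  mulOp (fun k => conj (scatPhase lam p k)) (continuous_conj.measurable.comp
    (measurable_scatPhase lam p)) (fun k => by rw [norm_conj]; exact norm_scatPhase_le lam p k)

theorem scatPhaseOp_adjoint (lam : ℂ) (p : ℝ) : (scatPhaseOp lam p)† = scatPhaseConjOp lam p :=
  mulOp_adjoint _ _ _ _ _ _ fun _ => rfl

theorem scatPhaseConjOp_adjoint (lam : ℂ) (p : ℝ) :
    (scatPhaseConjOp lam p)† = scatPhaseOp lam p := by
  rw [← scatPhaseOp_adjoint, ContinuousLinearMap.adjoint_adjoint]

theorem scatPhaseOp_phaseOp (lam : ℂ) (p : ℝ) (n : ℤ) (f : MomentumSpace) :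
    scatPhaseOp lam p (phaseOp n f) = phaseOp n (scatPhaseOp lam p f) := mulOp_comm _ _ _ _ _ _ f

theorem scatPhaseConjOp_phaseOp (lam : ℂ) (p : ℝ) (n : ℤ) (f : MomentumSpace) :
    scatPhaseConjOp lam p (phaseOp n f) = phaseOp n (scatPhaseConjOp lam p f) :=
  mulOp_comm _ _ _ _ _ _ f

theorem norm_scatPhaseOp {lam : ℂ} (p : ℝ) (hC : Real.cos (coupling lam) ≠ 1)
    (f : MomentumSpace) : ‖scatPhaseOp lam p f‖ = ‖f‖ :=
  norm_mulOp_of_ae_norm_eq_one _ _ _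
    ((ae_scatC_ne_zero lam p hC).mono fun _ h => norm_scatPhase_of_ne h) f

theorem scatPhase_mul_conj {lam : ℂ} {p k : ℝ} (h : scatC lam p k ≠ 0) :
    scatPhase lam p k * conj (scatPhase lam p k) = 1 := by
  rw [mul_conj, normSq_eq_norm_sq, norm_scatPhase_of_ne h]; simp

theorem scatPhaseOp_scatPhaseConjOp {lam : ℂ} (p : ℝ) (hC : Real.cos (coupling lam) ≠ 1)
    (f : MomentumSpace) : scatPhaseOp lam p (scatPhaseConjOp lam p f) = f :=
  mulOp_mulOp_of_ae_eq_one _ _ _ _ _ _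
    ((ae_scatC_ne_zero lam p hC).mono fun _ h => scatPhase_mul_conj h) f

theorem scatPhaseConjOp_scatPhaseOp {lam : ℂ} (p : ℝ) (hC : Real.cos (coupling lam) ≠ 1)
    (f : MomentumSpace) : scatPhaseConjOp lam p (scatPhaseOp lam p f) = f :=
  mulOp_mulOp_of_ae_eq_one _ _ _ _ _ _
    ((ae_scatC_ne_zero lam p hC).mono fun _ h => by rw [mul_comm]; exact scatPhase_mul_conj h) f

theorem norm_exp_sub_conj (q k : ℝ) : ‖exp (I * k) - (q : ℂ)‖ = ‖exp (-I * k) - (q : ℂ)‖ := by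
  rw [← conj_exp_neg_I_mul, ← norm_conj, map_sub, conj_conj, conj_ofReal]

theorem abs_cos_lt_one_of_sin_ne_zero {x : ℝ} (h : Real.sin x ≠ 0) : |Real.cos x| < 1 := by
  rw [← sq_lt_one_iff_abs_lt_one]
  have h1 := Real.sin_sq_add_cos_sq x
  have h2 : 0 < Real.sin x ^ 2 := by positivity
  linarith

/-- The amplitude at the origin is bounded by the denominator, also at the exceptional momenta. -/
theorem exists_norm_scatD_le (lam : ℂ) (p : ℝ) {s : ℝ} (hs : s = 1 ∨ s = -1) :
    ∃ K : ℝ, ∀ k, ‖scatD lam p k s‖ ≤ K * ‖scatC lam p k‖ := by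
  by_cases hsin : Real.sin (coupling lam) = 0
  · refine ⟨0, fun k => ?_⟩
    rw [scatD, hsin]; simp
  have hC := abs_cos_lt_one_of_sin_ne_zero hsin
  set C := Real.cos (coupling lam) with hCdef
  set q := Real.cos (2 * p) with hq
  have h1 : ∀ k : ℝ, (1 - |C|) * ‖exp (-I * k) - (q : ℂ)‖ ≤ ‖scatC lam p k‖ := by
    intro k
    rw [scatC, add_comm]
    have h := norm_sub_le_norm_add (exp (I * k) - (q : ℂ)) ((C : ℂ) * (exp (-I * k) - (q : ℂ)))
    rw [norm_mul, norm_real, Real.norm_eq_abs, norm_exp_sub_conj] at h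
    linarith
  obtain ⟨K, hK0, hK⟩ : ∃ K : ℝ, 0 ≤ K ∧ ∀ k : ℝ,
      ‖exp (-I * k) - exp (-2 * I * s * p)‖ ≤ K * ‖exp (-I * k) - (q : ℂ)‖ := by
    have he : exp (-2 * I * s * p) = (Real.cos (-(2 * s * p)) : ℂ)
        + (Real.sin (-(2 * s * p)) : ℂ) * I := by
      rw [ofReal_cos, ofReal_sin, ← exp_mul_I]
      congr 1; push_cast; ring
    by_cases hsp : Real.sin (2 * p) = 0
    · refine ⟨1, zero_le_one, fun k => ?_⟩
      have h2 : exp (-2 * I * s * p) = (q : ℂ) := by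
        rw [he, Real.cos_neg, Real.sin_neg]
        rcases hs with rfl | rfl
        · rw [mul_one, hsp, ← hq]; simp
        · rw [show 2 * -1 * p = -(2 * p) by ring, Real.cos_neg, Real.sin_neg, hsp, ← hq]; simp
      rw [h2, one_mul]
    · have hq1 : |q| < 1 := abs_cos_lt_one_of_sin_ne_zero hsp
      have hpos : 0 < 1 - |q| := by linarith
      refine ⟨2 / (1 - |q|), by positivity, fun k => ?_⟩
      have hn1 : ‖exp (-I * k)‖ = 1 := by rw [Complex.norm_exp]; simp
      have hn2 : ‖exp (-2 * I * s * p)‖ = 1 := by rw [Complex.norm_exp]; simp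
      have h3 : ‖exp (-I * k) - exp (-2 * I * s * p)‖ ≤ 2 :=
        (norm_sub_le _ _).trans (by rw [hn1, hn2]; norm_num)
      have h4 : 1 - |q| ≤ ‖exp (-I * k) - (q : ℂ)‖ := by
        have h := norm_sub_norm_le (exp (-I * k)) (q : ℂ)
        rwa [hn1, norm_real, Real.norm_eq_abs] at h
      calc _ ≤ 2 := h3
        _ = 2 / (1 - |q|) * (1 - |q|) := (div_mul_cancel₀ _ hpos.ne').symm
        _ ≤ _ := mul_le_mul_of_nonneg_left h4 (by positivity)
  have hpos : 0 < 1 - |C| := by linarith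
  set c₀ := I * conj lam * (Real.sin (coupling lam) : ℂ) / (coupling lam : ℂ) with hc₀
  refine ⟨‖c₀‖ * K / (1 - |C|), fun k => ?_⟩
  rw [scatD, norm_mul, ← hc₀]
  calc ‖c₀‖ * ‖exp (-I * k) - exp (-2 * I * s * p)‖
      ≤ ‖c₀‖ * (K * ‖exp (-I * k) - (q : ℂ)‖) :=
        mul_le_mul_of_nonneg_left (hK k) (norm_nonneg _)
    _ = ‖c₀‖ * K / (1 - |C|) * ((1 - |C|) * ‖exp (-I * k) - (q : ℂ)‖) := by
        field_simp
    _ ≤ _ := mul_le_mul_of_nonneg_left (h1 k) (by positivity)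

theorem phiScat_zero_zero (lam : ℂ) (p k : ℝ) :
    phiScat lam p k (0, 0) = (scatNorm lam p k : ℂ)⁻¹ * scatD lam p k 1 := by simp [phiScat]

theorem phiScat_one_zero (lam : ℂ) (p k : ℝ) :
    phiScat lam p k (1, 0) = (scatNorm lam p k : ℂ)⁻¹ * scatD lam p k (-1) := by simp [phiScat]

/-- The components of the scattering vectors at the origin are square integrable in `k`. -/
theorem exists_momentum_eq (lam : ℂ) (p : ℝ) {s : ℝ} (hs : s = 1 ∨ s = -1) :
    ∃ χ : MomentumSpace, (χ : ℝ → ℂ) =ᵐ[circleMeasure] fun k =>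
      ((Real.sqrt 2 : ℝ) : ℂ) * conj ((scatNorm lam p k : ℂ)⁻¹ * scatD lam p k s) := by
  obtain ⟨K, hK⟩ := exists_norm_scatD_le lam p hs
  have hmeas : Measurable fun k =>
      ((Real.sqrt 2 : ℝ) : ℂ) * conj ((scatNorm lam p k : ℂ)⁻¹ * scatD lam p k s) := by
    have h1 : Continuous fun k => (scatNorm lam p k : ℂ) := by
      have := continuous_scatC lam p
      unfold scatNorm; fun_prop
    exact (continuous_conj.measurable.comp
      (h1.measurable.inv.mul (continuous_scatD lam p s).measurable)).const_mul _
  have hmem : MemLp (fun k => ((Real.sqrt 2 : ℝ) : ℂ) *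
      conj ((scatNorm lam p k : ℂ)⁻¹ * scatD lam p k s)) 2 circleMeasure := by
    refine MemLp.of_bound hmeas.aestronglyMeasurable
      (Real.sqrt 2 * ((Real.sqrt (4 * Real.pi))⁻¹ * |K|)) (Eventually.of_forall fun k => ?_)
    rw [norm_mul, norm_conj, norm_real, Real.norm_of_nonneg (Real.sqrt_nonneg _), norm_mul,
      norm_inv, norm_real, scatNorm, norm_mul, norm_norm,
      Real.norm_of_nonneg (Real.sqrt_nonneg _), mul_inv, mul_assoc]
    refine mul_le_mul_of_nonneg_left (mul_le_mul_of_nonneg_left ?_ (by positivity))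
      (Real.sqrt_nonneg _)
    by_cases h : ‖scatC lam p k‖ = 0
    · rw [h, inv_zero, zero_mul]; exact abs_nonneg K
    · rw [inv_mul_le_iff₀ (lt_of_le_of_ne (norm_nonneg _) (Ne.symm h)), mul_comm]
      exact (hK k).trans (mul_le_mul_of_nonneg_right (le_abs_self K) (norm_nonneg _))
  exact ⟨hmem.toLp _, hmem.coeFn_toLp⟩

/-- The synthesis map of the vectors `φ_s(k)`, given the amplitudes `χa` and `χb` at the origin:
outgoing and incoming waves on the two half-lines, joined at the origin. -/
def scatSynthesis (lam : ℂ) (p : ℝ) (χa χb : MomentumSpace) : MomentumSpace →L[ℂ] RelSpace :=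
  synthesis (orthonormal_antiKet_two 0) {m | 1 ≤ m} ∘L scatPhaseConjOp lam p
    + synthesis (orthonormal_antiKet_two 0) {m | 1 ≤ m}ᶜ ∘L scatPhaseOp lam p
    + InnerProductSpace.rankOne ℂ (antiKet (0, 0)) χa
    + InnerProductSpace.rankOne ℂ (antiKet (1, 0)) χb

variable {lam : ℂ} {p : ℝ} {χa χb : MomentumSpace}

theorem scatSynthesis_apply (f : MomentumSpace) : scatSynthesis lam p χa χb f =
    synthesis (orthonormal_antiKet_two 0) {m | 1 ≤ m} (scatPhaseConjOp lam p f)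
    + synthesis (orthonormal_antiKet_two 0) {m | 1 ≤ m}ᶜ (scatPhaseOp lam p f)
    + ⟪χa, f⟫_ℂ • antiKet (0, 0) + ⟪χb, f⟫_ℂ • antiKet (1, 0) := rfl

theorem scatSynthesis_adjoint_apply (w : RelSpace) : ((scatSynthesis lam p χa χb)†) w =
    scatPhaseOp lam p (((synthesis (orthonormal_antiKet_two 0) {m | 1 ≤ m})†) w)
    + scatPhaseConjOp lam p (((synthesis (orthonormal_antiKet_two 0) {m | 1 ≤ m}ᶜ)†) w)
    + ⟪antiKet (0, 0), w⟫_ℂ • χa + ⟪antiKet (1, 0), w⟫_ℂ • χb := by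
  rw [scatSynthesis, map_add, map_add, map_add, ContinuousLinearMap.adjoint_comp,
    ContinuousLinearMap.adjoint_comp, InnerProductSpace.adjoint_rankOne,
    InnerProductSpace.adjoint_rankOne, scatPhaseOp_adjoint, scatPhaseConjOp_adjoint]
  rfl

theorem scatExpansion_relAnti (w : RelSpace) : ((scatSynthesis lam p χa χb)†) (relAnti w) =
    ((scatSynthesis lam p χa χb)†) w := by
  simp only [scatSynthesis_adjoint_apply, synthesis_adjoint_relAnti, inner_antiKet_relAnti]

theorem scatPhase_mul_monomial (lam : ℂ) (p k : ℝ) (m : ℤ) : scatPhase lam p k * monomial m k =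
    ((Real.sqrt 2 : ℝ) : ℂ) * conj ((scatNorm lam p k : ℂ)⁻¹ *
      (conj (scatC lam p k) * exp (-I * m * k))) := by
  have h1 : conj (exp (-I * m * k)) = exp (I * k * m) := by
    rw [← exp_conj]; congr 1; simp; ring
  rw [map_mul, map_mul, conj_conj, h1, map_inv₀, conj_ofReal, scatNorm, ofReal_mul, mul_inv,
    monomial, ← sqrt_two_mul_inv_sqrt_four_pi, scatPhase]
  ring

theorem conj_scatPhase_mul_monomial (lam : ℂ) (p k : ℝ) (m : ℤ) :
    conj (scatPhase lam p k) * monomial m k =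
    ((Real.sqrt 2 : ℝ) : ℂ) * conj ((scatNorm lam p k : ℂ)⁻¹ *
      (scatC lam p k * exp (-I * m * k))) := by
  have h1 : conj (exp (-I * m * k)) = exp (I * k * m) := by
    rw [← exp_conj]; congr 1; simp; ring
  rw [map_mul, map_mul, h1, map_inv₀, conj_ofReal, scatNorm, ofReal_mul, mul_inv,
    monomial, ← sqrt_two_mul_inv_sqrt_four_pi, scatPhase, map_div₀, conj_ofReal]
  ring

theorem scatExpansion_ket
    (ha : (χa : ℝ → ℂ) =ᵐ[circleMeasure] fun k =>
      ((Real.sqrt 2 : ℝ) : ℂ) * conj (phiScat lam p k (0, 0)))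
    (hb : (χb : ℝ → ℂ) =ᵐ[circleMeasure] fun k =>
      ((Real.sqrt 2 : ℝ) : ℂ) * conj (phiScat lam p k (1, 0))) (q : RelIndex) :
    (((scatSynthesis lam p χa χb)†) (ket q) : ℝ → ℂ) =ᵐ[circleMeasure]
      fun k => conj (phiScat lam p k q) := by
  -- the components orthogonal to the waves on the half-lines
  have hx : ∀ w : RelSpace, (∀ m : ℤ, ⟪antiKet (2, 2 * m + 0), w⟫_ℂ = 0) →
      ((scatSynthesis lam p χa χb)†) w =
        ⟪antiKet (0, 0), w⟫_ℂ • χa + ⟪antiKet (1, 0), w⟫_ℂ • χb := by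
    intro w hw
    rw [scatSynthesis_adjoint_apply, synthesis_adjoint_eq_zero _ _ fun m _ => hw m,
      synthesis_adjoint_eq_zero _ _ fun m _ => hw m, map_zero, map_zero, add_zero, zero_add]
  have hz : ((0 : MomentumSpace) : ℝ → ℂ) =ᵐ[circleMeasure] fun _ => (0 : ℂ) :=
    Lp.coeFn_zero ℂ 2 circleMeasure
  refine expansion_ket (isAntisymmetric_phiScat lam p) scatExpansion_relAnti ?_ q
  rintro i (rfl | rfl | rfl) y
  · rw [hx _ fun m => by rw [inner_antiKet_antiKet]; simp, inner_antiKet_antiKet,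
      inner_antiKet_antiKet]
    by_cases hy : y = 0
    · subst hy
      simpa using ha
    · rw [if_neg (fun h => hy h.2.symm)]
      simp only [phiScat, if_neg hy, Matrix.cons_val, mul_zero, map_zero]
      simpa using hz
  · rw [hx _ fun m => by rw [inner_antiKet_antiKet]; simp, inner_antiKet_antiKet,
      inner_antiKet_antiKet]
    by_cases hy : y = 0
    · subst hy
      simpa using hb
    · rw [if_neg (c := (1 : Fin 6) = 1 ∧ 0 = y) (fun h => hy h.2.symm)]
      simp only [phiScat, if_neg hy, Matrix.cons_val, mul_zero, map_zero]
      simpa using hz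
  · by_cases hy : Even y
    · obtain ⟨m, hm⟩ := hy
      have hy2 : y = 2 * m + 0 := by omega
      subst hy2
      have hm2 : (2 * m + 0) / 2 = m := by omega
      rw [scatSynthesis_adjoint_apply]
      have h0 : ⟪antiKet (0, 0), antiKet (2, 2 * m + 0)⟫_ℂ = 0 := by
        rw [inner_antiKet_antiKet]; simp
      have h1 : ⟪antiKet (1, 0), antiKet (2, 2 * m + 0)⟫_ℂ = 0 := by
        rw [inner_antiKet_antiKet]; simp
      rw [h0, h1, zero_smul, zero_smul, add_zero, add_zero]
      have horth : ∀ s : Set ℤ, m ∉ s → ((synthesis (orthonormal_antiKet_two 0) s)†)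
          (antiKet (2, 2 * m + 0)) = 0 := fun s hs =>
        synthesis_adjoint_eq_zero _ _ fun m' hm' =>
          (orthonormal_antiKet_two 0).2 (fun h => hs (h ▸ hm'))
      have hφ : ∀ k, phiScat lam p k (2, 2 * m + 0) =
          (scatNorm lam p k : ℂ)⁻¹ * scatAmplitude lam p k m := by
        intro k
        simp only [phiScat, Matrix.cons_val, hm2]
        rw [if_pos ⟨m, hm⟩]
      by_cases hm1 : 1 ≤ m
      · rw [synthesis_adjoint_self (orthonormal_antiKet_two 0) {m | 1 ≤ m} hm1,
          horth {m | 1 ≤ m}ᶜ (fun h => h hm1), map_zero, add_zero]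
        filter_upwards [coeFn_mulOp (scatPhase lam p) (measurable_scatPhase lam p)
          (norm_scatPhase_le lam p) (fourierVec m (1 : ℂ)), coeFn_fourierVec m (1 : ℂ)] with k h2 h3
        rw [scatPhaseOp, h2, h3, smul_eq_mul, mul_one, scatPhase_mul_monomial, hφ, scatAmplitude,
          if_pos hm1]
      · rw [synthesis_adjoint_self (orthonormal_antiKet_two 0) {m | 1 ≤ m}ᶜ hm1,
          horth _ hm1, map_zero, zero_add]
        filter_upwards [coeFn_mulOp (fun k => conj (scatPhase lam p k))
          (continuous_conj.measurable.comp (measurable_scatPhase lam p))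
          (fun k => by rw [norm_conj]; exact norm_scatPhase_le lam p k) (fourierVec m (1 : ℂ)),
          coeFn_fourierVec m (1 : ℂ)] with k h2 h3
        rw [scatPhaseConjOp, h2, h3, smul_eq_mul, mul_one, conj_scatPhase_mul_monomial, hφ,
          scatAmplitude, if_neg hm1]
    · rw [hx, inner_antiKet_antiKet, inner_antiKet_antiKet]
      · simp only [phiScat, if_neg hy, Matrix.cons_val, mul_zero, map_zero]
        simpa using hz
      · intro m
        rw [inner_antiKet_antiKet, if_neg, if_neg, sub_zero]
        · rintro ⟨h, -⟩; revert h; decide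
        · rintro ⟨-, rfl⟩; exact hy (by simp)

/-- In the far future the scattering synthesis map is a free wave with the outgoing phase. -/
theorem tendsto_scatSynthesis_outgoing (f : MomentumSpace) :
    Tendsto (fun n : ℕ => scatSynthesis lam p χa χb ((phaseOp 1)^[n] f)
      - synthesis (orthonormal_antiKet_two 0) Set.univ (scatPhaseOp lam p ((phaseOp 1)^[n] f)))
      atTop (𝓝 0) := by
  have hs : ∀ z : ℤ, ∀ᶠ n : ℕ in atTop, z - n * 1 ∉ {m : ℤ | 1 ≤ m} := by
    intro z
    filter_upwards [eventually_ge_atTop z.toNat] with n hn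
    intro h
    have h' : 1 ≤ z - n * 1 := h
    omega
  have h1 := tendsto_synthesis_phaseOp (orthonormal_antiKet_two 0) _ 1 hs (scatPhaseConjOp lam p f)
  have h2 := tendsto_synthesis_phaseOp (orthonormal_antiKet_two 0) _ 1 hs (scatPhaseOp lam p f)
  have h3 := (tendsto_inner_phaseOp χa one_ne_zero f).smul_const (antiKet (0, 0))
  have h4 := (tendsto_inner_phaseOp χb one_ne_zero f).smul_const (antiKet (1, 0))
  have h5 := ((h1.sub h2).add h3).add h4
  rw [sub_zero, zero_smul, zero_smul, add_zero, add_zero] at h5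
  refine h5.congr fun n => ?_
  rw [phaseOp_iterate, scatSynthesis_apply, ← synthesis_add_compl _ {m | 1 ≤ m},
    scatPhaseConjOp_phaseOp, scatPhaseOp_phaseOp]
  abel

/-- In the far past the scattering synthesis map is a free wave with the incoming phase. -/
theorem tendsto_scatSynthesis_incoming (f : MomentumSpace) :
    Tendsto (fun n : ℕ => scatSynthesis lam p χa χb ((phaseOp (-1))^[n] f)
      - synthesis (orthonormal_antiKet_two 0) Set.univ
        (scatPhaseConjOp lam p ((phaseOp (-1))^[n] f)))
      atTop (𝓝 0) := by
  have hs : ∀ z : ℤ, ∀ᶠ n : ℕ in atTop, z - n * (-1) ∉ {m : ℤ | 1 ≤ m}ᶜ := by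
    intro z
    filter_upwards [eventually_ge_atTop (1 - z).toNat] with n hn
    intro h
    refine h ?_
    change 1 ≤ z - n * (-1)
    omega
  have h1 := tendsto_synthesis_phaseOp (orthonormal_antiKet_two 0) _ (-1) hs (scatPhaseOp lam p f)
  have h2 := tendsto_synthesis_phaseOp (orthonormal_antiKet_two 0) _ (-1) hs
    (scatPhaseConjOp lam p f)
  have h3 := (tendsto_inner_phaseOp χa (ε := -1) (by norm_num) f).smul_const (antiKet (0, 0))
  have h4 := (tendsto_inner_phaseOp χb (ε := -1) (by norm_num) f).smul_const (antiKet (1, 0))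
  have h5 := ((h1.sub h2).add h3).add h4
  rw [sub_zero, zero_smul, zero_smul, add_zero, add_zero] at h5
  refine h5.congr fun n => ?_
  rw [phaseOp_iterate, scatSynthesis_apply, ← synthesis_add_compl _ {m | 1 ≤ m},
    scatPhaseConjOp_phaseOp, scatPhaseOp_phaseOp]
  abel

/-- The expansion map of the vectors `φ_s(k)` exists and is a partial isometry onto `L²(-π, π]`;
its initial space contains the even basis vectors of the third internal state. -/
theorem exists_scatExpansion (lam : ℂ) (h0 : coupling lam ≠ 0)
    (hC : Real.cos (coupling lam) ≠ 1) (p : ℝ) :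
    ∃ Φ : RelSpace →L[ℂ] MomentumSpace,
      (∀ q, (Φ (ket q) : ℝ → ℂ) =ᵐ[circleMeasure] fun k => conj (phiScat lam p k q)) ∧
      (∀ v, Φ (relAnti v) = Φ v) ∧
      Φ ∘L Φ† = ContinuousLinearMap.id ℂ MomentumSpace ∧
      ∀ m : ℤ, ∃ f, (Φ†) f = antiKet (2, 2 * m) := by
  obtain ⟨χa, ha⟩ := exists_momentum_eq lam p (s := 1) (Or.inl rfl)
  obtain ⟨χb, hb⟩ := exists_momentum_eq lam p (s := -1) (Or.inr rfl)
  simp only [← phiScat_zero_zero] at ha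
  simp only [← phiScat_one_zero] at hb
  have hket := scatExpansion_ket ha hb
  set E := scatSynthesis lam p χa χb with hE
  have hanti : ∀ v, (E†) (relAnti v) = (E†) v := scatExpansion_relAnti
  have hφ := fun k : ℝ => isImproperEigenvector_phiScat lam h0 p k
  have hrelAnti : ∀ f, relAnti (E f) = E f := by
    intro f
    have h := relAnti_expansion_adjoint hanti f
    rwa [ContinuousLinearMap.adjoint_adjoint] at h
  have hA : ∀ f, E (phaseOp 1 f) = relA lam p (E f) := by
    intro f
    have h := relA_expansion_adjoint lam h0 p hket hφ f
    rw [ContinuousLinearMap.adjoint_adjoint] at h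
    exact h.symm
  have hA' : ∀ f, E (phaseOp (-1) f) = ((relA lam p)†) (E f) := by
    intro f
    have h := relA_adjoint_expansion_adjoint lam h0 p hket hφ hanti f
    rw [ContinuousLinearMap.adjoint_adjoint] at h
    exact h.symm
  refine ⟨E†, hket, hanti, ?_, fun m => ?_⟩
  · rw [ContinuousLinearMap.adjoint_adjoint]
    refine (ContinuousLinearMap.norm_map_iff_adjoint_comp_self _).1
      (norm_eq_of_asymptotic (N := phaseOp 1)
        (E₀ := fun f => synthesis (orthonormal_antiKet_two 0) Set.univ (scatPhaseOp lam p f))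
        (fun f => ?_) (fun f => ?_) (norm_phaseOp 1) tendsto_scatSynthesis_outgoing)
    · rw [hA, norm_relA lam p (hrelAnti f)]
    · rw [norm_synthesis_univ, norm_scatPhaseOp p hC]
  · rw [ContinuousLinearMap.adjoint_adjoint]
    have hfree : ∀ z : ℤ, synthesis (orthonormal_antiKet_two 0) Set.univ (fourierVec z (1 : ℂ)) =
        antiKet (2, 2 * z) := by
      intro z
      rw [synthesis_fourierVec, if_pos (Set.mem_univ z), add_zero]
    have hsynth : ∀ f, relAnti (synthesis (orthonormal_antiKet_two 0) Set.univ f) =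
        synthesis (orthonormal_antiKet_two 0) Set.univ f := by
      intro f
      have h := relAnti_expansion_adjoint (synthesis_adjoint_relAnti 0 Set.univ) f
      rwa [ContinuousLinearMap.adjoint_adjoint] at h
    have hstep : ∀ z : ℤ, z ≠ 1 → relA lam p (antiKet (2, 2 * z)) = antiKet (2, 2 * (z - 1)) := by
      intro z hz
      have h1 : 2 * z ≠ relShift 2 := by
        change 2 * z ≠ 2; omega
      rw [relA_antiKet_of_ne lam h0 p 2 h1, show relPhase p 2 = 1 from rfl, one_smul,
        show 2 * z - relShift 2 = 2 * (z - 1) by change 2 * z - 2 = _; ring]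
    let S : Submodule ℂ RelSpace :=
      LinearMap.eqLocus (relAnti : RelSpace →ₗ[ℂ] RelSpace) LinearMap.id
    by_cases hm : 1 ≤ m
    · -- the backward orbit of `|e₃⟩|2m⟩` is free
      refine ⟨scatPhaseOp lam p (fourierVec m 1), ?_⟩
      have h1 := eq_of_asymptotic (A := (relA lam p)†) (S := S) (E := E) (N := phaseOp (-1))
        (E₀ := fun f => synthesis (orthonormal_antiKet_two 0) Set.univ (scatPhaseConjOp lam p f))
        (f := scatPhaseOp lam p (fourierVec m 1))
        (fun v hv => ⟨relAnti_relA_adjoint lam p v, norm_relA_adjoint lam p hv⟩) hrelAnti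
        (fun f => hsynth _) hA' (fun n => ?_) (tendsto_scatSynthesis_incoming _)
      · rw [h1, scatPhaseConjOp_scatPhaseOp p hC, hfree]
      · rw [phaseOp_iterate, scatPhaseConjOp_phaseOp, scatPhaseConjOp_phaseOp,
          scatPhaseConjOp_phaseOp, scatPhaseConjOp_scatPhaseOp p hC, phaseOp_fourierVec,
          phaseOp_fourierVec, hfree, hfree]
        have h2 := hstep (m - n * -1 - -1) (by omega)
        rw [sub_neg_eq_add, add_sub_cancel_right] at h2
        rw [sub_neg_eq_add (m - n * -1) 1, ← h2, relA_adjoint_relA lam p (relAnti_antiKet _)]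
    · -- the forward orbit of `|e₃⟩|2m⟩` is free
      refine ⟨scatPhaseConjOp lam p (fourierVec m 1), ?_⟩
      have h1 := eq_of_asymptotic (A := relA lam p) (S := S) (E := E) (N := phaseOp 1)
        (E₀ := fun f => synthesis (orthonormal_antiKet_two 0) Set.univ (scatPhaseOp lam p f))
        (f := scatPhaseConjOp lam p (fourierVec m 1))
        (fun v hv => ⟨relAnti_relA lam p v, norm_relA lam p hv⟩) hrelAnti
        (fun f => hsynth _) hA (fun n => ?_) (tendsto_scatSynthesis_outgoing _)
      · rw [h1, scatPhaseOp_scatPhaseConjOp p hC, hfree]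
      · rw [phaseOp_iterate, scatPhaseOp_phaseOp, scatPhaseOp_phaseOp,
          scatPhaseOp_phaseOp, scatPhaseOp_scatPhaseConjOp p hC, phaseOp_fourierVec,
          phaseOp_fourierVec, hfree, hfree, hstep _ (by omega)]

end Scattering

/-! ### States at the origin -/

section Origin

/-- The vector `s (|e₁⟩ - |e₄⟩)|0⟩ / √2 + t (|e₂⟩ - |e₅⟩)|0⟩ / √2`. -/
def originVec (s t : ℂ) : RelSpace := s • antiKet (0, 0) + t • antiKet (1, 0)

theorem relAnti_originVec (s t : ℂ) : relAnti (originVec s t) = originVec s t := by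
  rw [originVec, map_add, map_smul, map_smul, relAnti_antiKet, relAnti_antiKet]

theorem inner_antiKet_originVec (i : Fin 6) (y : ℤ) (hi : i = 0 ∨ i = 1 ∨ i = 2) (s t : ℂ) :
    ⟪antiKet (i, y), originVec s t⟫_ℂ =
      if y = 0 then (if i = 0 then s else if i = 1 then t else 0) else 0 := by
  rw [originVec, inner_add_right, inner_smul_right, inner_smul_right, inner_antiKet_antiKet,
    inner_antiKet_antiKet]
  rcases hi with rfl | rfl | rfl <;> by_cases hy : y = 0 <;> simp [hy]

theorem inner_originVec (s t s' t' : ℂ) :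
    ⟪originVec s t, originVec s' t'⟫_ℂ = conj s * s' + conj t * t' := by
  rw [originVec, inner_add_left, inner_smul_left, inner_smul_left,
    inner_antiKet_originVec _ _ (by simp), inner_antiKet_originVec _ _ (by simp)]
  simp

theorem norm_originVec {s t : ℂ} (h : conj s * s + conj t * t = 1) : ‖originVec s t‖ = 1 := by
  rw [@norm_eq_sqrt_re_inner ℂ, inner_originVec, h]; simp

theorem originVec_mem_spaceD (s t : ℂ) : originVec s t ∈ spaceD := by
  refine mem_spaceD_of_inner (relAnti_originVec s t) (fun y hy => ?_) (fun y hy => ?_)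
    (fun y => ?_)
  · rw [inner_antiKet_originVec _ _ (by simp), if_neg hy]
  · rw [inner_antiKet_originVec _ _ (by simp), if_neg hy]
  · rw [inner_antiKet_originVec _ _ (by simp), if_neg (by omega)]

theorem relA_originVec (lam : ℂ) (h0 : coupling lam ≠ 0) (p : ℝ) (s t : ℂ) :
    relA lam p (originVec s t) =
      originVec (exp (2 * I * p) * s + (cosCoupling lam - 1) / 2 *
          (exp (2 * I * p) * s + exp (-2 * I * p) * t))
        (exp (-2 * I * p) * t + (cosCoupling lam - 1) / 2 *
          (exp (2 * I * p) * s + exp (-2 * I * p) * t))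
      + (I * sinCoupling lam * lam * (exp (2 * I * p) * s + exp (-2 * I * p) * t)) •
        antiKet (2, 0) := by
  rw [originVec, map_add, map_smul, map_smul, relA_antiKet_zero lam h0, relA_antiKet_one lam h0,
    originVec]
  module

theorem inv_sqrt_two_mul_self :
    ((Real.sqrt 2 : ℝ) : ℂ)⁻¹ * ((Real.sqrt 2 : ℝ) : ℂ)⁻¹ = 1 / 2 := by
  rw [← mul_inv, sqrt_two_mul_self]; norm_num

theorem originVec_inv_sqrt_two (s t : ℂ) :
    originVec (((Real.sqrt 2 : ℝ) : ℂ)⁻¹ * s) (((Real.sqrt 2 : ℝ) : ℂ)⁻¹ * t) =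
      (1 / 2 : ℂ) • (s • (ket (0, 0) - ket (3, 0)) + t • (ket (1, 0) - ket (4, 0))) := by
  rw [originVec, antiKet_eq, antiKet_eq, neg_zero, smul_smul, smul_smul, mul_right_comm,
    mul_right_comm _ t, inv_sqrt_two_mul_self, smul_add, smul_smul, smul_smul]
  rfl

theorem phiBound_eq : phiBound = originVec (((Real.sqrt 2 : ℝ) : ℂ)⁻¹ * 1)
    (((Real.sqrt 2 : ℝ) : ℂ)⁻¹ * (-1)) := by
  rw [originVec_inv_sqrt_two, phiBound]
  congr 1
  rw [one_smul, neg_one_smul]; abel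

theorem phiBoundMinus_eq (p : ℝ) : phiBoundMinus p =
    originVec (((Real.sqrt 2 : ℝ) : ℂ)⁻¹ * exp (-I * p))
      (((Real.sqrt 2 : ℝ) : ℂ)⁻¹ * (-exp (I * p))) := by
  rw [originVec_inv_sqrt_two, phiBoundMinus, neg_smul, ← sub_eq_add_neg]

theorem phiBoundPlus_eq (p : ℝ) : phiBoundPlus p =
    originVec (((Real.sqrt 2 : ℝ) : ℂ)⁻¹ * exp (-I * p))
      (((Real.sqrt 2 : ℝ) : ℂ)⁻¹ * exp (I * p)) := by
  rw [originVec_inv_sqrt_two, phiBoundPlus]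

/-- The interaction couples only to the sum of the two amplitudes at the origin. A vector for which
this sum vanishes after the free step evolves freely. -/
theorem relA_originVec_of_add_eq_zero (lam : ℂ) (h0 : coupling lam ≠ 0) (p : ℝ) {s t : ℂ}
    (h : exp (2 * I * p) * s + exp (-2 * I * p) * t = 0) :
    relA lam p (originVec s t) = originVec (exp (2 * I * p) * s) (exp (-2 * I * p) * t) := by
  rw [relA_originVec lam h0, h, mul_zero, mul_zero, zero_smul, add_zero, add_zero, add_zero]

/-- If `√2|λ|` is an odd multiple of `π`, the interaction exchanges the two states at the origin
up to a sign. -/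
theorem relA_originVec_of_cos_eq (lam : ℂ) (h0 : coupling lam ≠ 0) (p : ℝ) (s t : ℂ)
    (hC : cosCoupling lam = -1) (hS : sinCoupling lam = 0) :
    relA lam p (originVec s t) = originVec (-(exp (-2 * I * p) * t)) (-(exp (2 * I * p) * s)) := by
  rw [relA_originVec lam h0, hC, hS, mul_zero, zero_mul, zero_mul, zero_smul, add_zero]
  congr 1 <;> ring

end Origin

/-! ### The spectral resolution -/

section Resolution

theorem list_sum_apply {E : Type*} [NormedAddCommGroup E] [NormedSpace ℂ E] {α : Type*}
    (f : α → E →L[ℂ] E) (L : List α) (v : E) :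
    (L.map f).sum v = (L.map fun b => f b v).sum := by
  induction L with
  | nil => rfl
  | cons a L ih => rw [List.map_cons, List.sum_cons, add_apply, ih, List.map_cons, List.sum_cons]

variable (L : List (ℂ × RelSpace))

theorem sum_rankOne_mem {K : Submodule ℂ RelSpace} (h : ∀ b ∈ L, b.2 ∈ K) (v : RelSpace) :
    (L.map fun b => InnerProductSpace.rankOne ℂ b.2 b.2).sum v ∈ K := by
  rw [list_sum_apply]
  refine list_sum_mem fun x hx => ?_
  obtain ⟨b, hb, rfl⟩ := List.mem_map.1 hx
  exact K.smul_mem _ (h b hb)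

theorem inner_sum_rankOne_of_orthogonal {w : RelSpace} (h : ∀ b ∈ L, ⟪w, b.2⟫_ℂ = 0)
    (v : RelSpace) : ⟪w, (L.map fun b => InnerProductSpace.rankOne ℂ b.2 b.2).sum v⟫_ℂ = 0 := by
  have h1 := sum_rankOne_mem L (K := (Submodule.span ℂ {w})ᗮ)
    (fun b hb => Submodule.mem_orthogonal_singleton_iff_inner_right.2 (h b hb)) v
  exact Submodule.mem_orthogonal_singleton_iff_inner_right.1 h1

theorem inner_sum_rankOne (hn : ∀ b ∈ L, ‖b.2‖ = 1)
    (hp : L.Pairwise fun b b' => ⟪b.2, b'.2⟫_ℂ = 0) (v : RelSpace) : ∀ b ∈ L,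
    ⟪b.2, (L.map fun b => InnerProductSpace.rankOne ℂ b.2 b.2).sum v⟫_ℂ = ⟪b.2, v⟫_ℂ := by
  induction L with
  | nil => intro b hb; simp at hb
  | cons a L ih =>
    rw [List.pairwise_cons] at hp
    intro b hb
    rw [List.map_cons, List.sum_cons, add_apply, inner_add_right, InnerProductSpace.rankOne_apply,
      inner_smul_right]
    rcases List.mem_cons.1 hb with rfl | hb
    · rw [inner_sum_rankOne_of_orthogonal L hp.1, inner_self_eq_norm_sq_to_K,
        hn b List.mem_cons_self]
      simp
    · rw [ih (fun b hb => hn b (List.mem_cons_of_mem _ hb)) hp.2 b hb,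
        inner_eq_zero_symm.1 (hp.1 b hb), mul_zero, zero_add]

theorem map_sum_rankOne (A : RelSpace →L[ℂ] RelSpace) (h : ∀ b ∈ L, A b.2 = b.1 • b.2)
    (v : RelSpace) : A ((L.map fun b => InnerProductSpace.rankOne ℂ b.2 b.2).sum v) =
      (L.map fun b => b.1 • InnerProductSpace.rankOne ℂ b.2 b.2).sum v := by
  induction L with
  | nil => exact map_zero A
  | cons a L ih =>
    rw [List.map_cons, List.sum_cons, add_apply, map_add,
      ih fun b hb => h b (List.mem_cons_of_mem _ hb), List.map_cons, List.sum_cons, add_apply,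
      InnerProductSpace.rankOne_apply, map_smul, h a List.mem_cons_self, smul_comm]
    rfl

variable {L} {lam : ℂ} {p : ℝ}

theorem ae_mul_exp_ne_one (μ : ℂ) : ∀ᵐ k : ℝ ∂circleMeasure, μ * exp (I * k) ≠ 1 := by
  refine ae_restrict_of_ae ?_
  refine Set.Countable.measure_zero ?_ volume
  by_cases h : ∃ k₀ : ℝ, μ * exp (I * k₀) = 1
  · obtain ⟨k₀, hk₀⟩ := h
    refine (Set.countable_range fun n : ℤ => k₀ + n * (2 * Real.pi)).mono fun k hk => ?_
    have hμ : μ ≠ 0 := by rintro rfl; simp at hk₀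
    have h1 := mul_left_cancel₀ hμ ((not_not.1 hk).trans hk₀.symm)
    obtain ⟨n, hn⟩ := exp_eq_exp_iff_exists_int.1 h1
    refine ⟨n, ?_⟩
    have h2 : I * (k : ℂ) = I * ((k₀ + n * (2 * Real.pi) : ℝ) : ℂ) := by
      rw [hn]; push_cast; ring
    exact (ofReal_injective (mul_left_cancel₀ I_ne_zero h2)).symm
  · refine Set.Countable.mono (fun k hk => ?_) Set.countable_empty
    exact h ⟨k, not_not.1 hk⟩

/-- An expansion in improper eigenvectors vanishes on proper eigenvectors, since multiplication
by `e^{-ik}` has no eigenvectors. -/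
theorem expansion_eq_zero_of_eigenvector (h0 : coupling lam ≠ 0) {φ : ℝ → RelIndex → ℂ}
    {Φ : RelSpace →L[ℂ] MomentumSpace}
    (hΦ : ∀ i, (Φ (ket i) : ℝ → ℂ) =ᵐ[circleMeasure] fun k => conj (φ k i))
    (hφ : ∀ k : ℝ, IsImproperEigenvector (relA lam p) (exp (-I * k)) (φ k))
    {b : RelSpace} {μ : ℂ} (hb : relAnti b = b) (hμ : relA lam p b = μ • b) : Φ b = 0 := by
  have h1 : Φ b = μ • phaseOp (-1) (Φ b) := by
    conv_lhs => rw [← relA_adjoint_relA lam p hb, hμ, map_smul, map_smul,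
      expansion_relA_adjoint lam h0 p hΦ hφ]
  rw [Lp.eq_zero_iff_ae_eq_zero]
  have h2 : (Φ b : ℝ → ℂ) =ᵐ[circleMeasure] (μ • phaseOp (-1) (Φ b) : MomentumSpace) := by
    rw [← h1]
  filter_upwards [h2, Lp.coeFn_smul μ (phaseOp (-1) (Φ b)), coeFn_phaseOp (-1) (Φ b),
    ae_mul_exp_ne_one μ] with k h3 h4 h5 h6
  rw [h4, Pi.smul_apply, h5, smul_eq_mul, ← mul_assoc] at h3
  have h7 : (1 - μ * exp (I * k)) * Φ b k = 0 := by
    rw [sub_mul, one_mul, sub_eq_zero]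
    convert h3 using 4
    simp
  exact (mul_eq_zero.1 h7).resolve_left (sub_ne_zero.2 (Ne.symm h6))

theorem expansion_antiKet_eq_zero {φ : ℝ → RelIndex → ℂ} {Φ : RelSpace →L[ℂ] MomentumSpace}
    (hΦ : ∀ i, (Φ (ket i) : ℝ → ℂ) =ᵐ[circleMeasure] fun k => conj (φ k i))
    (hanti : ∀ v, Φ (relAnti v) = Φ v) {q : RelIndex} (hq : ∀ k, φ k q = 0) :
    Φ (antiKet q) = 0 := by
  rw [antiKet, map_smul, hanti]
  have h : Φ (ket q) = 0 := by
    rw [Lp.eq_zero_iff_ae_eq_zero]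
    filter_upwards [hΦ q] with k hk
    rw [hk, hq, map_zero]; rfl
  rw [h, smul_zero]

theorem scatExpansion_adjoint_mem_spaceD {Φ : RelSpace →L[ℂ] MomentumSpace}
    (hΦ : ∀ i, (Φ (ket i) : ℝ → ℂ) =ᵐ[circleMeasure] fun k => conj (phiScat lam p k i))
    (hanti : ∀ v, Φ (relAnti v) = Φ v) (f : MomentumSpace) : (Φ†) f ∈ spaceD := by
  refine mem_spaceD_of_inner (relAnti_expansion_adjoint hanti f) (fun y hy => ?_)
    (fun y hy => ?_) (fun y => ?_) <;>
  rw [ContinuousLinearMap.adjoint_inner_right, expansion_antiKet_eq_zero hΦ hanti,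
    inner_zero_left] <;>
  intro k
  · simp [phiScat, hy]
  · simp [phiScat, hy]
  · have h : ¬ Even (2 * y + 1) := by simp
    simp [phiScat, h]

/-- A vector in `spaceD` orthogonal to the scattering states is concentrated at the origin. If
`sin(√2|λ|) ≠ 0`, the collision connects the waves with the states at the origin, and orthogonality
to `A(p)|e₃⟩|2⟩` and `A(p)†|e₃⟩|0⟩` gives a linear equation each for the two amplitudes. -/
theorem eq_originVec_of_expansion_eq_zero (h0 : coupling lam ≠ 0)
    {Φ : RelSpace →L[ℂ] MomentumSpace}
    (hΦ : ∀ i, (Φ (ket i) : ℝ → ℂ) =ᵐ[circleMeasure] fun k => conj (phiScat lam p k i))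
    (hanti : ∀ v, Φ (relAnti v) = Φ v) (hg : ∀ m : ℤ, ∃ f, (Φ†) f = antiKet (2, 2 * m))
    {v : RelSpace} (hv : v ∈ spaceD) (hv0 : Φ v = 0) :
    ∃ s t : ℂ, v = originVec s t ∧ (Real.sin (coupling lam) ≠ 0 →
      s + t = 0 ∧ exp (2 * I * p) * s + exp (-2 * I * p) * t = 0) := by
  have hφ := fun k : ℝ => isImproperEigenvector_phiScat lam h0 p k
  obtain ⟨hvanti, hvA, hvB, hvC⟩ := (mem_spaceD_iff v).1 hv
  have horth : ∀ f, ⟪(Φ†) f, v⟫_ℂ = 0 := fun f => by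
    rw [ContinuousLinearMap.adjoint_inner_left, hv0, inner_zero_right]
  have hsv : v = originVec ⟪antiKet (0, 0), v⟫_ℂ ⟪antiKet (1, 0), v⟫_ℂ := by
    rw [← sub_eq_zero]
    refine eq_zero_of_inner_antiKet (by rw [map_sub, hvanti, relAnti_originVec]) ?_
    intro i hi y
    rw [inner_sub_right, inner_antiKet_originVec i y hi, sub_eq_zero]
    rcases hi with rfl | rfl | rfl
    · by_cases hy : y = 0
      · simp [hy]
      · rw [if_neg hy]
        exact (Submodule.mem_orthogonal _ _).1 hvA _ (antiKet_mem_spaceA hy)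
    · by_cases hy : y = 0
      · simp [hy]
      · rw [if_neg hy]
        exact (Submodule.mem_orthogonal _ _).1 hvB _ (antiKet_mem_spaceB hy)
    · have h1 : ⟪antiKet (2, y), v⟫_ℂ = 0 := by
        rcases Int.even_or_odd' y with ⟨m, rfl | rfl⟩
        · obtain ⟨f, hf⟩ := hg m
          rw [← hf, horth]
        · exact (Submodule.mem_orthogonal _ _).1 hvC _ (antiKet_mem_spaceC m)
      rw [h1]; simp
  refine ⟨_, _, hsv, fun hsin => ?_⟩
  generalize ⟪antiKet (0, 0), v⟫_ℂ = s at hsv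
  generalize ⟪antiKet (1, 0), v⟫_ℂ = t at hsv
  have hlam : lam ≠ 0 := by
    rintro rfl
    exact h0 (by simp [coupling])
  have hS : sinCoupling lam ≠ 0 :=
    div_ne_zero (by exact_mod_cast hsin) (by exact_mod_cast h0)
  have h20 : ∀ s t : ℂ, ⟪antiKet (2, 0), originVec s t⟫_ℂ = 0 := fun s t => by
    rw [inner_antiKet_originVec _ _ (by simp)]; simp
  constructor
  · obtain ⟨f, hf⟩ := hg 1
    have h1 := horth (phaseOp 1 f)
    rw [← relA_expansion_adjoint lam h0 p hΦ hφ, hf, mul_one, relA_antiKet_two_two lam h0, hsv,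
      inner_add_left, inner_smul_left, h20, mul_zero, zero_add, inner_smul_left, inner_add_left,
      inner_antiKet_originVec _ _ (by simp), inner_antiKet_originVec _ _ (by simp)] at h1
    have h2 : conj (I * sinCoupling lam * conj lam) ≠ 0 := by
      rw [map_ne_zero]
      exact mul_ne_zero (mul_ne_zero I_ne_zero hS) ((map_ne_zero _).2 hlam)
    simpa using (mul_eq_zero.1 h1).resolve_left h2
  · obtain ⟨f, hf⟩ := hg 0
    have h1 := horth (phaseOp (-1) f)
    rw [← relA_adjoint_expansion_adjoint lam h0 p hΦ hφ hanti, hf,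
      ContinuousLinearMap.adjoint_inner_left, hsv, relA_originVec lam h0, mul_zero,
      inner_add_right, h20, zero_add, inner_smul_right, inner_antiKet_antiKet] at h1
    have h2 : I * sinCoupling lam * lam ≠ 0 := mul_ne_zero (mul_ne_zero I_ne_zero hS) hlam
    have h3 : (2 : Fin 6) ≠ 2 + 3 := by decide
    simp only [true_and, if_true, h3, false_and, if_false, sub_zero, mul_one] at h1
    exact (mul_eq_zero.1 h1).resolve_left h2

/-- The part of `spaceD` not reached by the scattering states is spanned by the bound states. -/
theorem adjoint_comp_self_eq_sub {Φ : RelSpace →L[ℂ] MomentumSpace}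
    (hΦ : Φ ∘L Φ† = ContinuousLinearMap.id ℂ MomentumSpace) (hD : ∀ f, (Φ†) f ∈ spaceD)
    (hn : ∀ b ∈ L, ‖b.2‖ = 1) (hp : L.Pairwise fun b b' => ⟪b.2, b'.2⟫_ℂ = 0)
    (hb : ∀ b ∈ L, b.2 ∈ spaceD) (hb0 : ∀ b ∈ L, Φ b.2 = 0)
    (hcompl : ∀ v ∈ spaceD, Φ v = 0 → (∀ b ∈ L, ⟪b.2, v⟫_ℂ = 0) → v = 0) :
    Φ† ∘L Φ = spaceD.starProjection -
      (L.map fun b => InnerProductSpace.rankOne ℂ b.2 b.2).sum := by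
  have hΦΦ : ∀ f, Φ ((Φ†) f) = f := fun f =>
    congrArg (fun A : MomentumSpace →L[ℂ] MomentumSpace => A f) hΦ
  refine ContinuousLinearMap.ext fun v => ?_
  have hPv : v - spaceD.starProjection v ∈ spaceDᗮ :=
    Submodule.sub_starProjection_mem_orthogonal v
  have h1 : Φ v = Φ (spaceD.starProjection v) := by
    rw [← sub_eq_zero, ← map_sub]
    refine ext_inner_left ℂ fun f => ?_
    rw [← ContinuousLinearMap.adjoint_inner_left, inner_zero_right]
    exact (Submodule.mem_orthogonal _ _).1 hPv _ (hD f)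
  have h2 : ∀ b ∈ L, ⟪b.2, v⟫_ℂ = ⟪b.2, spaceD.starProjection v⟫_ℂ := by
    intro b hbL
    rw [← sub_eq_zero, ← inner_sub_right]
    exact (Submodule.mem_orthogonal _ _).1 hPv _ (hb b hbL)
  change (Φ†) (Φ v) = spaceD.starProjection v -
    (L.map fun b => InnerProductSpace.rankOne ℂ b.2 b.2).sum v
  rw [eq_sub_iff_add_eq, ← sub_eq_zero]
  refine hcompl _ (Submodule.sub_mem _ (Submodule.add_mem _ (hD _) (sum_rankOne_mem L hb v))
    (Submodule.starProjection_apply_mem _ _)) ?_ fun b hbL => ?_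
  · have h3 : Φ ((L.map fun b => InnerProductSpace.rankOne ℂ b.2 b.2).sum v) = 0 :=
      sum_rankOne_mem L (K := LinearMap.ker (Φ : RelSpace →ₗ[ℂ] MomentumSpace)) hb0 v
    rw [map_sub, map_add, hΦΦ, h3, h1, add_zero, sub_self]
  · rw [inner_sub_right, inner_add_right, ContinuousLinearMap.adjoint_inner_right, hb0 b hbL,
      inner_zero_left, inner_sum_rankOne L hn hp v b hbL, h2 b hbL, zero_add, sub_self]

theorem inner_phaseOp_one (f g : MomentumSpace) :
    ⟪f, phaseOp 1 g⟫_ℂ = ∫ k : ℝ, exp (-I * k) * (conj (f k) * g k) ∂circleMeasure ∧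
      Integrable (fun k : ℝ => exp (-I * k) * (conj (f k) * g k)) circleMeasure := by
  have h : (fun k => ⟪f k, phaseOp 1 g k⟫_ℂ) =ᵐ[circleMeasure]
      fun k : ℝ => exp (-I * k) * (conj (f k) * g k) := by
    filter_upwards [coeFn_phaseOp 1 g] with k hk
    rw [hk, RCLike.inner_apply, show I * (k : ℂ) * ((-1 : ℤ) : ℂ) = -I * k by push_cast; ring]
    ring
  exact ⟨(L2.inner_def _ _).trans (integral_congr_ae h), (L2.integrable_inner f _).congr h⟩

/-- A family of bound states at the origin that exhausts the complement of the scattering states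
yields a spectral resolution. -/
theorem hasSpectralResolution_of_bound (h0 : coupling lam ≠ 0)
    (hC : Real.cos (coupling lam) ≠ 1)
    (hb : ∀ b ∈ L, b.2 ∈ spaceD ∧ ‖b.2‖ = 1 ∧ relA lam p b.2 = b.1 • b.2)
    (hp : L.Pairwise fun b b' => ⟪b.2, b'.2⟫_ℂ = 0)
    (hcompl : ∀ s t : ℂ, (Real.sin (coupling lam) ≠ 0 →
        s + t = 0 ∧ exp (2 * I * p) * s + exp (-2 * I * p) * t = 0) →
      (∀ b ∈ L, ⟪b.2, originVec s t⟫_ℂ = 0) → s = 0 ∧ t = 0) :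
    HasSpectralResolution lam p L := by
  have hφf := fun k : ℝ => isImproperEigenvector_phiFree lam h0 p k
  have hφs := fun k : ℝ => isImproperEigenvector_phiScat lam h0 p k
  obtain ⟨Φ, hΦ, hanti, hiso, hg⟩ := exists_scatExpansion lam h0 hC p
  have hproj : Φ† ∘L Φ = spaceD.starProjection -
      (L.map fun b => InnerProductSpace.rankOne ℂ b.2 b.2).sum := by
    refine adjoint_comp_self_eq_sub hiso (scatExpansion_adjoint_mem_spaceD hΦ hanti)
      (fun b h => (hb b h).2.1) hp (fun b h => (hb b h).1)
      (fun b h => expansion_eq_zero_of_eigenvector h0 hΦ hφs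
        (relAnti_of_mem_spaceD (hb b h).1) (hb b h).2.2) ?_
    intro v hv hv0 hvb
    obtain ⟨s, t, rfl, hst⟩ := eq_originVec_of_expansion_eq_zero h0 hΦ hanti hg hv hv0
    obtain ⟨rfl, rfl⟩ := hcompl s t hst hvb
    rw [originVec, zero_smul, zero_smul, add_zero]
  refine ⟨hb, hp, hφf, hφs, freeExpansion, Φ, isImproperBasis_phiFree, ⟨hΦ, hiso, hproj⟩, ?_⟩
  intro u v
  have hv : relA lam p v = relA lam p (relAnti v) := by
    change relAnti (relJ lam (relFree p (relAnti v))) =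
      relAnti (relJ lam (relFree p (relAnti (relAnti v))))
    rw [relAnti_relAnti]
  have hPc : spaceC.starProjection v = (freeExpansion†) (freeExpansion v) :=
    (congrArg (fun A : RelSpace →L[ℂ] RelSpace => A v) isImproperBasis_phiFree.2.2).symm
  have hPd : spaceD.starProjection v = (Φ†) (Φ v) +
      (L.map fun b => InnerProductSpace.rankOne ℂ b.2 b.2).sum v :=
    (sub_eq_iff_eq_add.1 (congrArg (fun A : RelSpace →L[ℂ] RelSpace => A v) hproj).symm)
  obtain ⟨hf1, hf2⟩ := inner_phaseOp_one (freeExpansion u) (freeExpansion v)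
  obtain ⟨hs1, hs2⟩ := inner_phaseOp_one (Φ u) (Φ v)
  simp only [mul_add]
  rw [integral_add hf2 hs2, ← hf1, ← hs1, hv, ← sum_starProjection, add_apply, add_apply,
    add_apply, map_add, map_add, map_add,
    relA_of_mem_spaceA lam h0 p (Submodule.starProjection_apply_mem _ _),
    relA_of_mem_spaceB lam h0 p (Submodule.starProjection_apply_mem _ _), hPc, hPd, map_add,
    relA_expansion_adjoint lam h0 p freeExpansion_ket hφf,
    relA_expansion_adjoint lam h0 p hΦ hφs,
    map_sum_rankOne L (relA lam p) (fun b h => (hb b h).2.2), inner_add_right, inner_add_right,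
    inner_add_right, inner_add_right, inner_smul_right, inner_smul_right,
    ContinuousLinearMap.adjoint_inner_right, ContinuousLinearMap.adjoint_inner_right]
  ring

end Resolution

/-! ### The bound states -/

section Bound

variable {lam : ℂ} {p : ℝ}

theorem conj_inv_sqrt_two : conj (((Real.sqrt 2 : ℝ) : ℂ)⁻¹) = ((Real.sqrt 2 : ℝ) : ℂ)⁻¹ := by
  rw [map_inv₀, conj_ofReal]

theorem inner_originVec_inv_sqrt_two (s t s' t' : ℂ) :
    ⟪originVec (((Real.sqrt 2 : ℝ) : ℂ)⁻¹ * s) (((Real.sqrt 2 : ℝ) : ℂ)⁻¹ * t),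
      originVec s' t'⟫_ℂ = ((Real.sqrt 2 : ℝ) : ℂ)⁻¹ * (conj s * s' + conj t * t') := by
  rw [inner_originVec, map_mul, map_mul, conj_inv_sqrt_two]; ring

theorem norm_originVec_inv_sqrt_two {s t : ℂ} (h : conj s * s + conj t * t = 2) :
    ‖originVec (((Real.sqrt 2 : ℝ) : ℂ)⁻¹ * s) (((Real.sqrt 2 : ℝ) : ℂ)⁻¹ * t)‖ = 1 := by
  refine norm_originVec ?_
  rw [map_mul, map_mul, conj_inv_sqrt_two]
  linear_combination (conj s * s + conj t * t) * inv_sqrt_two_mul_self + (1 / 2 : ℂ) * h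

theorem exp_I_mul_mul_exp_neg (p : ℝ) : exp (I * p) * exp (-I * p) = 1 := by
  rw [← exp_add]; simp

theorem conj_exp_I_mul_ofReal (p : ℝ) : conj (exp (I * p)) = exp (-I * p) := by
  rw [← conj_exp_neg_I_mul, conj_conj]

theorem hasSpectralResolution_nil (h0 : coupling lam ≠ 0) (hC : Real.cos (coupling lam) ≠ 1)
    (hsin : Real.sin (coupling lam) ≠ 0) (hp : Real.sin (2 * p) ≠ 0) :
    HasSpectralResolution lam p [] := by
  refine hasSpectralResolution_of_bound h0 hC (by simp) List.Pairwise.nil ?_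
  intro s t h _
  obtain ⟨h1, h2⟩ := h hsin
  have h3 : exp (2 * I * p) - exp (-2 * I * p) = 2 * (Real.sin (2 * p) : ℂ) * I := by
    rw [ofReal_sin, Complex.sin,
      show ((2 * p : ℝ) : ℂ) * I = 2 * I * p by push_cast; ring,
      show -((2 * p : ℝ) : ℂ) * I = -2 * I * p by push_cast; ring]
    linear_combination (exp (2 * I * p) - exp (-2 * I * p)) * I_mul_I
  have h4 : s * (2 * (Real.sin (2 * p) : ℂ) * I) = 0 := by
    linear_combination h2 - exp (-2 * I * p) * h1 - s * h3
  have h5 : 2 * (Real.sin (2 * p) : ℂ) * I ≠ 0 :=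
    mul_ne_zero (mul_ne_zero two_ne_zero (by exact_mod_cast hp)) I_ne_zero
  have hs := (mul_eq_zero.1 h4).resolve_right h5
  exact ⟨hs, by rwa [hs, zero_add] at h1⟩

theorem hasSpectralResolution_phiBound (h0 : coupling lam ≠ 0)
    (hC : Real.cos (coupling lam) ≠ 1) (hsin : Real.sin (coupling lam) ≠ 0) {μ : ℂ}
    (h1 : exp (2 * I * p) = μ) (h2 : exp (-2 * I * p) = μ) :
    HasSpectralResolution lam p [(μ, phiBound)] := by
  refine hasSpectralResolution_of_bound h0 hC ?_ (List.pairwise_singleton _ _) ?_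
  · intro b hb
    rw [List.mem_singleton.1 hb]
    change phiBound ∈ spaceD ∧ ‖phiBound‖ = 1 ∧ relA lam p phiBound = μ • phiBound
    rw [phiBound_eq]
    refine ⟨originVec_mem_spaceD _ _, norm_originVec_inv_sqrt_two (by simp; norm_num), ?_⟩
    rw [relA_originVec_of_add_eq_zero lam h0 p (by rw [h1, h2]; ring), h1, h2, originVec,
      originVec, smul_add, smul_smul, smul_smul]
  · intro s t h hb
    obtain ⟨h3, -⟩ := h hsin
    have h4 := hb _ List.mem_cons_self
    change ⟪phiBound, originVec s t⟫_ℂ = 0 at h4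
    rw [phiBound_eq, inner_originVec_inv_sqrt_two] at h4
    have h5 := (mul_eq_zero.1 h4).resolve_left (inv_ne_zero sqrt_two_ne_zero)
    rw [map_neg, map_one] at h5
    exact ⟨by linear_combination (h3 + h5) / 2, by linear_combination (h3 - h5) / 2⟩

theorem hasSpectralResolution_phiBoundMinus_phiBoundPlus (h0 : coupling lam ≠ 0)
    (hC : Real.cos (coupling lam) = -1) (hsin : Real.sin (coupling lam) = 0) :
    HasSpectralResolution lam p [(1, phiBoundMinus p), (-1, phiBoundPlus p)] := by
  have hC' : cosCoupling lam = -1 := by rw [cosCoupling, hC]; simp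
  have hS' : sinCoupling lam = 0 := by rw [sinCoupling, hsin]; simp
  have hp := exp_I_mul_mul_exp_neg p
  have he1 : exp (2 * I * p) * exp (-I * p) = exp (I * p) := by
    rw [← exp_add]; congr 1; ring
  have he2 : exp (-2 * I * p) * exp (I * p) = exp (-I * p) := by
    rw [← exp_add]; congr 1; ring
  refine hasSpectralResolution_of_bound h0 (by rw [hC]; norm_num) ?_ ?_ ?_
  · intro b hb
    rcases List.mem_cons.1 hb with rfl | hb
    · change phiBoundMinus p ∈ spaceD ∧ ‖phiBoundMinus p‖ = 1 ∧
        relA lam p (phiBoundMinus p) = (1 : ℂ) • phiBoundMinus p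
      rw [phiBoundMinus_eq]
      refine ⟨originVec_mem_spaceD _ _, norm_originVec_inv_sqrt_two ?_, ?_⟩
      · rw [map_neg, conj_exp_neg_I_mul, conj_exp_I_mul_ofReal]
        linear_combination 2 * hp
      · rw [relA_originVec_of_cos_eq lam h0 p _ _ hC' hS', one_smul]
        congr 1
        · linear_combination ((Real.sqrt 2 : ℝ) : ℂ)⁻¹ * he2
        · linear_combination -((Real.sqrt 2 : ℝ) : ℂ)⁻¹ * he1
    · rw [List.mem_singleton.1 hb]
      change phiBoundPlus p ∈ spaceD ∧ ‖phiBoundPlus p‖ = 1 ∧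
        relA lam p (phiBoundPlus p) = (-1 : ℂ) • phiBoundPlus p
      rw [phiBoundPlus_eq]
      refine ⟨originVec_mem_spaceD _ _, norm_originVec_inv_sqrt_two ?_, ?_⟩
      · rw [conj_exp_neg_I_mul, conj_exp_I_mul_ofReal]
        linear_combination 2 * hp
      · rw [relA_originVec_of_cos_eq lam h0 p _ _ hC' hS']
        have hneg : ∀ s t : ℂ, (-1 : ℂ) • originVec s t = originVec (-s) (-t) := by
          intro s t
          rw [originVec, originVec]; module
        rw [hneg]
        congr 1
        · linear_combination -((Real.sqrt 2 : ℝ) : ℂ)⁻¹ * he2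
        · linear_combination -((Real.sqrt 2 : ℝ) : ℂ)⁻¹ * he1
  · refine List.pairwise_cons.2 ⟨fun b hb => ?_, List.pairwise_singleton _ _⟩
    rw [List.mem_singleton.1 hb]
    change ⟪phiBoundMinus p, phiBoundPlus p⟫_ℂ = 0
    rw [phiBoundMinus_eq, phiBoundPlus_eq, inner_originVec_inv_sqrt_two, map_neg,
      conj_exp_neg_I_mul, conj_exp_I_mul_ofReal]
    ring
  · intro s t _ hb
    have h1 := hb _ List.mem_cons_self
    have h2 := hb _ (List.mem_cons_of_mem _ List.mem_cons_self)
    change ⟪phiBoundMinus p, originVec s t⟫_ℂ = 0 at h1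
    change ⟪phiBoundPlus p, originVec s t⟫_ℂ = 0 at h2
    rw [phiBoundMinus_eq, inner_originVec_inv_sqrt_two] at h1
    rw [phiBoundPlus_eq, inner_originVec_inv_sqrt_two] at h2
    replace h1 := (mul_eq_zero.1 h1).resolve_left (inv_ne_zero sqrt_two_ne_zero)
    replace h2 := (mul_eq_zero.1 h2).resolve_left (inv_ne_zero sqrt_two_ne_zero)
    rw [map_neg, conj_exp_neg_I_mul, conj_exp_I_mul_ofReal] at h1
    rw [conj_exp_neg_I_mul, conj_exp_I_mul_ofReal] at h2
    constructor
    · linear_combination exp (-I * p) / 2 * (h1 + h2) - s * hp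
    · linear_combination exp (I * p) / 2 * (h2 - h1) - t * hp

end Bound

end

end DiracFCA

theorem mainTheorem1 (lam : ℂ)
    (hlam : ∀ n : ℤ, Real.sqrt 2 * ‖lam‖ ≠ 2 * n * Real.pi) :
    -- `𝐀₂` is unitary on the antisymmetric subspace and is the two-particle sector of the automaton
    (pairA lam)† ∘L pairA lam = antiPair ∧ pairA lam ∘L (pairA lam)† = antiPair ∧
    (∃ W : PairSpace →L[ℂ] Fock,
      (∀ m₁ m₂ : Mode, W (ket (m₁, m₂)) =
        ((Real.sqrt 2 : ℝ) : ℂ)⁻¹ • create m₁ (create m₂ vacuum)) ∧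
      W† ∘L W = antiPair ∧
      (∀ f : Fock, (∃ v, W v = f) ↔ ∀ S : Finset Mode, S.card ≠ 2 → f S = 0) ∧
      ∀ (m₁ m₂ : Mode) (Λ : Finset ℤ), (freeMode m₁).1 ∈ Λ → (freeMode m₂).1 ∈ Λ →
        ((Real.sqrt 2 : ℝ) : ℂ)⁻¹ • automaton lam Λ m₁ (automaton lam Λ m₂ vacuum) =
          W (pairA lam (ket (m₁, m₂)))) ∧
    -- decomposition into the nontrivial part and a part on which the evolution is free
    projQ ∘L pairA lam = pairA lam ∘L projQ ∧
    pairA lam = nontrivialPart lam + trivialPart lam ∧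
    trivialPart lam = (1 - projQ) ∘L (antiPair ∘L freePair ∘L antiPair) ∘L (1 - projQ) ∧
    -- direct integral over the total momentum `p`
    toRelative† ∘L toRelative = projQ ∧
    (∃ U : EllTwo (Fin 6 × ℤ × ℤ) ≃ₗᵢ[ℂ] Lp RelSpace 2 circleMeasure,
      (∀ (i : Fin 6) (y z : ℤ),
        (U (ket (i, y, z)) : ℝ → RelSpace) =ᵐ[circleMeasure] fun p =>
          (((Real.sqrt (2 * Real.pi) : ℝ) : ℂ)⁻¹ * Complex.exp (Complex.I * p * z)) •
            (ket (i, y) : RelSpace)) ∧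
      ∀ v : PairSpace,
        (U (toRelative (nontrivialPart lam v)) : ℝ → RelSpace) =ᵐ[circleMeasure] fun p =>
          relA lam p ((U (toRelative v) : ℝ → RelSpace) p)) ∧
    -- spectral resolution at each total momentum
    ∀ p : ℝ,
      spaceA.starProjection + spaceB.starProjection + spaceC.starProjection
        + spaceD.starProjection = relAnti ∧
      ((∀ n : ℤ, Real.sqrt 2 * ‖lam‖ ≠ n * Real.pi) → (∀ n' : ℤ, 2 * p ≠ n' * Real.pi) →
        HasSpectralResolution lam p []) ∧
      (∀ n' : ℤ, (∀ n : ℤ, Real.sqrt 2 * ‖lam‖ ≠ n * Real.pi) → 2 * p = n' * Real.pi →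
        HasSpectralResolution lam p [((-1 : ℂ) ^ n', phiBound)]) ∧
      (∀ n : ℤ, Real.sqrt 2 * ‖lam‖ = (2 * n + 1) * Real.pi →
        HasSpectralResolution lam p [(1, phiBoundMinus p), (-1, phiBoundPlus p)]) := by
  have h0 : coupling lam ≠ 0 := by
    intro h
    exact hlam 0 (by simpa [coupling] using h)
  have hC : Real.cos (coupling lam) ≠ 1 := by
    intro h
    obtain ⟨n, hn⟩ := (Real.cos_eq_one_iff _).1 h
    exact hlam n (by rw [show Real.sqrt 2 * ‖lam‖ = coupling lam from rfl, ← hn]; ring)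
  refine ⟨(pairA_unitary lam).1, (pairA_unitary lam).2.1,
    ⟨pairToFock, pairToFock_ket, pairToFock_adjoint_comp_self, exists_pairToFock_eq_iff,
      fun m₁ m₂ Λ h1 h2 => automaton_pair lam Λ h1 h2⟩,
    (pairA_commute_projQ lam).eq, pairA_eq_nontrivialPart_add lam, trivialPart_eq lam h0,
    toRelative_adjoint_comp_self,
    ⟨fibreUnitary, fun i y z => ?_, actsFibrewise_nontrivialPart lam h0⟩,
    fun p => ⟨sum_starProjection, fun h1 h2 => ?_, fun n' h1 h2 => ?_, fun n h1 => ?_⟩⟩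
  · rw [fibreUnitary_ket]
    exact coeFn_fourierVec z (ket (i, y))
  · refine hasSpectralResolution_nil h0 hC (fun h => ?_) (fun h => ?_)
    · obtain ⟨n, hn⟩ := Real.sin_eq_zero_iff.1 h
      exact h1 n hn.symm
    · obtain ⟨n, hn⟩ := Real.sin_eq_zero_iff.1 h
      exact h2 n hn.symm
  · have hp : (2 * p : ℂ) = n' * Real.pi := by exact_mod_cast h2
    have hexp : exp (2 * I * p) = (-1 : ℂ) ^ n' := by
      rw [← exp_pi_mul_I, ← exp_int_mul]
      congr 1
      linear_combination I * hp
    refine hasSpectralResolution_phiBound h0 hC (fun h => ?_) hexp ?_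
    · obtain ⟨n, hn⟩ := Real.sin_eq_zero_iff.1 h
      exact h1 n hn.symm
    · rw [show -2 * I * (p : ℂ) = -(2 * I * p) by ring, exp_neg, hexp, ← inv_zpow]
      norm_num
  · have hc : coupling lam = n * (2 * Real.pi) + Real.pi := by
      rw [show coupling lam = Real.sqrt 2 * ‖lam‖ from rfl, h1]; ring
    refine hasSpectralResolution_phiBoundMinus_phiBoundPlus h0 ?_ ?_
    · rw [hc, Real.cos_add_pi, Real.cos_int_mul_two_pi]
    · exact Real.sin_eq_zero_iff.2 ⟨2 * n + 1, by rw [hc]; push_cast; ring⟩
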